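/- All graphs are undirected, without loops or multiple edges, and may be infinite. For a graph $G$ and vertices $x,y$, let $d_G$ be the graph distance and let the interval $I_G(x,y)$ be the set of vertices of all shortest $(x,y)$-paths. A set $C\subseteq V(G)$ is convex if $I_G(x,y)\subseteq C$ for all $x,y\in C$; $co_G(A)$ is the smallest convex set containing $A$; and $\mathcal I_G(A)=\bigcup_{x,y\in A}I_G(x,y)$. A convex subgraph is a non-empty subgraph induced by a convex set. A copoint at a vertex $x$ is a convex set that is maximal with respect to not containing $x$. The pre-hull number $ph(G)$ is the least integer $n\ge 0$ such that $co_G(C\cup\{x\})=\mathcal I_G^{\,n}(C\cup\{x\})$ for each vertex $x$ and each copoint $C$ at $x$ (and $\infty$ if there is no such $n$). The Cartesian product of a family $(G_i)_{i\in I}$ of graphs has vertex set $\prod_i V(G_i)$, two vertices being adjacent if they are adjacent in exactly one coordinate and equal in all the others; the weak Cartesian product at a vertex $a$ is the connected component of the Cartesian product that contains $a$. Hypercubes are the weak Cartesian powers of $K_2$, and a partial cube is a (connected) isometric subgraph of a hypercube. A Peano partial cube is a partial cube all of whose finite convex subgraphs have pre-hull number at most $1$. A median of a triple $(u,v,w)$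 of vertices is an element of $I_G(u,v)\cap I_G(v,w)\cap I_G(w,u)$. A metric triangle is a triple $(x,y,z)$ such that the intervals $I_G(x,y), I_G(y,z), I_G(z,x)$ pairwise intersect only in their common endvertices. A quasi-median of $(u,v,w)$ is a metric triangle $(x,y,z)$ with $d_G(u,v)=d_G(u,x)+d_G(x,y)+d_G(y,v)$, $d_G(v,w)=d_G(v,y)+d_G(y,z)+d_G(z,w)$ and $d_G(w,u)=d_G(w,z)+d_G(z,x)+d_G(x,u)$. A hypertorus is a Cartesian product of a finite family of even cycles at least one of which has length greater than $4$. A hyper-median of $(u,v,w)$ is a quasi-median $(x,y,z)$ of $(u,v,w)$ such that $co_G(\{x,y,z\})$ induces a hypertorus. A hyper-median partial cube is a Peano partial cube in which every triple of vertices has a median or a hyper-median. A set $A$ of vertices of $G$ is gated if for each vertex $x$ of $G$ there is $y\in A$ with $y\in I_G(x,z)$ for every $z\in A$; a gated subgraph is a subgraph induced by a gated set. A graph $G$ is a gated amalgam of $G_0$ and $G_1$ if $G_0$ and $G_1$ are isomorphic to two intersecting gated subgraphs of $G$ whose union is $G$. An induced subgraph $H$ of $G$ is a retract of $G$ if there is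 a map $f:V(G)\to V(H)$ that fixes every vertex of $H$ and satisfies $d_H(f(x),f(y))\le d_G(x,y)$ for all $x,y\in V(G)$. A class of graphs is a variety if it is closed under retracts and Cartesian products. **Theorem.** The class of Peano partial cubes is a variety: it is closed under retracts and under Cartesian products, that is, under Cartesian products of finitely many graphs and under weak Cartesian products of arbitrary families. It is moreover closed under convex subgraphs and under gated amalgams. The same holds for the class of hyper-median partial cubes. -/

import Mathlib

universe u v w

namespace PeanoCubes

open SimpleGraph

/-! Geodesic convexity -/

/-- The geodesic interval `I_G(x, y)`: the vertices lying on the shortest walks from `x` to `y`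
(a walk of length `G.dist x y` is automatically a path). It is empty when `x` and `y` lie in
different components. -/
def interval {V : Type u} (G : SimpleGraph V) (x y : V) : Set V :=
  {z | ∃ p : G.Walk x y, p.length = G.dist x y ∧ z ∈ p.support}

/-- Geodesically convex sets of vertices. -/
def IsConvex {V : Type u} (G : SimpleGraph V) (C : Set V) : Prop :=
  ∀ x ∈ C, ∀ y ∈ C, interval G x y ⊆ C

/-- The convex hull of `A`: the smallest convex set containing `A`. -/
def hull {V : Type u} (G : SimpleGraph V) (A : Set V) : Set V :=
  ⋂₀ {C | IsConvex G C ∧ A ⊆ C}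

/-- The pre-hull operator: the union of the intervals between any two elements of `A`. -/
def preHull {V : Type u} (G : SimpleGraph V) (A : Set V) : Set V :=
  ⋃ x ∈ A, ⋃ y ∈ A, interval G x y

/-- `C` is a copoint at `x`: a convex set that is maximal with respect to not containing `x`. -/
def IsCopoint {V : Type u} (G : SimpleGraph V) (x : V) (C : Set V) : Prop :=
  Maximal (fun D : Set V => IsConvex G D ∧ x ∉ D) C

/-- The pre-hull number: the least `n` such that `n` applications of the pre-hull operator to
`C ∪ {x}` yield its convex hull, for every vertex `x` and every copoint `C` at `x`;
it is `⊤` when there is no such `n`. -/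
noncomputable def preHullNumber {V : Type u} (G : SimpleGraph V) : ℕ∞ :=
  ⨅ (n : ℕ) (_ : ∀ (x : V) (C : Set V), IsCopoint G x C →
    hull G (C ∪ {x}) = (preHull G)^[n] (C ∪ {x})), (n : ℕ∞)

/-- Every finite convex subgraph has pre-hull number at most `1`. -/
def IsPhHomogeneous {V : Type u} (G : SimpleGraph V) : Prop :=
  ∀ S : Set V, S.Finite → IsConvex G S → preHullNumber (G.induce S) ≤ 1

/-! Cartesian products -/

/-- The Cartesian product of a family of graphs. -/
def cartProd {ι : Type v} {V : ι → Type w} (G : ∀ i, SimpleGraph (V i)) :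
    SimpleGraph (∀ i, V i) where
  Adj x y := ∃ j, (G j).Adj (x j) (y j) ∧ ∀ i, i ≠ j → x i = y i
  symm := ⟨fun _ _ ⟨j, h, e⟩ => ⟨j, h.symm, fun i hi => (e i hi).symm⟩⟩
  loopless := ⟨fun _ ⟨_, h, _⟩ => h.ne rfl⟩

/-- The weak Cartesian product at `a`: the connected component of the Cartesian product that
contains `a`. -/
def weakCartProd {ι : Type v} {V : ι → Type w} (G : ∀ i, SimpleGraph (V i)) (a : ∀ i, V i) :
    SimpleGraph {x : ∀ i, V i | (cartProd G).Reachable a x} :=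
  (cartProd G).induce {x | (cartProd G).Reachable a x}

/-! Partial cubes and Peano partial cubes -/

/-- The hypercubes: the weak Cartesian powers of the complete graph with two vertices. -/
abbrev hypercube (ι : Type v) (a : ι → Bool) :=
  weakCartProd (fun _ : ι => (⊤ : SimpleGraph Bool)) a

/-- Partial cubes: the connected graphs that embed isometrically in a hypercube. -/
def IsPartialCube {V : Type u} (G : SimpleGraph V) : Prop :=
  G.Connected ∧ ∃ (ι : Type u) (a : ι → Bool)
    (f : V → {x : ι → Bool | (cartProd fun _ : ι => (⊤ : SimpleGraph Bool)).Reachable a x}),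
      ∀ x y, (hypercube ι a).dist (f x) (f y) = G.dist x y

/-- Peano partial cubes: the ph-homogeneous partial cubes. -/
def IsPeanoPartialCube (V : Type u) (G : SimpleGraph V) : Prop :=
  IsPartialCube G ∧ IsPhHomogeneous G

/-! Hyper-median partial cubes -/

/-- `m` is a median of the triple `(a, b, c)`. -/
def IsMedian {V : Type u} (G : SimpleGraph V) (a b c m : V) : Prop :=
  m ∈ interval G a b ∧ m ∈ interval G b c ∧ m ∈ interval G c a

/-- `(x, y, z)` is a metric triangle: the three intervals pairwise intersect only in their common
endvertices. -/
def IsMetricTriangle {V : Type u} (G : SimpleGraph V) (x y z : V) : Prop :=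
  interval G x y ∩ interval G y z = {y} ∧
  interval G y z ∩ interval G z x = {z} ∧
  interval G z x ∩ interval G x y = {x}

/-- `(x, y, z)` is a quasi-median of `(a, b, c)`. -/
def IsQuasiMedian {V : Type u} (G : SimpleGraph V) (a b c x y z : V) : Prop :=
  IsMetricTriangle G x y z ∧
  G.dist a b = G.dist a x + G.dist x y + G.dist y b ∧
  G.dist b c = G.dist b y + G.dist y z + G.dist z c ∧
  G.dist c a = G.dist c z + G.dist z x + G.dist x a

/-- Hypertori: the Cartesian products of finitely many even cycles, at least one of which has
length greater than `4`. -/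
def IsHypertorus {V : Type u} (G : SimpleGraph V) : Prop :=
  ∃ (n : ℕ) (k : Fin n → ℕ), (∀ i, 4 ≤ 2 * k i) ∧ (∃ i, 4 < 2 * k i) ∧
    Nonempty (G ≃g cartProd fun i => cycleGraph (2 * k i))

/-- `(x, y, z)` is a hyper-median of `(a, b, c)`: a quasi-median whose convex hull induces a
hypertorus. -/
def IsHyperMedian {V : Type u} (G : SimpleGraph V) (a b c x y z : V) : Prop :=
  IsQuasiMedian G a b c x y z ∧ IsHypertorus (G.induce (hull G {x, y, z}))

/-- Hyper-median partial cubes: the Peano partial cubes in which every triple of vertices has a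
median or a hyper-median. -/
def IsHyperMedianPartialCube (V : Type u) (G : SimpleGraph V) : Prop :=
  IsPeanoPartialCube V G ∧ ∀ a b c : V,
    (∃ m, IsMedian G a b c m) ∨ ∃ x y z, IsHyperMedian G a b c x y z

/-! Gated amalgams and retracts -/

/-- `A` is gated: every vertex `x` has a gate `y` in `A`. -/
def IsGated {V : Type u} (G : SimpleGraph V) (A : Set V) : Prop :=
  ∀ x, ∃ y ∈ A, ∀ z ∈ A, y ∈ interval G x z

/-- `G` is the gated amalgam of `G₀` and `G₁`: these are isomorphic to two intersecting gated
(induced) subgraphs of `G` whose union is `G`. -/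
def IsGatedAmalgam {V₀ V₁ V : Type u} (G₀ : SimpleGraph V₀) (G₁ : SimpleGraph V₁)
    (G : SimpleGraph V) : Prop :=
  ∃ A B : Set V, IsGated G A ∧ IsGated G B ∧ (A ∩ B).Nonempty ∧
    A ∪ B = Set.univ ∧ (∀ x y, G.Adj x y → (x ∈ A ∧ y ∈ A) ∨ (x ∈ B ∧ y ∈ B)) ∧
    Nonempty (G₀ ≃g G.induce A) ∧ Nonempty (G₁ ≃g G.induce B)

/-- Contractions: the non-expansive maps for the graph distances, with values in `ℕ∞` so that
vertices in different components are at distance `⊤`. -/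
def IsContraction {V : Type u} {W : Type v} (G : SimpleGraph V) (H : SimpleGraph W)
    (f : V → W) : Prop :=
  ∀ x y, H.edist (f x) (f y) ≤ G.edist x y

/-- The subgraph induced by `S` is a retract of `G`: there is a contraction of `G` onto it that
fixes every element of `S`. -/
def IsRetract {V : Type u} (G : SimpleGraph V) (S : Set V) : Prop :=
  ∃ f : V → S, IsContraction G (G.induce S) f ∧ ∀ s : S, f s = s

/-! Closure properties of a class of graphs -/

/-- Closed under (non-empty) convex subgraphs. -/
def ClosedUnderConvexSubgraphs (P : ∀ V : Type u, SimpleGraph V → Prop) : Prop :=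
  ∀ (V : Type u) (G : SimpleGraph V), P V G →
    ∀ S : Set V, S.Nonempty → IsConvex G S → P S (G.induce S)

/-- Closed under gated amalgams. -/
def ClosedUnderGatedAmalgams (P : ∀ V : Type u, SimpleGraph V → Prop) : Prop :=
  ∀ (V₀ V₁ V : Type u) (G₀ : SimpleGraph V₀) (G₁ : SimpleGraph V₁) (G : SimpleGraph V),
    P V₀ G₀ → P V₁ G₁ → IsGatedAmalgam G₀ G₁ G → P V G

/-- Closed under Cartesian products: of two graphs, of any finite family, and, as weak Cartesian
products, of an arbitrary family. -/
def ClosedUnderCartesianProducts (P : ∀ V : Type u, SimpleGraph V → Prop) : Prop :=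
  (∀ (V₀ V₁ : Type u) (G₀ : SimpleGraph V₀) (G₁ : SimpleGraph V₁),
    P V₀ G₀ → P V₁ G₁ → P (V₀ × V₁) (G₀ □ G₁)) ∧
  (∀ (ι : Type u) [Finite ι] (V : ι → Type u) (G : ∀ i, SimpleGraph (V i)),
    (∀ i, P (V i) (G i)) → P (∀ i, V i) (cartProd G)) ∧
  (∀ (ι : Type u) (V : ι → Type u) (G : ∀ i, SimpleGraph (V i)),
    (∀ i, P (V i) (G i)) → ∀ a : ∀ i, V i,
      P {x : ∀ i, V i | (cartProd G).Reachable a x} (weakCartProd G a))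

/-- Closed under retracts. -/
def ClosedUnderRetracts (P : ∀ V : Type u, SimpleGraph V → Prop) : Prop :=
  ∀ (V : Type u) (G : SimpleGraph V), P V G →
    ∀ S : Set V, IsRetract G S → P S (G.induce S)

/-- Varieties of graphs: the classes closed under retracts and Cartesian products. -/
def IsVariety (P : ∀ V : Type u, SimpleGraph V → Prop) : Prop :=
  ClosedUnderRetracts P ∧ ClosedUnderCartesianProducts P

end PeanoCubes

namespace PeanoCubes

open SimpleGraph

/-! ### Intervals, hulls and induced convex subgraphs -/

section Basic
variable {V : Type u} {G : SimpleGraph V}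

/-! An isometric embedding `φ` in a hypercube turns convexity into a calculus of coordinates:
intervals are cut out by the coordinates in which the ends agree, hulls by halfspaces. Pre-hull
numbers are then traded for the Peano axiom (`IsEmb.isPhHomogeneous_iff`), whose useful form is the
join-hull property: the hull of a convex set and a vertex `u` is the union of the intervals from `u`
to the set. This concerns intervals only, so convex subgraphs inherit it, products have it
coordinatewise, and gated amalgams get it by projecting to both sides.

Retracts are harder: retracting the vertex supplied by the Peano axiom of `G` need not keep it on
the required geodesic. So copoints are examined directly. A copoint at `x` in a finite convex set is
the far side of some coordinate `h`, and the point is that a vertex `y` between two near-side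
vertices with neighbours across `h` lies between any near-side vertex and such a boundary vertex.
Unless `y` is on the boundary itself, `IsEmb.exists_ring` finds two opposite boundary vertices seen
from `y` such that all boundary vertices lie behind one of them. A non-expansive retraction has to
keep the two coordinate sets, so the ring survives in the retract (`Retraction.stable_of_between`).

For hyper-medians, convex subgraphs, amalgams and products again follow from intervals and hulls.
For a retract, the retraction maps a hyper-median of least perimeter to a hyper-median with vertices
in the retract; the whole torus is then fixed by `IsEmb.fix_hypertorus`. There the triangle cuts
every cycle factor into three arcs shorter than half the cycle, distance counting shows that axes go
to axes, and an extremal choice together with idempotence makes every axis fixed. -/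

theorem mem_interval_iff_dist (hG : G.Connected) {x y z : V} :
    z ∈ interval G x y ↔ G.dist x z + G.dist z y = G.dist x y := by
  classical
  constructor
  · rintro ⟨p, hp, hz⟩
    have h1 := congrArg Walk.length (p.take_spec hz)
    rw [Walk.length_append] at h1
    have h2 := dist_le (p.takeUntil z hz)
    have h3 := dist_le (p.dropUntil z hz)
    have h4 := hG.dist_triangle (u := x) (v := z) (w := y)
    omega
  · intro h
    obtain ⟨p, hp⟩ := hG.exists_walk_length_eq_dist x z
    obtain ⟨q, hq⟩ := hG.exists_walk_length_eq_dist z y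
    refine ⟨p.append q, by rw [Walk.length_append, hp, hq, h], ?_⟩
    rw [Walk.mem_support_append_iff]
    exact Or.inl p.end_mem_support

theorem subset_hull (A : Set V) : A ⊆ hull G A :=
  Set.subset_sInter fun _ h => h.2

theorem isConvex_sInter {F : Set (Set V)} (h : ∀ C ∈ F, IsConvex G C) : IsConvex G (⋂₀ F) :=
  fun x hx y hy _ hz C hC => h C hC x (hx C hC) y (hy C hC) hz

theorem isConvex_hull (A : Set V) : IsConvex G (hull G A) :=
  isConvex_sInter fun _ h => h.1

theorem hull_subset {A C : Set V} (hC : IsConvex G C) (h : A ⊆ C) : hull G A ⊆ C :=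
  Set.sInter_subset_of_mem ⟨hC, h⟩

theorem hull_mono {A B : Set V} (h : A ⊆ B) : hull G A ⊆ hull G B :=
  hull_subset (isConvex_hull B) (h.trans (subset_hull B))

theorem IsConvex.inter {A B : Set V} (hA : IsConvex G A) (hB : IsConvex G B) :
    IsConvex G (A ∩ B) :=
  fun x hx y hy _ hz => ⟨hA x hx.1 y hy.1 hz, hB x hx.2 y hy.2 hz⟩

theorem dist_induce_of_isConvex (hG : G.Connected) {S : Set V} (hS : IsConvex G S) (x y : S) :
    ∃ p : (G.induce S).Walk x y, p.length = G.dist x y := by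
  obtain ⟨p, hp⟩ := hG.exists_walk_length_eq_dist (x : V) y
  have h : ∀ z ∈ p.support, z ∈ S := fun z hz => hS x x.2 y y.2 ⟨p, hp, hz⟩
  refine ⟨p.induce S h, ?_⟩
  rw [← hp, ← Walk.length_map (Embedding.induce S).toHom, Walk.map_induce]
  rfl
end Basic

/-! ### Hypercube coordinates: intervals and hulls by halfspaces -/

/-- The coordinates in which two vertices differ. -/
abbrev sep {V : Type u} {ι : Type v} (φ : V → ι → Bool) (x y : V) : Set ι := {i | φ x i ≠ φ y i}

/-- `φ` is an isometric embedding of the connected graph `G` in a hypercube. -/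
structure IsEmb {V : Type u} {ι : Type v} (G : SimpleGraph V) (φ : V → ι → Bool) : Prop where
  conn : G.Connected
  encard_sep : ∀ x y, (sep φ x y).encard = (G.dist x y : ℕ∞)

section Emb
variable {V : Type u} {ι : Type v} {G : SimpleGraph V} {φ : V → ι → Bool}

/-- The edge condition bounds distances below by the number of separating coordinates, and the step
condition produces a walk of that length. Both are local, which is how products and amalgams are
embedded. -/
theorem isEmb_of_step [Nonempty V] (fin : ∀ x y, (sep φ x y).Finite)
    (adj : ∀ x y, G.Adj x y → (sep φ x y).encard ≤ 1)
    (step : ∀ x y, x ≠ y → ∃ z i, G.Adj x z ∧ φ x i ≠ φ y i ∧ φ z i = φ y i ∧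
      ∀ j, j ≠ i → φ z j = φ x j) : IsEmb G φ := by
  have key : ∀ (n : ℕ) (x y : V), (sep φ x y).ncard = n → ∃ p : G.Walk x y, p.length ≤ n := by
    intro n
    induction n with
    | zero =>
      intro x y h
      rw [Set.ncard_eq_zero (fin x y)] at h
      by_cases hxy : x = y
      · subst hxy; exact ⟨Walk.nil, le_rfl⟩
      · obtain ⟨z, i, -, hi, -⟩ := step x y hxy
        have : i ∈ sep φ x y := hi
        simp [h] at this
    | succ n ih =>
      intro x y h
      by_cases hxy : x = y
      · subst hxy; exact ⟨Walk.nil, Nat.zero_le _⟩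
      · obtain ⟨z, i, hz, hi, hzi, hj⟩ := step x y hxy
        have e : sep φ z y = sep φ x y \ {i} := by
          ext j
          by_cases hji : j = i
          · subst hji; simp [hzi]
          · simp [hj j hji, hji]
        have h2 := Set.ncard_sdiff_singleton_add_one (show i ∈ sep φ x y from hi) (fin x y)
        rw [← e] at h2
        obtain ⟨p, hp⟩ := ih z y (by omega)
        exact ⟨Walk.cons hz p, by simp; omega⟩
  have conn : G.Connected :=
    { preconnected := fun x y => ⟨(key _ x y rfl).choose⟩ }
  have low : ∀ (x y : V) (p : G.Walk x y), (sep φ x y).encard ≤ p.length := by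
    intro x y p
    induction p with
    | nil => simp [sep]
    | @cons a b c h p ih =>
      have : sep φ a c ⊆ sep φ a b ∪ sep φ b c := by
        intro i hi
        by_contra hc
        simp only [Set.mem_union, Set.mem_ofPred_eq, not_or, not_not] at hc
        exact hi (hc.1.trans hc.2)
      refine (Set.encard_le_encard this).trans ((Set.encard_union_le _ _).trans ?_)
      rw [Walk.length_cons, Nat.cast_add, add_comm]
      exact add_le_add ih (by simpa using adj a b h)
  refine ⟨conn, fun x y => le_antisymm ?_ ?_⟩
  · obtain ⟨p, hp⟩ := conn.exists_walk_length_eq_dist x y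
    rw [← hp]; exact low x y p
  · obtain ⟨p, hp⟩ := key _ x y rfl
    rw [← (fin x y).cast_ncard_eq]
    exact_mod_cast (dist_le p).trans hp

namespace IsEmb
variable (he : IsEmb G φ)
include he

theorem finite_sep (x y : V) : (sep φ x y).Finite :=
  Set.finite_of_encard_eq_coe (he.encard_sep x y)

theorem ncard_sep (x y : V) : (sep φ x y).ncard = G.dist x y := by
  have := he.encard_sep x y
  rw [← (he.finite_sep x y).cast_ncard_eq] at this
  exact_mod_cast this

/-- `sep φ x y` is the symmetric difference of the other two sets, so the excess of a detour counts
the coordinates crossed twice. -/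
theorem dist_add (x y z : V) : G.dist x z + G.dist z y =
    G.dist x y + 2 * (sep φ x z ∩ sep φ z y).ncard := by
  have h1 := Set.ncard_union_add_ncard_inter (sep φ x z) (sep φ z y) (he.finite_sep _ _)
    (he.finite_sep _ _)
  have h2 : sep φ x z ∪ sep φ z y = sep φ x y ∪ (sep φ x z ∩ sep φ z y) := by
    ext i
    simp only [Set.mem_union, Set.mem_ofPred_eq, Set.mem_inter_iff]
    cases φ x i <;> cases φ y i <;> cases φ z i <;> simp
  have h3 : Disjoint (sep φ x y) (sep φ x z ∩ sep φ z y) := by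
    rw [Set.disjoint_left]
    intro i
    simp only [Set.mem_ofPred_eq, Set.mem_inter_iff]
    cases φ x i <;> cases φ y i <;> cases φ z i <;> simp
  rw [h2, Set.ncard_union_eq h3 (he.finite_sep _ _) ((he.finite_sep _ _).inter_of_left _),
    he.ncard_sep, he.ncard_sep, he.ncard_sep] at h1
  omega

theorem mem_interval {x y z : V} :
    z ∈ interval G x y ↔ ∀ i, φ x i = φ y i → φ z i = φ x i := by
  rw [mem_interval_iff_dist he.conn, he.dist_add]
  have : (sep φ x z ∩ sep φ z y).ncard = 0 ↔ ∀ i, φ x i = φ y i → φ z i = φ x i := by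
    rw [Set.ncard_eq_zero ((he.finite_sep _ _).inter_of_left _), Set.eq_empty_iff_forall_notMem]
    refine forall_congr' fun i => ?_
    simp only [Set.mem_ofPred_eq, Set.mem_inter_iff]
    cases φ x i <;> cases φ y i <;> cases φ z i <;> simp
  rw [← this]; omega

theorem inj {x y : V} (h : ∀ i, φ x i = φ y i) : x = y := by
  rw [← he.conn.dist_eq_zero_iff, ← he.ncard_sep, Set.ncard_eq_zero (he.finite_sep _ _)]
  ext i; simp [h i]

theorem adj_iff {x y : V} : G.Adj x y ↔ ∃ i, φ x i ≠ φ y i ∧ ∀ j, j ≠ i → φ x j = φ y j := by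
  rw [← dist_eq_one_iff_adj, ← he.ncard_sep, Set.ncard_eq_one]
  refine exists_congr fun i => ?_
  rw [Set.ext_iff]
  constructor
  · intro h
    refine ⟨by simpa using h i, fun j hj => ?_⟩
    by_contra hc
    exact hj (by simpa [hc] using h j)
  · rintro ⟨h1, h2⟩ j
    by_cases hj : j = i
    · subst hj; simpa using h1
    · simp [hj, h2 j hj]

theorem isConvex_half (i : ι) (b : Bool) : IsConvex G {x | φ x i = b} := by
  intro x hx y hy z hz
  exact ((he.mem_interval.1 hz) i (hx.trans hy.symm)).trans hx

theorem left_mem (x y : V) : x ∈ interval G x y := he.mem_interval.2 fun _ _ => rfl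
theorem right_mem (x y : V) : y ∈ interval G x y := he.mem_interval.2 fun _ h => h.symm
theorem symm_mem {x y z : V} (h : z ∈ interval G x y) : z ∈ interval G y x := by
  rw [he.mem_interval] at *
  intro i hi; rw [h i hi.symm, hi]

theorem interval_self {x z : V} (h : z ∈ interval G x x) : z = x :=
  he.inj fun i => he.mem_interval.1 h i rfl

theorem interval_trans {x y z t : V} (h : z ∈ interval G x y) (h' : t ∈ interval G x z) :
    t ∈ interval G x y := by
  rw [he.mem_interval] at *
  intro i hi; exact h' i (h i hi).symm

theorem isConvex_interval (x y : V) : IsConvex G (interval G x y) := by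
  intro a ha b hb c hc
  rw [he.mem_interval] at *
  intro i hi
  rw [hc i ((ha i hi).trans (hb i hi).symm), ha i hi]

/-- A property that fails along the way fails first across an edge. -/
theorem exists_exit {Q : V → Prop} {p q : V} (hp : Q p) (hq : ¬ Q q) :
    ∃ a b, a ∈ interval G p q ∧ b ∈ interval G p q ∧ G.Adj a b ∧ Q a ∧ ¬ Q b := by
  obtain ⟨w, hw⟩ := he.conn.exists_walk_length_eq_dist p q
  obtain ⟨d, hd, h1, h2⟩ := w.exists_boundary_dart {x | Q x} hp hq
  exact ⟨d.fst, d.snd, ⟨w, hw, w.dart_fst_mem_support_of_mem_darts hd⟩,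
    ⟨w, hw, w.dart_snd_mem_support_of_mem_darts hd⟩, d.adj, h1, h2⟩

/-- The first step towards a vertex. -/
theorem exists_step {x y : V} (h : x ≠ y) : ∃ z i, G.Adj x z ∧ z ∈ interval G x y ∧
    φ x i ≠ φ y i ∧ φ z i = φ y i ∧ ∀ j, j ≠ i → φ z j = φ x j := by
  obtain ⟨a, z, ha, hz, hadj, rfl, hb⟩ := he.exists_exit (Q := fun t => t = x) rfl h.symm
  obtain ⟨i, hi, hj⟩ := he.adj_iff.1 hadj
  have hz' := he.mem_interval.1 hz i
  have : φ a i ≠ φ y i := fun e => hi (hz' e).symm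
  refine ⟨z, i, hadj, hz, this, ?_, fun j hji => (hj j hji).symm⟩
  revert this hi
  cases φ a i <;> cases φ z i <;> cases φ y i <;> simp

theorem exists_mem_flip {x y : V} {i : ι} (h : φ x i ≠ φ y i) :
    ∃ a b, a ∈ interval G x y ∧ b ∈ interval G x y ∧ φ a i = φ x i ∧ φ b i ≠ φ x i ∧
      ∀ j, j ≠ i → φ a j = φ b j := by
  obtain ⟨a, b, ha, hb, hadj, h1, h2⟩ :=
    he.exists_exit (Q := fun t => φ t i = φ x i) (p := x) (q := y) rfl h.symm
  obtain ⟨k, hk, hj⟩ := he.adj_iff.1 hadj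
  have : i = k := by by_contra hc; exact h2 ((hj i hc).symm.trans h1)
  subst this
  exact ⟨a, b, ha, hb, h1, h2, hj⟩

/-- A point outside a non-empty convex set is separated from it by a halfspace. -/
theorem exists_separation {C : Set V} (hC : IsConvex G C) (hne : C.Nonempty) {y : V}
    (hy : y ∉ C) : ∃ i, ∀ c ∈ C, φ c i ≠ φ y i := by
  obtain ⟨c0, hc0⟩ := hne
  -- The first edge from a nearest vertex `c` towards `y` crosses the required coordinate: a vertex
  -- of `C` beyond it would force the next vertex, which is closer to `y`, into `C`.
  obtain ⟨c, hc, hmin⟩ := WellFounded.has_min (measure fun c => G.dist c y).wf C ⟨c0, hc0⟩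
  have hcy : c ≠ y := by rintro rfl; exact hy hc
  obtain ⟨z, i, hadj, hz, hi, hzi, hj⟩ := he.exists_step hcy
  have hzC : z ∉ C := by
    intro hzC
    apply hmin z hzC
    have h1 := (mem_interval_iff_dist he.conn).1 hz
    have h2 := dist_eq_one_iff_adj.2 hadj
    change G.dist z y < G.dist c y
    omega
  refine ⟨i, fun d hd hdi => hzC (hC c hc d hd ?_)⟩
  rw [he.mem_interval]
  intro j hcd
  by_cases hji : j = i
  · subst hji; exact absurd (hcd.trans hdi) hi
  · exact hj j hji

theorem mem_hull {A : Set V} (hne : A.Nonempty) {y : V} :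
    y ∈ hull G A ↔ ∀ i b, (∀ a ∈ A, φ a i = b) → φ y i = b := by
  constructor
  · intro h i b hA
    exact hull_subset (he.isConvex_half i b) hA h
  · intro h
    by_contra hc
    obtain ⟨i, hi⟩ := he.exists_separation (isConvex_hull A) (hne.mono (subset_hull A)) hc
    have := h i (!φ y i) fun a ha => by
      have := hi a (subset_hull A ha)
      revert this; cases φ a i <;> cases φ y i <;> simp
    revert this; cases φ y i <;> simp

theorem mem_of_isConvex {C : Set V} (hC : IsConvex G C) (hne : C.Nonempty) {y : V}
    (h : ∀ i, (∀ c ∈ C, φ c i ≠ φ y i) → False) : y ∈ C := by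
  by_contra hc
  obtain ⟨i, hi⟩ := he.exists_separation hC hne hc
  exact h i hi

/-- A vertex of the hull differs from `x ∈ A` only in coordinates in which some vertex of `A` does,
and these are finitely many. -/
theorem finite_hull {A : Set V} (hA : A.Finite) : (hull G A).Finite := by
  classical
  rcases A.eq_empty_or_nonempty with rfl | ⟨x, hx⟩
  · exact Set.finite_empty.subset (hull_subset (fun _ h => h.elim) subset_rfl)
  · refine Set.Finite.of_finite_image (f := fun z => sep φ x z)
      ((hA.biUnion fun a _ => he.finite_sep x a).finite_subsets.subset ?_) ?_
    · rintro _ ⟨z, hz, rfl⟩ i hi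
      by_contra hc
      simp only [Set.mem_iUnion, not_exists, Set.mem_ofPred_eq, not_not] at hc
      exact hi ((he.mem_hull ⟨x, hx⟩).1 hz i (φ x i) fun a ha => (hc a ha).symm).symm
    · intro a _ b _ hab
      refine he.inj fun i => ?_
      have : i ∈ sep φ x a ↔ i ∈ sep φ x b := by
        have : sep φ x a = sep φ x b := hab
        rw [this]
      revert this
      simp only [Set.mem_ofPred_eq]
      cases φ x i <;> cases φ a i <;> cases φ b i <;> simp

omit he in
theorem of_dist {W : Type w} {H : SimpleGraph W} (he : IsEmb G φ) (hH : H.Connected) (f : W → V)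
    (hf : ∀ x y, G.dist (f x) (f y) = H.dist x y) : IsEmb H fun x => φ (f x) :=
  ⟨hH, fun x y => by rw [← hf, ← he.encard_sep]⟩

theorem induce_connected {S : Set V} (hS : IsConvex G S) (hne : S.Nonempty) :
    (G.induce S).Connected :=
  { preconnected := fun x y => ⟨(dist_induce_of_isConvex he.conn hS x y).choose⟩
    nonempty := hne.to_subtype }

theorem induce {S : Set V} (hS : IsConvex G S) (hne : S.Nonempty) :
    IsEmb (G.induce S) fun x : S => φ x := by
  refine he.of_dist (he.induce_connected hS hne) Subtype.val fun x y => le_antisymm ?_ ?_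
  · obtain ⟨p, hp⟩ := (he.induce_connected hS hne).exists_walk_length_eq_dist x y
    rw [← hp, ← Walk.length_map (Embedding.induce S).toHom]
    exact dist_le _
  · obtain ⟨p, hp⟩ := dist_induce_of_isConvex he.conn hS x y
    rw [← hp]; exact dist_le p
end IsEmb
end Emb

/-! ### Pre-hull number at most one, join-hull property and Peano axiom -/

/-- The Peano axiom for the geodesic convexity. -/
def PeanoAxiom {V : Type u} (G : SimpleGraph V) : Prop :=
  ∀ u v w x y, x ∈ interval G u w → y ∈ interval G v x → ∃ z ∈ interval G v w, y ∈ interval G u z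

/-- Copoints of finite convex sets have pre-hull number at most one. -/
def PhOne {V : Type u} (G : SimpleGraph V) : Prop :=
  ∀ F : Set V, F.Finite → IsConvex G F → ∀ x ∈ F, ∀ C : Set V,
    Maximal (fun D : Set V => IsConvex G D ∧ D ⊆ F ∧ x ∉ D) C →
      hull G (C ∪ {x}) ⊆ preHull G (C ∪ {x})

/-- The join-hull property inside `F`. -/
def JoinHullOn {V : Type u} (G : SimpleGraph V) (F : Set V) : Prop :=
  ∀ C ⊆ F, IsConvex G C → C.Nonempty → ∀ u ∈ F, ∀ y ∈ hull G (C ∪ {u}), ∃ c ∈ C, y ∈ interval G u c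

namespace IsEmb
variable {V : Type u} {ι : Type v} {G : SimpleGraph V} {φ : V → ι → Bool} (he : IsEmb G φ)
include he

theorem mem_interval_induce {S : Set V} (hS : IsConvex G S) {x y z : S} :
    z ∈ interval (G.induce S) x y ↔ (z : V) ∈ interval G x y := by
  rw [(he.induce hS ⟨x, x.2⟩).mem_interval, he.mem_interval]

theorem isConvex_image {S : Set V} (hS : IsConvex G S) {D : Set S} :
    IsConvex G (Subtype.val '' D) ↔ IsConvex (G.induce S) D := by
  constructor
  · intro h x hx y hy z hz
    obtain ⟨t, ht, e⟩ := h x ⟨x, hx, rfl⟩ y ⟨y, hy, rfl⟩ ((he.mem_interval_induce hS).1 hz)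
    rwa [← Subtype.ext e]
  · rintro h _ ⟨x, hx, rfl⟩ _ ⟨y, hy, rfl⟩ z hz
    exact ⟨⟨z, hS x x.2 y y.2 hz⟩, h x hx y hy ((he.mem_interval_induce hS).2 hz), rfl⟩

theorem image_hull {S : Set V} (hS : IsConvex G S) (A : Set S) :
    Subtype.val '' hull (G.induce S) A = hull G (Subtype.val '' A) := by
  apply Set.Subset.antisymm
  · rintro _ ⟨x, hx, rfl⟩ D ⟨hD, hA⟩
    have : IsConvex (G.induce S) (Subtype.val ⁻¹' D) := by
      intro a ha b hb c hc
      exact hD a ha b hb ((he.mem_interval_induce hS).1 hc)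
    exact hull_subset this (fun a ha => hA ⟨a, ha, rfl⟩) hx
  · exact hull_subset ((he.isConvex_image hS).2 (isConvex_hull A))
      (Set.image_mono (subset_hull A))

theorem image_preHull {S : Set V} (hS : IsConvex G S) (A : Set S) :
    Subtype.val '' preHull (G.induce S) A = preHull G (Subtype.val '' A) := by
  ext z
  simp only [preHull, Set.mem_image, Set.mem_iUnion, exists_prop]
  constructor
  · rintro ⟨z, ⟨x, hx, y, hy, hz⟩, rfl⟩
    exact ⟨x, ⟨x, hx, rfl⟩, y, ⟨y, hy, rfl⟩, (he.mem_interval_induce hS).1 hz⟩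
  · rintro ⟨_, ⟨x, hx, rfl⟩, _, ⟨y, hy, rfl⟩, hz⟩
    exact ⟨⟨z, hS x x.2 y y.2 hz⟩, ⟨x, hx, y, hy, (he.mem_interval_induce hS).2 hz⟩, rfl⟩

theorem subset_preHull (A : Set V) : A ⊆ preHull G A := fun x hx =>
  Set.mem_biUnion hx (Set.mem_biUnion hx (he.left_mem x x))

omit he in
theorem preHull_subset_hull (A : Set V) : preHull G A ⊆ hull G A := by
  intro z hz
  simp only [preHull, Set.mem_iUnion, exists_prop] at hz
  obtain ⟨x, hx, y, hy, hz⟩ := hz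
  exact isConvex_hull A x (subset_hull A hx) y (subset_hull A hy) hz

theorem preHullNumber_le_one_iff : preHullNumber G ≤ 1 ↔
    ∀ (x : V) (C : Set V), IsCopoint G x C → hull G (C ∪ {x}) ⊆ preHull G (C ∪ {x}) := by
  constructor
  · intro h x C hC
    have h' : preHullNumber G < 2 := lt_of_le_of_lt h (by norm_num)
    simp only [preHullNumber, iInf_lt_iff] at h'
    obtain ⟨n, hn, hn2⟩ := h'
    have : n < 2 := by exact_mod_cast hn2
    interval_cases n
    · rw [hn x C hC]; exact he.subset_preHull _
    · rw [hn x C hC]; rfl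
  · intro h
    refine (iInf₂_le 1 fun x C hC => ?_).trans (by simp)
    exact (h x C hC).antisymm (preHull_subset_hull _)

/-- Moves the condition from induced subgraphs to convex sets inside `G`, where different sets `F`
can be compared. -/
theorem phOne_iff : IsPhHomogeneous G ↔ PhOne G := by
  refine forall_congr' fun S => forall_congr' fun hfin => forall_congr' fun hS => ?_
  rcases S.eq_empty_or_nonempty with rfl | hne
  · refine iff_of_true ?_ fun x hx => hx.elim
    refine (iInf₂_le 0 fun x C hC => x.2.elim).trans (by simp)
  rw [(he.induce hS hne).preHullNumber_le_one_iff]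
  have key : ∀ (x : S) (D : Set S), (IsConvex (G.induce S) D ∧ x ∉ D) ↔
      (IsConvex G (Subtype.val '' D) ∧ Subtype.val '' D ⊆ S ∧ (x : V) ∉ Subtype.val '' D) := by
    intro x D
    rw [he.isConvex_image hS]
    simp
  have hsub : ∀ D ⊆ S, Subtype.val '' ((Subtype.val ⁻¹' D : Set S)) = D := by
    intro D hD; simpa using hD
  constructor
  · intro h x hx C hC
    have h2 := h ⟨x, hx⟩ (Subtype.val ⁻¹' C) ⟨(key _ _).2 (by
      rw [hsub C hC.prop.2.1]; exact hC.prop), fun D hD hle => by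
        have := hC.le_of_ge ((key _ _).1 hD) (by
          rw [← hsub C hC.prop.2.1]; exact Set.image_mono hle)
        exact fun d hd => this ⟨d, hd, rfl⟩⟩
    have h3 := Set.image_mono (f := Subtype.val) h2
    rwa [he.image_hull hS, he.image_preHull hS, Set.image_union, hsub C hC.prop.2.1,
      Set.image_singleton] at h3
  · intro h x C hC
    have h2 := h x x.2 (Subtype.val '' C) ⟨(key _ _).1 hC.prop, fun D hD hle => by
      have := hC.le_of_ge (y := Subtype.val ⁻¹' D) ((key _ _).2 (by rwa [hsub D hD.2.1]))
        (fun d hd => hle ⟨d, hd, rfl⟩)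
      rw [← hsub D hD.2.1]
      exact Set.image_mono this⟩
    rw [← Set.image_singleton, ← Set.image_union, ← he.image_hull hS, ← he.image_preHull hS] at h2
    exact (Set.image_subset_image_iff Subtype.val_injective).1 h2

/-- The union of the intervals is convex by using the Peano axiom twice: once to reach a vertex `z`
between `b` and `c`, once more to push `z` to a vertex between `c` and `d`. -/
theorem joinHull (hP : PeanoAxiom G) {C : Set V} (hC : IsConvex G C) (hne : C.Nonempty) {u y : V}
    (hy : y ∈ hull G (C ∪ {u})) : ∃ c ∈ C, y ∈ interval G u c := by
  refine hull_subset (C := {y | ∃ c ∈ C, y ∈ interval G u c}) ?_ ?_ hy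
  · rintro a ⟨c, hc, ha⟩ b ⟨d, hd, hb⟩ t ht
    obtain ⟨z, hz, htz⟩ := hP u b c a t ha (he.symm_mem ht)
    obtain ⟨z', hz', h'⟩ := hP u c d b z hb (he.symm_mem hz)
    exact ⟨z', hC c hc d hd hz', he.interval_trans h' htz⟩
  · rintro a (ha | rfl)
    · exact ⟨a, ha, he.right_mem _ _⟩
    · obtain ⟨c, hc⟩ := hne
      exact ⟨c, hc, he.left_mem _ _⟩

theorem phOne_of_peanoAxiom (hP : PeanoAxiom G) : PhOne G := by
  intro F _ _ x _ C hC y hy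
  rcases C.eq_empty_or_nonempty with rfl | hne
  · rw [Set.empty_union] at *
    have : IsConvex G {x} := by
      rintro _ rfl _ rfl z hz; exact he.interval_self hz
    exact he.subset_preHull _ (hull_subset this subset_rfl hy)
  · obtain ⟨c, hc, hy⟩ := he.joinHull hP hC.prop.1 hne hy
    exact Set.mem_biUnion (Or.inr rfl) (Set.mem_biUnion (Or.inl hc) hy)

end IsEmb

theorem bool_eq_of_ne_of_ne {a b c : Bool} (h : a ≠ b) (h' : c ≠ b) : a = c := by
  revert h h'; cases a <;> cases b <;> cases c <;> simp

namespace IsEmb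
variable {V : Type u} {ι : Type v} {G : SimpleGraph V} {φ : V → ι → Bool} (he : IsEmb G φ)
include he

/-- Induction on the size of `F`. In a failure choose `C` maximal among the convex sets that violate
the property. Then `F` is the hull of `C` and the bad vertex, and all edges leaving `C` cross one
coordinate `h`. If `C` with one vertex beyond `h` spans `F`, then `C` is a copoint and the pre-hull
hypothesis applies. Otherwise a bad pair at least distance contradicts the induction hypothesis,
used in that span and in a halfspace of `F`. -/
theorem joinHullOn_of_phOne (hph : PhOne G) (F : Set V) (hfin : F.Finite) (hF : IsConvex G F) :
    JoinHullOn G F := by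
  induction hn : F.ncard using Nat.strong_induction_on generalizing F with
  | _ n IH => ?_
  subst hn
  have IH' : ∀ F' : Set V, IsConvex G F' → F' ⊆ F → F' ≠ F → JoinHullOn G F' := fun F' h1 h2 h3 =>
    IH _ (Set.ncard_lt_ncard (h2.ssubset_of_ne h3) hfin) F' (hfin.subset h2) h1 rfl
  let bad : Set V → V → V → Prop := fun C u y =>
    u ∈ F ∧ y ∈ hull G (C ∪ {u}) ∧ ∀ c ∈ C, y ∉ interval G u c
  let Bad : Set V → Prop := fun C => IsConvex G C ∧ C.Nonempty ∧ C ⊆ F ∧ ∃ u y, bad C u y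
  by_contra hcon
  have hBad : ∃ C, Bad C := by
    simp only [JoinHullOn, not_forall] at hcon
    obtain ⟨C, hCF, hC, hne, u, hu, y, hy, hc⟩ := hcon
    exact ⟨C, hC, hne, hCF, u, y, hu, hy, fun c hcC hyc => hc ⟨c, hcC, hyc⟩⟩
  have hBfin : {C | Bad C}.Finite := hfin.finite_subsets.subset fun C hC => hC.2.2.1
  obtain ⟨C, hCmax⟩ := hBfin.exists_maximal hBad
  obtain ⟨hC, hne, hCF, u0, y0, hb0⟩ := hCmax.prop
  have hgood : ∀ D, IsConvex G D → D ⊆ F → C ⊆ D → ¬ D ⊆ C → ∀ u ∈ F, ∀ y ∈ hull G (D ∪ {u}),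
      ∃ c ∈ D, y ∈ interval G u c := by
    intro D hD hDF hCD hn u hu y hy
    by_contra hc
    exact hn (hCmax.le_of_ge (y := D)
      ⟨hD, hne.mono hCD, hDF, u, y, hu, hy, fun c h1 h2 => hc ⟨c, h1, h2⟩⟩ hCD)
  have hull_eq : ∀ u y, bad C u y → hull G (C ∪ {u}) = F := by
    rintro u y ⟨hu, hy, hc⟩
    by_contra hne'
    have hs : C ∪ {u} ⊆ F := Set.union_subset hCF (by simpa using hu)
    obtain ⟨c, h1, h2⟩ := IH' _ (isConvex_hull (C ∪ {u})) (hull_subset hF hs) hne' C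
      (Set.subset_union_left.trans (subset_hull _)) hC hne u (subset_hull _ (Or.inr rfl)) y hy
    exact hc c h1 h2
  have hu_notin : ∀ u y, bad C u y → u ∉ C := by
    rintro u y ⟨hu, hy, hc⟩ huC
    have : y ∈ C := hull_subset hC (Set.union_subset le_rfl (by simpa using huC)) hy
    exact hc y this (he.right_mem _ _)
  -- an exit edge of `C`
  have edge : ∀ e ∈ C, ∀ e' ∈ F, e' ∉ C → ∀ h, φ e h ≠ φ e' h → (∀ j, j ≠ h → φ e j = φ e' j) →
      (∀ c ∈ C, φ c h = φ e h) ∧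
      (∀ u y, bad C u y → φ u h ≠ φ e h) ∧
      (∀ t ∈ hull G (C ∪ {e'}), φ t h = φ e h → t ∈ C) ∧
      (∀ u y, bad C u y → ∃ c1 ∈ hull G (C ∪ {e'}), y ∈ interval G u c1 ∧ φ c1 h ≠ φ e h ∧
        bad C u c1) := by
    intro e heC e' he'F he'C h hh hj
    have h1 : ∀ c ∈ C, φ c h = φ e h := by
      intro d hd
      by_contra hdh
      refine he'C (hC e heC d hd (he.mem_interval.2 fun i hi => ?_))
      by_cases hih : i = h
      · subst hih; exact absurd hi.symm hdh
      · exact (hj i hih).symm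
    have h2 : ∀ u y, bad C u y → φ u h ≠ φ e h := by
      intro u y hb huh
      have : e' ∈ hull G (C ∪ {u}) := by rw [hull_eq u y hb]; exact he'F
      have := (he.mem_hull (hne.mono Set.subset_union_left)).1 this h (φ e h) (by
        rintro a (ha | rfl)
        · exact h1 a ha
        · exact huh)
      exact hh this.symm
    have h3 : ∀ t ∈ hull G (C ∪ {e'}), φ t h = φ e h → t ∈ C := by
      intro t ht hth
      refine he.mem_of_isConvex hC hne fun i hi => ?_
      have hih : i ≠ h := by rintro rfl; exact hi e heC hth.symm
      have := (he.mem_hull (hne.mono Set.subset_union_left)).1 ht i (φ e i) (by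
        rintro a (ha | rfl)
        · exact bool_eq_of_ne_of_ne (hi a ha) (hi e heC)
        · exact (hj i hih).symm)
      exact hi e heC this.symm
    refine ⟨h1, h2, h3, fun u y hb => ?_⟩
    have hs : C ∪ {e'} ⊆ F := Set.union_subset hCF (by simpa using he'F)
    obtain ⟨c1, hc1, hy1⟩ := hgood (hull G (C ∪ {e'})) (isConvex_hull _) (hull_subset hF hs)
      (Set.subset_union_left.trans (subset_hull _)) (fun hh' => he'C (hh' (subset_hull _ (Or.inr rfl))))
      u hb.1 y (hull_mono (Set.union_subset_union_left _
        (Set.subset_union_left.trans (subset_hull _))) hb.2.1)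
    have hc1' : c1 ∉ C := fun hc => hb.2.2 c1 hc hy1
    refine ⟨c1, hc1, hy1, fun hc => hc1' (h3 c1 hc1 hc), hb.1, ?_, fun c hc hcc => ?_⟩
    · rw [hull_eq u y hb]; exact hull_subset hF hs hc1
    · exact hb.2.2 c hc (he.interval_trans hcc hy1)
  have huC0 := hu_notin u0 y0 hb0
  have hne' := hne
  obtain ⟨p0, hp0⟩ := hne'
  obtain ⟨c0, c0', -, hc0', hadj, hc0C, hc0C'⟩ := he.exists_exit (Q := (· ∈ C)) hp0 huC0
  have hc0F : c0' ∈ F := hF p0 (hCF hp0) u0 hb0.1 hc0'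
  obtain ⟨h, hh, hj⟩ := he.adj_iff.1 hadj
  obtain ⟨e1, e2, e3, e4⟩ := edge c0 hc0C c0' hc0F hc0C' h hh hj
  have hs : C ∪ {c0'} ⊆ F := Set.union_subset hCF (by simpa using hc0F)
  have hChF : hull G (C ∪ {c0'}) ⊆ F := hull_subset hF hs
  -- If an exit edge crossed some `h' ≠ h`, the vertex `c1` found for `h` would be on the side of
  -- `C` with respect to `h'`, yet between the two vertices `u0` and `c2` on the other side.
  have nbr : ∀ e ∈ C, ∀ e' ∈ F, e' ∉ C → ∀ h', φ e h' ≠ φ e' h' →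
      (∀ j, j ≠ h' → φ e j = φ e' j) → h' = h := by
    intro e heC e' he'F he'C h' hh' hj'
    obtain ⟨f1, f2, f3, f4⟩ := edge e heC e' he'F he'C h' hh' hj'
    by_contra hhh
    obtain ⟨c1, hc1, hy1, hch, hb1⟩ := e4 u0 y0 hb0
    obtain ⟨c2, hc2, hy2, hch2, hb2⟩ := f4 u0 c1 hb1
    have := (he.mem_hull (hne.mono Set.subset_union_left)).1 hc1 h' (φ e h') (by
      rintro a (ha | rfl)
      · exact f1 a ha
      · rw [← hj h' hhh]; exact f1 c0 hc0C)
    have hu := f2 u0 y0 hb0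
    have := he.mem_interval.1 hy2 h' (bool_eq_of_ne_of_ne hu hch2)
    exact hu (by rw [← this]; assumption)
  -- Here `C` is a copoint at `u0`: a larger convex set in `F` has a vertex beyond `h`, hence
  -- contains `c0'` and then all of `F`.
  by_cases hCh : hull G (C ∪ {c0'}) = F
  · have hcop : Maximal (fun D : Set V => IsConvex G D ∧ D ⊆ F ∧ u0 ∉ D) C := by
      refine ⟨⟨hC, hCF, huC0⟩, fun D ⟨hD, hDF, huD⟩ hCD => ?_⟩
      intro d hd
      by_contra hdC
      have hdh : φ d h ≠ φ c0 h := fun hc => hdC (e3 d (by rw [hCh]; exact hDF hd) hc)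
      have : c0' ∈ D := by
        refine hD c0 (hCD hc0C) d hd (he.mem_interval.2 fun i hi => ?_)
        by_cases hih : i = h
        · subst hih; exact absurd hi.symm hdh
        · exact (hj i hih).symm
      have : hull G (C ∪ {c0'}) ⊆ D := hull_subset hD (Set.union_subset hCD (by simpa using this))
      rw [hCh] at this
      exact huD (this hb0.1)
    have := hph F hfin hF u0 hb0.1 C hcop hb0.2.1
    simp only [preHull, Set.mem_iUnion, exists_prop] at this
    obtain ⟨a, ha, b, hb, hy⟩ := this
    rcases ha with ha | rfl
    · rcases hb with hb | rfl
      · exact hb0.2.2 y0 (hC a ha b hb hy) (he.right_mem _ _)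
      · exact hb0.2.2 a ha (he.symm_mem hy)
    · rcases hb with hb | rfl
      · exact hb0.2.2 b hb hy
      · obtain rfl := he.interval_self hy
        exact hb0.2.2 _ hp0 (he.left_mem _ _)
  have hJ : JoinHullOn G (hull G (C ∪ {c0'})) := IH' _ (isConvex_hull _) hChF hCh
  -- a closest bad pair
  have hex : ∃ p : V × V, bad C p.1 p.2 ∧ p.2 ∈ hull G (C ∪ {c0'}) := by
    obtain ⟨c1, hc1, hy1, hch, hb1⟩ := e4 u0 y0 hb0
    exact ⟨(u0, c1), hb1, hc1⟩
  obtain ⟨⟨u, y⟩, ⟨hb, hyCh⟩, hmin⟩ := WellFounded.has_min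
    (measure fun p : V × V => G.dist p.1 p.2).wf
    {p : V × V | bad C p.1 p.2 ∧ p.2 ∈ hull G (C ∪ {c0'})} hex
  dsimp only at hb hyCh
  have huy : u ≠ y := by
    rintro rfl; exact hb.2.2 _ hp0 (he.left_mem _ _)
  obtain ⟨u1, x, hadj1, hu1, hx, hx1, hjx⟩ := he.exists_step huy
  have hu1F : u1 ∈ F := hF u hb.1 y (hChF hyCh) hu1
  have hyu1 : y ∈ hull G (C ∪ {u1}) := by
    rw [he.mem_hull (hne.mono Set.subset_union_left)]
    intro i b hi
    by_cases hix : i = x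
    · subst hix; rw [← hx1]; exact hi u1 (Or.inr rfl)
    · refine (he.mem_hull (hne.mono Set.subset_union_left)).1 hb.2.1 i b ?_
      rintro a (ha | rfl)
      · exact hi a (Or.inl ha)
      · rw [← hjx i hix]; exact hi u1 (Or.inr rfl)
  have hg : ∃ c ∈ C, y ∈ interval G u1 c := by
    by_contra hcc
    refine hmin (u1, y) ⟨⟨hu1F, hyu1, fun c h1 h2 => hcc ⟨c, h1, h2⟩⟩, hyCh⟩ ?_
    change G.dist u1 y < G.dist u y
    have h1 := (mem_interval_iff_dist he.conn).1 hu1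
    have h2 := dist_eq_one_iff_adj.2 hadj1
    omega
  have noc : ∀ c ∈ C, y ∈ interval G u1 c → φ c x = φ u x := by
    intro c hc hyc
    by_contra hcx
    refine hb.2.2 c hc (he.mem_interval.2 fun i hi => ?_)
    have hix : i ≠ x := by rintro rfl; exact hcx hi.symm
    rw [he.mem_interval.1 hyc i ((hjx i hix).trans hi), hjx i hix]
  obtain ⟨c, hc, hyc⟩ := hg
  have hcx := noc c hc hyc
  have hBne : (C ∩ {t | φ t x = φ y x}).Nonempty := by
    by_contra hemp
    rw [Set.not_nonempty_iff_eq_empty, Set.eq_empty_iff_forall_notMem] at hemp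
    refine hx ((he.mem_hull (hne.mono Set.subset_union_left)).1 hb.2.1 x (φ u x) ?_).symm
    rintro a (ha | rfl)
    · exact bool_eq_of_ne_of_ne (fun h => hemp a ⟨ha, h⟩) hx
    · rfl
  -- The half of `F` on the side of `y` at `x` misses `u`, so the induction hypothesis applies to
  -- it; the vertex of `C` that it would give is excluded by `noc`.
  have hyB : y ∉ hull G ((C ∩ {t | φ t x = φ y x}) ∪ {u1}) := by
    intro hy
    have : F ∩ {t | φ t x = φ y x} ≠ F := fun h => hx (Set.inter_eq_left.1 h hb.1)
    obtain ⟨c, hc, hcy⟩ := IH' _ (hF.inter (he.isConvex_half x (φ y x))) Set.inter_subset_left this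
      (C ∩ {t | φ t x = φ y x}) (Set.inter_subset_inter_left _ hCF)
      (hC.inter (he.isConvex_half x (φ y x))) hBne u1 ⟨hu1F, hx1⟩ y hy
    exact hx ((noc c hc.1 hcy).symm.trans hc.2)
  rw [he.mem_hull (hBne.mono Set.subset_union_left)] at hyB
  push Not at hyB
  obtain ⟨z, ζ, hz, hyz⟩ := hyB
  have hzx : z ≠ x := by
    rintro rfl; exact hyz (hx1.symm.trans (hz u1 (Or.inr rfl)))
  have huz : φ u z = ζ := by rw [← hjx z hzx]; exact hz u1 (Or.inr rfl)
  have hcz : φ c z ≠ ζ := fun hcz => hyz <| by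
    rw [he.mem_interval.1 hyc z ((hz u1 (Or.inr rfl)).trans hcz.symm), hz u1 (Or.inr rfl)]
  obtain ⟨c2, hc2C, hc2x⟩ := hBne
  have hc2z : φ c2 z = ζ := hz c2 (Or.inl ⟨hc2C, hc2x⟩)
  -- The vertex `c3` of `C` agrees with `u` both at `z` and at `x`. An edge leaving `C` on the way
  -- from `c3` to `u` keeps these two values, and by `nbr` it crosses `h`.
  obtain ⟨a, c3, ha, hc3, haz, hc3z, hac⟩ := he.exists_mem_flip (i := z) (hc2z ▸ hcz)
  have haC := hC c hc c2 hc2C ha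
  have hc3C := hC c hc c2 hc2C hc3
  have hc3z' : φ c3 z = ζ := bool_eq_of_ne_of_ne hc3z hcz.symm
  have hax : φ a x = φ u x := by
    refine bool_eq_of_ne_of_ne (fun hax => ?_) hx
    exact (haz ▸ hcz) (hz a (Or.inl ⟨haC, hax⟩))
  have hc3x : φ c3 x = φ u x := by rw [← hac x hzx.symm]; exact hax
  obtain ⟨e, e', hei, hei', headj, heC, heC'⟩ := he.exists_exit (Q := (· ∈ C)) hc3C (hu_notin u y hb)
  have he'F := hF c3 (hCF hc3C) u hb.1 hei'
  obtain ⟨h', hh', hj'⟩ := he.adj_iff.1 headj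
  obtain rfl := nbr e heC e' he'F heC' h' hh' hj'
  have key : y ∈ hull G (C ∪ {e'}) := by
    rw [he.mem_hull (hne.mono Set.subset_union_left)]
    intro i b hi
    by_cases hih : i = h'
    · subst hih
      exact absurd ((hi e (Or.inl heC)).trans (hi e' (Or.inr rfl)).symm) hh'
    · refine (he.mem_hull (hne.mono Set.subset_union_left)).1 hyCh i b ?_
      rintro a (ha | rfl)
      · exact hi a (Or.inl ha)
      · rw [← hj i hih]; exact hi c0 (Or.inl hc0C)
  have he'Ch : e' ∈ hull G (C ∪ {c0'}) := by
    rw [he.mem_hull (hne.mono Set.subset_union_left)]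
    intro i b hi
    by_cases hih : i = h'
    · subst hih
      exact absurd ((hi c0 (Or.inl hc0C)).trans (hi c0' (Or.inr rfl)).symm) hh
    · rw [← hj' i hih]; exact hi e (Or.inl heC)
  -- The vertex `c4` must be on the side of `y` at `x`, hence has value `ζ` at `z`, as does `e'`.
  -- Then `y` between them has it too, against the choice of `z`.
  obtain ⟨c4, hc4, hyc4⟩ := hJ C (Set.subset_union_left.trans (subset_hull _)) hC hne e' he'Ch y key
  have he'x : φ e' x = φ u x := by rw [he.mem_interval.1 hei' x hc3x, hc3x]
  have he'z : φ e' z = ζ := by rw [he.mem_interval.1 hei' z (hc3z'.trans huz.symm), hc3z']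
  have hc4x : φ c4 x = φ y x := by
    by_contra h4
    have := he.mem_interval.1 hyc4 x (he'x.trans (bool_eq_of_ne_of_ne hx h4))
    exact hx (this.trans he'x).symm
  have hc4z := hz c4 (Or.inl ⟨hc4, hc4x⟩)
  exact hyz ((he.mem_interval.1 hyc4 z (he'z.trans hc4z.symm)).trans he'z)

/-- Everything happens in the finite hull of `u, v, w`, where the join-hull property is applied to
the convex set `interval G v w` and `u`. -/
theorem peanoAxiom_of_phOne (hph : PhOne G) : PeanoAxiom G := by
  intro u v w x y hx hy
  refine he.joinHullOn_of_phOne hph (hull G {u, v, w}) (he.finite_hull (by simp))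
    (isConvex_hull _) (interval G v w) ?_ (he.isConvex_interval v w) ⟨v, he.left_mem v w⟩ u
    (subset_hull _ (by simp)) y ?_
  · exact isConvex_hull _ v (subset_hull _ (by simp)) w (subset_hull _ (by simp))
  · have hv := subset_hull (G := G) (interval G v w ∪ {u}) (Or.inl (he.left_mem v w))
    have hw := subset_hull (G := G) (interval G v w ∪ {u}) (Or.inl (he.right_mem v w))
    have hu := subset_hull (G := G) (interval G v w ∪ {u}) (Or.inr rfl)
    exact isConvex_hull _ v hv x (isConvex_hull _ u hu w hw hx) hy

theorem isPhHomogeneous_iff : IsPhHomogeneous G ↔ PeanoAxiom G := by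
  rw [he.phOne_iff]
  exact ⟨he.peanoAxiom_of_phOne, he.phOne_of_peanoAxiom⟩
end IsEmb

/-! ### Invariance under isomorphism -/

section Iso
variable {V : Type u} {W : Type v} {G : SimpleGraph V} {H : SimpleGraph W}

theorem dist_iso (e : G ≃g H) (x y : V) : H.dist (e x) (e y) = G.dist x y := by
  have h1 : ∀ x y, G.Reachable x y → H.dist (e x) (e y) ≤ G.dist x y := fun x y h => by
    obtain ⟨p, hp⟩ := h.exists_walk_length_eq_dist
    rw [← hp, ← Walk.length_map e.toHom]; exact dist_le _
  by_cases h : G.Reachable x y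
  · refine le_antisymm (h1 x y h) ?_
    obtain ⟨p, hp⟩ := (h.map e.toHom).exists_walk_length_eq_dist
    have h2 := dist_le (p.map e.symm.toHom)
    rw [Walk.length_map, hp] at h2
    have h3 : ∀ x, e.symm.toHom (e.toHom x) = x := fun x => e.symm_apply_apply x
    rw [h3, h3] at h2
    exact h2
  · rw [dist_eq_zero_of_not_reachable h, dist_eq_zero_of_not_reachable]
    intro hc; apply h
    have := hc.map e.symm.toHom
    have h3 : ∀ x, e.symm.toHom (e x) = x := fun x => e.symm_apply_apply x
    rwa [h3, h3] at this

theorem mem_interval_iso (e : G ≃g H) {x y z : V} :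
    e z ∈ interval H (e x) (e y) ↔ z ∈ interval G x y := by
  constructor
  · rintro ⟨p, hp, hz⟩
    have h3 : ∀ x, e.symm.toHom (e x) = x := fun x => e.symm_apply_apply x
    refine ⟨(p.map e.symm.toHom).copy (h3 x) (h3 y), ?_, ?_⟩
    · rw [Walk.length_copy, Walk.length_map, hp, dist_iso]
    · rw [Walk.support_copy, Walk.support_map, List.mem_map]
      exact ⟨_, hz, h3 z⟩
  · rintro ⟨p, hp, hz⟩
    refine ⟨p.map e.toHom, ?_, ?_⟩
    · rw [Walk.length_map, hp]; exact (dist_iso e x y).symm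
    · rw [Walk.support_map, List.mem_map]
      exact ⟨_, hz, rfl⟩

theorem image_interval_iso (e : G ≃g H) (x y : V) :
    interval H (e x) (e y) = e '' interval G x y := by
  ext z
  obtain ⟨z, rfl⟩ := e.surjective z
  rw [mem_interval_iso, e.injective.mem_set_image]

theorem isConvex_image_iso (e : G ≃g H) {C : Set V} : IsConvex H (e '' C) ↔ IsConvex G C := by
  constructor
  · intro h x hx y hy z hz
    have := h (e x) ⟨x, hx, rfl⟩ (e y) ⟨y, hy, rfl⟩ ((mem_interval_iso e).2 hz)
    rwa [e.injective.mem_set_image] at this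
  · rintro h _ ⟨x, hx, rfl⟩ _ ⟨y, hy, rfl⟩ z hz
    obtain ⟨z, rfl⟩ := e.surjective z
    exact ⟨z, h x hx y hy ((mem_interval_iso e).1 hz), rfl⟩

theorem hull_iso (e : G ≃g H) (A : Set V) : hull H (e '' A) = e '' hull G A := by
  apply Set.Subset.antisymm
  · exact hull_subset ((isConvex_image_iso e).2 (isConvex_hull A)) (Set.image_mono (subset_hull A))
  · rintro _ ⟨x, hx, rfl⟩ D ⟨hD, hA⟩
    have h1 : e '' (e ⁻¹' D) = D := Set.image_preimage_eq D e.surjective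
    have : IsConvex G (e ⁻¹' D) := by rwa [← isConvex_image_iso e, h1]
    exact hull_subset this (fun a ha => hA ⟨a, ha, rfl⟩) hx

theorem peanoAxiom_iso (e : G ≃g H) (h : PeanoAxiom G) : PeanoAxiom H := by
  intro u v w x y
  obtain ⟨u, rfl⟩ := e.surjective u
  obtain ⟨v, rfl⟩ := e.surjective v
  obtain ⟨w, rfl⟩ := e.surjective w
  obtain ⟨x, rfl⟩ := e.surjective x
  obtain ⟨y, rfl⟩ := e.surjective y
  rw [mem_interval_iso, mem_interval_iso]
  intro hx hy
  obtain ⟨z, hz, hz'⟩ := h u v w x y hx hy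
  exact ⟨e z, (mem_interval_iso e).2 hz, (mem_interval_iso e).2 hz'⟩

theorem IsEmb.iso {ι : Type w} {φ : V → ι → Bool} (he : IsEmb G φ) (e : G ≃g H) :
    IsEmb H fun x => φ (e.symm x) :=
  he.of_dist (e.connected_iff.1 he.conn) e.symm fun x y => dist_iso e.symm x y
end Iso

/-! ### Coordinates and the Peano axiom in weak Cartesian products -/

section Product
variable {ι : Type v} {V : ι → Type w} {G : ∀ i, SimpleGraph (V i)}

theorem reachable_update [DecidableEq ι] (x : ∀ i, V i) (i : ι) {s t : V i}
    (h : (G i).Reachable s t) :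
    (cartProd G).Reachable (Function.update x i s) (Function.update x i t) := by
  let f : G i →g cartProd G :=
    ⟨fun s => Function.update x i s, fun {a b} hab => ⟨i, by simpa using hab, fun j hj => by
      simp [Function.update_of_ne hj]⟩⟩
  exact h.map f

theorem reachable_cartProd (x y : ∀ i, V i) (hfin : {i | x i ≠ y i}.Finite)
    (h : ∀ i, (G i).Reachable (x i) (y i)) : (cartProd G).Reachable x y := by
  classical
  have key : ∀ s : Finset ι, ∀ x : ∀ i, V i, (∀ i, (G i).Reachable (x i) (y i)) →
      (∀ i, i ∉ s → x i = y i) → (cartProd G).Reachable x y := by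
    intro s
    induction s using Finset.induction_on with
    | empty => intro x _ h; rw [show x = y from funext fun i => h i (by simp)]
    | insert a s ha ih =>
      intro x hr hx
      have h1 := reachable_update x a (hr a)
      rw [Function.update_eq_self] at h1
      refine h1.trans (ih _ (fun i => ?_) fun i hi => ?_)
      · by_cases hia : i = a
        · subst hia; simp
        · rw [Function.update_of_ne hia]; exact hr i
      · by_cases hia : i = a
        · subst hia; simp
        · rw [Function.update_of_ne hia]; exact hx i (by simp [hia, hi])
  refine key hfin.toFinset x h fun i hi => ?_
  simpa using hi

theorem finite_of_reachable {x y : ∀ i, V i} (h : (cartProd G).Reachable x y) :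
    {i | x i ≠ y i}.Finite := by
  obtain ⟨p⟩ := h
  induction p with
  | nil => simp
  | @cons a b c h p ih =>
    obtain ⟨j, hj, hij⟩ := h
    refine (ih.insert j).subset fun i hi => ?_
    by_cases hij' : i = j
    · exact Or.inl hij'
    · refine Or.inr ?_
      rw [Set.mem_ofPred_eq, ← hij i hij']; exact hi

variable {κ : ι → Type u} {φ : ∀ i, V i → κ i → Bool}

theorem isEmb_weakCartProd (he : ∀ i, IsEmb (G i) (φ i)) (a : ∀ i, V i) :
    IsEmb (weakCartProd G a) fun x (p : Σ i, κ i) => φ p.1 (x.1 p.1) p.2 := by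
  classical
  have : Nonempty {x : ∀ i, V i | (cartProd G).Reachable a x} := ⟨⟨a, Reachable.refl a⟩⟩
  refine isEmb_of_step ?_ ?_ ?_
  · intro x y
    have h := finite_of_reachable (x.2.symm.trans y.2)
    refine (h.biUnion (t := fun i => Sigma.mk i '' sep (φ i) (x.1 i) (y.1 i))
      fun i _ => ((he i).finite_sep _ _).image _).subset ?_
    rintro ⟨i, j⟩ hij
    simp only [Set.mem_iUnion]
    refine ⟨i, fun hi => hij ?_, ⟨j, hij, rfl⟩⟩
    change φ i (x.1 i) j = φ i (y.1 i) j
    rw [hi]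
  · rintro x y ⟨i, hadj, hi⟩
    obtain ⟨j, hj, hj'⟩ := (he i).adj_iff.1 hadj
    refine (Set.encard_le_encard (t := {⟨i, j⟩}) ?_).trans (Set.encard_singleton _).le
    rintro ⟨i', j'⟩ h
    have h' : φ i' (x.1 i') j' ≠ φ i' (y.1 i') j' := h
    have : i' = i := by
      by_contra hc
      apply h'
      rw [show x.1 i' = y.1 i' from hi i' hc]
    subst this
    have : j' = j := by
      by_contra hc
      exact h' (hj' j' hc)
    subst this; rfl
  · intro x y hxy
    have : ∃ i, x.1 i ≠ y.1 i := by
      by_contra hc; push Not at hc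
      exact hxy (Subtype.ext (funext hc))
    obtain ⟨i, hi⟩ := this
    obtain ⟨z, j, hadj, -, h1, h2, h3⟩ := (he i).exists_step hi
    have hx : (cartProd G).Adj x.1 (Function.update x.1 i z) :=
      ⟨i, by simpa using hadj, fun k hk => by simp [Function.update_of_ne hk]⟩
    refine ⟨⟨Function.update x.1 i z, x.2.trans hx.reachable⟩, ⟨i, j⟩, hx, h1, by simpa using h2, ?_⟩
    rintro ⟨i', j'⟩ hne
    by_cases hi' : i' = i
    · subst hi'
      simp only [Function.update_self]
      exact h3 j' fun hj => hne (by rw [hj])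
    · simp only [Function.update_of_ne hi']

theorem mem_interval_weakCartProd (he : ∀ i, IsEmb (G i) (φ i)) (a : ∀ i, V i)
    {x y z : {x : ∀ i, V i | (cartProd G).Reachable a x}} :
    z ∈ interval (weakCartProd G a) x y ↔ ∀ i, z.1 i ∈ interval (G i) (x.1 i) (y.1 i) := by
  rw [(isEmb_weakCartProd he a).mem_interval]
  simp only [(he _).mem_interval, Sigma.forall]

theorem mem_weak_of_finite (he : ∀ i, IsEmb (G i) (φ i)) {a : ∀ i, V i} {x : ∀ i, V i}
    (y : {x : ∀ i, V i | (cartProd G).Reachable a x}) (h : {i | y.1 i ≠ x i}.Finite) :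
    (cartProd G).Reachable a x :=
  y.2.trans (reachable_cartProd _ _ h fun i => (he i).conn.preconnected _ _)

theorem finite_ne (a : ∀ i, V i) (x y : {x : ∀ i, V i | (cartProd G).Reachable a x}) :
    {i | x.1 i ≠ y.1 i}.Finite := finite_of_reachable (x.2.symm.trans y.2)

theorem peanoAxiom_weakCartProd (he : ∀ i, IsEmb (G i) (φ i)) (hP : ∀ i, PeanoAxiom (G i))
    (a : ∀ i, V i) : PeanoAxiom (weakCartProd G a) := by
  intro u v w x y hx hy
  rw [mem_interval_weakCartProd he] at hx hy
  choose z hz hz' using fun i => hP i _ _ _ _ _ (hx i) (hy i)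
  -- Where `v` and `w` agree the choice is forced, so `z` differs from `v` in finitely many factors
  -- and stays in the component.
  have : (cartProd G).Reachable a z := by
    refine mem_weak_of_finite he v ((finite_ne a v w).subset ?_)
    intro i hi hvw
    have := hz i
    rw [← hvw] at this
    exact hi ((he i).interval_self this).symm
  refine ⟨⟨z, this⟩, ?_, ?_⟩
  · rw [mem_interval_weakCartProd he]; exact hz
  · rw [mem_interval_weakCartProd he]; exact hz'

/-- A product of finitely many connected graphs is its own weak product. -/
def weakIso [Finite ι] (h : ∀ i, (G i).Connected) (a : ∀ i, V i) : cartProd G ≃g weakCartProd G a where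
  toFun x := ⟨x, reachable_cartProd _ _ (Set.toFinite _) fun i => (h i).preconnected _ _⟩
  invFun x := x.1
  left_inv _ := rfl
  right_inv _ := rfl
  map_rel_iff' := Iff.rfl

end Product

/-- The binary Cartesian product as a product of a family. -/
def boxIso {V₀ V₁ : Type u} (G₀ : SimpleGraph V₀) (G₁ : SimpleGraph V₁) :
    (cartProd fun b : ULift.{u} Bool =>
      (match b with | ⟨true⟩ => ⟨V₀, G₀⟩ | ⟨false⟩ => ⟨V₁, G₁⟩ : Σ V : Type u, SimpleGraph V).2) ≃g
      G₀ □ G₁ where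
  toFun x := (x ⟨true⟩, x ⟨false⟩)
  invFun p b := match b with | ⟨true⟩ => p.1 | ⟨false⟩ => p.2
  left_inv x := by funext ⟨b⟩; cases b <;> rfl
  right_inv p := rfl
  map_rel_iff' := by
    intro x y
    simp only [Equiv.coe_fn_mk, boxProd_adj]
    constructor
    · rintro (⟨h1, h2⟩ | ⟨h1, h2⟩)
      · refine ⟨⟨true⟩, h1, ?_⟩
        rintro ⟨b⟩ hb; cases b
        · exact h2
        · exact absurd rfl hb
      · refine ⟨⟨false⟩, h1, ?_⟩
        rintro ⟨b⟩ hb; cases b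
        · exact absurd rfl hb
        · exact h2
    · rintro ⟨⟨b⟩, h1, h2⟩
      cases b
      · exact Or.inr ⟨h1, h2 ⟨true⟩ (by simp)⟩
      · exact Or.inl ⟨h1, h2 ⟨false⟩ (by simp)⟩

/-! ### Peano partial cubes via embeddings; convex subgraphs and products -/

section Cube

theorem isEmb_bool : IsEmb (⊤ : SimpleGraph Bool) fun b (_ : Unit) => b := by
  refine isEmb_of_step (fun x y => Set.toFinite _) (fun x y _ => ?_) fun x y h => ?_
  · exact (Set.encard_le_encard (Set.subset_univ _)).trans (by simp [Set.encard_univ])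
  · exact ⟨y, (), by simpa using h, h, rfl, fun j hj => absurd rfl hj⟩

/-- A hypercube is a weak product of embedded copies of `K₂`, so its distance counts differing
coordinates; as a product its coordinates are indexed by `Σ _ : ι, Unit`. -/
theorem isPartialCube_iff {V : Type u} {G : SimpleGraph V} :
    IsPartialCube G ↔ ∃ (ι : Type u) (φ : V → ι → Bool), IsEmb G φ := by
  have cube : ∀ (ι : Type u) (a : ι → Bool), IsEmb (hypercube ι a) fun x (p : Σ _ : ι, Unit) => x.1 p.1 :=
    fun ι a => isEmb_weakCartProd (fun _ => isEmb_bool) a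
  constructor
  · rintro ⟨hG, ι, a, f, hf⟩
    exact ⟨_, _, (cube ι a).of_dist hG f hf⟩
  · rintro ⟨ι, φ, he⟩
    obtain ⟨x0⟩ := he.conn.nonempty
    refine ⟨he.conn, ι, φ x0, fun x => ⟨φ x, reachable_cartProd _ _ (he.finite_sep _ _) fun i =>
      isEmb_bool.conn.preconnected _ _⟩, fun x y => ?_⟩
    have h1 := (cube ι (φ x0)).encard_sep ⟨φ x, reachable_cartProd _ _ (he.finite_sep _ _) fun i =>
      isEmb_bool.conn.preconnected _ _⟩ ⟨φ y, reachable_cartProd _ _ (he.finite_sep _ _) fun i =>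
      isEmb_bool.conn.preconnected _ _⟩
    have h2 := he.encard_sep x y
    have h3 : (Equiv.sigmaPUnit ι).symm '' sep φ x y = {p : Σ _ : ι, Unit | φ x p.1 ≠ φ y p.1} := by
      ext ⟨i, u⟩
      simp only [Set.mem_image, Set.mem_ofPred_eq]
      constructor
      · rintro ⟨j, hj, h⟩
        cases h; exact hj
      · exact fun h => ⟨i, h, rfl⟩
    have h4 := (Equiv.sigmaPUnit ι).symm.injective.encard_image (sep φ x y)
    rw [h3, h2] at h4
    have h5 := h1.symm.trans h4
    exact_mod_cast h5

theorem isPeanoPartialCube_iff {V : Type u} {G : SimpleGraph V} :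
    IsPeanoPartialCube V G ↔ ∃ (ι : Type u) (φ : V → ι → Bool), IsEmb G φ ∧ PeanoAxiom G := by
  rw [IsPeanoPartialCube, isPartialCube_iff]
  constructor
  · rintro ⟨⟨ι, φ, he⟩, h⟩
    exact ⟨ι, φ, he, he.isPhHomogeneous_iff.1 h⟩
  · rintro ⟨ι, φ, he, h⟩
    exact ⟨⟨ι, φ, he⟩, he.isPhHomogeneous_iff.2 h⟩

theorem isPeanoPartialCube_iso {V W : Type u} {G : SimpleGraph V} {H : SimpleGraph W} (e : G ≃g H)
    (h : IsPeanoPartialCube V G) : IsPeanoPartialCube W H := by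
  rw [isPeanoPartialCube_iff] at *
  obtain ⟨ι, φ, he, h⟩ := h
  exact ⟨ι, _, he.iso e, peanoAxiom_iso e h⟩

theorem isPeanoPartialCube_induce : ClosedUnderConvexSubgraphs.{u} IsPeanoPartialCube := by
  intro V G h S hne hS
  rw [isPeanoPartialCube_iff] at *
  obtain ⟨ι, φ, he, h⟩ := h
  refine ⟨ι, _, he.induce hS hne, ?_⟩
  intro u v w x y hx hy
  rw [he.mem_interval_induce hS] at hx hy
  obtain ⟨z, hz, hz'⟩ := h u v w x y hx hy
  exact ⟨⟨z, hS v v.2 w w.2 hz⟩, (he.mem_interval_induce hS).2 hz, (he.mem_interval_induce hS).2 hz'⟩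

/-- For isomorphism invariant classes of connected graphs, weak products suffice. -/
theorem closedUnderCartesianProducts_of_weak {P : ∀ V : Type u, SimpleGraph V → Prop}
    (conn : ∀ V G, P V G → G.Connected)
    (iso : ∀ (V W : Type u) (G : SimpleGraph V) (H : SimpleGraph W), G ≃g H → P V G → P W H)
    (weak : ∀ (ι : Type u) (V : ι → Type u) (G : ∀ i, SimpleGraph (V i)),
      (∀ i, P (V i) (G i)) → ∀ a : ∀ i, V i,
        P {x : ∀ i, V i | (cartProd G).Reachable a x} (weakCartProd G a)) :
    ClosedUnderCartesianProducts P := by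
  have fin : ∀ (ι : Type u) [Finite ι] (V : ι → Type u) (G : ∀ i, SimpleGraph (V i)),
      (∀ i, P (V i) (G i)) → P (∀ i, V i) (cartProd G) := by
    intro ι _ V G h
    have a : ∀ i, V i := fun i => (conn _ _ (h i)).nonempty.some
    exact iso _ _ _ _ (weakIso (fun i => conn _ _ (h i)) a).symm (weak ι V G h a)
  refine ⟨fun V₀ V₁ G₀ G₁ h₀ h₁ => iso _ _ _ _ (boxIso G₀ G₁) (fin (ULift Bool) _ _ ?_), fin, weak⟩
  rintro ⟨b⟩
  cases b
  · exact h₁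
  · exact h₀

theorem isPeanoPartialCube_product : ClosedUnderCartesianProducts.{u} IsPeanoPartialCube := by
  refine closedUnderCartesianProducts_of_weak (fun V G h => h.1.1)
    (fun V W G H e h => isPeanoPartialCube_iso e h) fun ι V G h a => ?_
  rw [isPeanoPartialCube_iff]
  choose κ φ he hP using fun i => isPeanoPartialCube_iff.1 (h i)
  exact ⟨_, _, isEmb_weakCartProd he a, peanoAxiom_weakCartProd he hP a⟩
end Cube

/-! ### Gated amalgams -/

theorem bool_eq_or {a b : Bool} (h : a ≠ b) (c : Bool) : c = a ∨ c = b := by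
  revert h; cases a <;> cases b <;> cases c <;> simp

/-- A gate map `g` onto `A`, together with an embedding of the subgraph induced by `A`,
extended along `g`. -/
structure Gate {V : Type u} {κ : Type v} (G : SimpleGraph V) (A : Set V) (g : V → V)
    (p : V → κ → Bool) : Prop where
  conn : G.Connected
  conv : IsConvex G A
  mem : ∀ x, g x ∈ A
  gate : ∀ x, ∀ z ∈ A, g x ∈ interval G x z
  emb : IsEmb (G.induce A) fun a : A => p a
  comp : ∀ x, p (g x) = p x

/-- Going from `x` to `y` through `z` passes its gate `g` twice, which costs `2 * G.dist z g` too
much unless `z` is its own gate. -/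
theorem isConvex_of_isGated {V : Type u} {G : SimpleGraph V} (hG : G.Connected) {A : Set V}
    (hA : IsGated G A) : IsConvex G A := by
  intro x hx y hy z hz
  obtain ⟨g, hg, h⟩ := hA z
  have h1 := (mem_interval_iff_dist hG).1 (h x hx)
  have h2 := (mem_interval_iff_dist hG).1 (h y hy)
  have h3 := (mem_interval_iff_dist hG).1 hz
  have h4 := hG.dist_triangle (u := x) (v := g) (w := y)
  rw [dist_comm (u := x) (v := z)] at h3
  rw [dist_comm (u := x) (v := g)] at h4
  have : G.dist z g = 0 := by omega
  rw [hG.dist_eq_zero_iff] at this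
  rwa [this]

namespace Gate
variable {V : Type u} {κ : Type v} {G : SimpleGraph V} {A : Set V} {g : V → V} {p : V → κ → Bool}
  (ga : Gate G A g p)
include ga

theorem fix {x : V} (hx : x ∈ A) : g x = x := by
  have := (mem_interval_iff_dist ga.conn).1 (ga.gate x x hx)
  simp only [dist_self] at this
  exact ((ga.conn.dist_eq_zero_iff).1 (by omega)).symm

theorem mem_interval_induce {x y z : V} (hx : x ∈ A) (hy : y ∈ A) (hz : z ∈ A) :
    (⟨z, hz⟩ : A) ∈ interval (G.induce A) ⟨x, hx⟩ ⟨y, hy⟩ ↔ z ∈ interval G x y := by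
  have hd : ∀ x y : A, (G.induce A).dist x y = G.dist x y := by
    intro x y
    refine le_antisymm ?_ ?_
    · obtain ⟨p, hp⟩ := dist_induce_of_isConvex ga.conn ga.conv x y
      rw [← hp]; exact dist_le p
    · obtain ⟨p, hp⟩ := ga.emb.conn.exists_walk_length_eq_dist x y
      rw [← hp, ← Walk.length_map (Embedding.induce A).toHom]
      exact dist_le _
  rw [mem_interval_iff_dist ga.conn, mem_interval_iff_dist ga.emb.conn, hd, hd, hd]

theorem mem_interval {x y z : V} (hx : x ∈ A) (hy : y ∈ A) (hz : z ∈ A) :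
    z ∈ interval G x y ↔ ∀ i, p x i = p y i → p z i = p x i := by
  rw [← ga.mem_interval_induce hx hy hz, ga.emb.mem_interval]

theorem inj {x y : V} (hx : x ∈ A) (hy : y ∈ A) (h : ∀ i, p x i = p y i) : x = y :=
  congrArg Subtype.val (ga.emb.inj (x := ⟨x, hx⟩) (y := ⟨y, hy⟩) h)

theorem adj_iff {x y : V} (hx : x ∈ A) (hy : y ∈ A) :
    G.Adj x y ↔ ∃ i, p x i ≠ p y i ∧ ∀ j, j ≠ i → p x j = p y j :=
  ga.emb.adj_iff (x := ⟨x, hx⟩) (y := ⟨y, hy⟩)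

theorem exists_step {x y : V} (hx : x ∈ A) (hy : y ∈ A) (h : x ≠ y) : ∃ z ∈ A, ∃ i, G.Adj x z ∧
    p x i ≠ p y i ∧ p z i = p y i ∧ ∀ j, j ≠ i → p z j = p x j := by
  obtain ⟨z, i, h1, -, h2⟩ := ga.emb.exists_step (x := ⟨x, hx⟩) (y := ⟨y, hy⟩)
    (fun hc => h (congrArg Subtype.val hc))
  exact ⟨z, z.2, i, h1, h2⟩

end Gate

section Amalgam
variable {V : Type u} {κ : Type v} {κ' : Type w} {G : SimpleGraph V} {A B : Set V} {g g' : V → V}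
  {p : V → κ → Bool} {q : V → κ' → Bool} (ga : Gate G A g p) (gb : Gate G B g' q)
  (hAB : (A ∩ B).Nonempty) (hU : A ∪ B = Set.univ)

/-- The coordinates that are constant on `A ∩ B`. -/
def constCoord (A B : Set V) (q : V → κ' → Bool) : Set κ' :=
  {j | ∀ x ∈ A ∩ B, ∀ y ∈ A ∩ B, q x j = q y j}

/-- The combined coordinates of a gated amalgam. -/
def amalgamCoord (A B : Set V) (p : V → κ → Bool) (q : V → κ' → Bool) (x : V) :
    κ ⊕ constCoord A B q → Bool :=
  Sum.elim (p x) fun j => q x j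

include ga gb hAB

omit ga gb in
theorem gate_mem_inter {κ κ'} {g g' : V → V} {p : V → κ → Bool} {q : V → κ' → Bool}
    (ga : Gate G A g p) (gb : Gate G B g' q) {x : V} (hx : x ∈ B) : g x ∈ A ∩ B := by
  obtain ⟨o, ho⟩ := hAB
  exact ⟨ga.mem x, gb.conv x hx o ho.2 (ga.gate x o ho.1)⟩

/-- Some vertex of `A ∩ B` agrees with `x` in `j`, and the gate lies between the two. Hence
coordinates of `B` that vary on `A ∩ B` are already recorded by the gate in `A`, and `amalgamCoord`
keeps only the constant ones. -/
theorem gate_coord {x : V} (hx : x ∈ B) {j : κ'} (hj : j ∉ constCoord A B q) :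
    q (g x) j = q x j := by
  simp only [constCoord, Set.mem_ofPred_eq, not_forall] at hj
  obtain ⟨a, ha, b, hb, hab⟩ := hj
  have h := gate_mem_inter hAB ga gb hx
  rcases bool_eq_or hab (q x j) with h1 | h1
  · exact (gb.mem_interval hx ha.2 h.2).1 (ga.gate x a ha.1) j h1
  · exact (gb.mem_interval hx hb.2 h.2).1 (ga.gate x b hb.1) j h1

/-- Each gate lies between its own vertex and the other gate. If the gates differed in `i`, one of
them would differ from both ends of such a geodesic. -/
theorem gate_coord_eq {x y : V} (hx : x ∈ B) (hy : y ∈ B) {i : κ'} (h : q x i = q y i) :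
    q (g x) i = q (g y) i := by
  have hx' := gate_mem_inter hAB ga gb hx
  have hy' := gate_mem_inter hAB ga gb hy
  have h1 := (gb.mem_interval hx hy'.2 hx'.2).1 (ga.gate x _ hy'.1) i
  have h2 := (gb.mem_interval hy hx'.2 hy'.2).1 (ga.gate y _ hx'.1) i
  revert h h1 h2
  cases q x i <;> cases q y i <;> cases q (g x) i <;> cases q (g y) i <;> simp

theorem coord_const {x y : V} (hx : x ∈ A) (hy : y ∈ A) {j : κ'} (hj : j ∈ constCoord A B q) :
    q x j = q y j := by
  rw [← gb.comp x, ← gb.comp y]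
  refine hj _ ?_ _ ?_ <;> rw [Set.inter_comm]
  · exact gate_mem_inter (Set.inter_comm A B ▸ hAB) gb ga hx
  · exact gate_mem_inter (Set.inter_comm A B ▸ hAB) gb ga hy

-- Crossing a constant coordinate of `B` leaves the gate in `A` unchanged. Crossing any other one
-- moves the gate along an edge, so exactly one coordinate `p` changes. Either way an edge of `B`
-- flips a single combined coordinate.
include hU in
theorem isEmb_amalgam (hE : ∀ x y, G.Adj x y → (x ∈ A ∧ y ∈ A) ∨ (x ∈ B ∧ y ∈ B)) :
    IsEmb G (amalgamCoord A B p q) := by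
  classical
  have hne := ga.conn.nonempty
  have hmem : ∀ x, x ∈ A ∨ x ∈ B := fun x => by
    have : x ∈ A ∪ B := hU ▸ trivial
    exact this
  -- moving in `B` along a constant coordinate does not move the gate
  have gate_eq : ∀ x y : V, x ∈ B → y ∈ B → ∀ j ∈ constCoord A B q,
      (∀ i, i ≠ j → q x i = q y i) → p x = p y := by
    intro x y hx hy j hj h
    have hx' := gate_mem_inter hAB ga gb hx
    have hy' := gate_mem_inter hAB ga gb hy
    rw [← ga.comp x, ← ga.comp y, gb.inj hx'.2 hy'.2 fun i => ?_]
    by_cases hij : i = j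
    · subst hij; exact hj _ hx' _ hy'
    · exact gate_coord_eq ga gb hAB hx hy (h i hij)
  have gate_adj : ∀ x y : V, x ∈ B → y ∈ B → ∀ j, j ∉ constCoord A B q → q x j ≠ q y j →
      (∀ i, i ≠ j → q x i = q y i) → G.Adj (g x) (g y) := by
    intro x y hx hy j hjJ hj hj'
    rw [gb.adj_iff (gate_mem_inter hAB ga gb hx).2 (gate_mem_inter hAB ga gb hy).2]
    refine ⟨j, ?_, fun k hk => gate_coord_eq ga gb hAB hx hy (hj' k hk)⟩
    rw [gate_coord ga gb hAB hx hjJ, gate_coord ga gb hAB hy hjJ]; exact hj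
  have stepB : ∀ {x y}, x ≠ y → x ∈ B → y ∈ B →
      ∃ z i, G.Adj x z ∧ amalgamCoord A B p q x i ≠ amalgamCoord A B p q y i ∧
        amalgamCoord A B p q z i = amalgamCoord A B p q y i ∧
        ∀ j, j ≠ i → amalgamCoord A B p q z j = amalgamCoord A B p q x j := by
    intro x y hxy hx hy
    obtain ⟨z, hz, j, h2, h3, h4, h5⟩ := gb.exists_step hx hy hxy
    by_cases hjJ : j ∈ constCoord A B q
    · refine ⟨z, Sum.inr ⟨j, hjJ⟩, h2, h3, h4, ?_⟩
      rintro (k | k) hk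
      · exact congrFun (gate_eq z x hz hx j hjJ h5) k
      · exact h5 k fun h => hk (congrArg Sum.inr (Subtype.ext h))
    · have hx' := gate_mem_inter hAB ga gb hx
      have hy' := gate_mem_inter hAB ga gb hy
      have hz' := gate_mem_inter hAB ga gb hz
      have h6 := gate_adj x z hx hz j hjJ (h4 ▸ h3) fun i hi => (h5 i hi).symm
      obtain ⟨i, hi, hi'⟩ := (ga.adj_iff hx'.1 hz'.1).1 h6
      have h7 : g z ∈ interval G (g x) (g y) := by
        rw [gb.mem_interval hx'.2 hy'.2 hz'.2]
        intro k hk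
        by_cases hkj : k = j
        · subst hkj
          rw [gate_coord ga gb hAB hx hjJ, gate_coord ga gb hAB hy hjJ] at hk
          exact absurd hk h3
        · exact gate_coord_eq ga gb hAB hz hx (h5 k hkj)
      have h8 := (ga.mem_interval hx'.1 hy'.1 hz'.1).1 h7 i
      rw [ga.comp, ga.comp] at hi
      rw [ga.comp, ga.comp, ga.comp] at h8
      have h9 : p x i ≠ p y i := fun h => hi (h8 h).symm
      refine ⟨z, Sum.inl i, h2, h9, bool_eq_of_ne_of_ne hi.symm h9.symm, ?_⟩
      rintro (k | k) hk
      · have := hi' k fun h => hk (h ▸ rfl)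
        rw [ga.comp, ga.comp] at this
        exact this.symm
      · exact h5 k fun h => hjJ (h ▸ k.2)
  refine isEmb_of_step ?_ ?_ ?_
  · intro x y
    have h1 := ga.emb.finite_sep ⟨g x, ga.mem x⟩ ⟨g y, ga.mem y⟩
    have h2 := gb.emb.finite_sep ⟨g' x, gb.mem x⟩ ⟨g' y, gb.mem y⟩
    simp only [sep, ga.comp, gb.comp] at h1 h2
    refine ((h1.image Sum.inl).union ((h2.preimage
      (f := ((↑) : constCoord A B q → κ')) Subtype.val_injective.injOn).image Sum.inr)).subset ?_
    rintro (i | j) h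
    · exact Or.inl ⟨i, h, rfl⟩
    · exact Or.inr ⟨j, h, rfl⟩
  · intro x y hadj
    have : ∃ k, ∀ i, i ≠ k → amalgamCoord A B p q x i = amalgamCoord A B p q y i := by
      rcases hE x y hadj with ⟨hx, hy⟩ | ⟨hx, hy⟩
      · obtain ⟨i, -, hi⟩ := (ga.adj_iff hx hy).1 hadj
        refine ⟨Sum.inl i, ?_⟩
        rintro (k | k) hk
        · exact hi k fun h => hk (h ▸ rfl)
        · exact coord_const ga gb hAB hx hy k.2
      · obtain ⟨j, hj, hj'⟩ := (gb.adj_iff hx hy).1 hadj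
        by_cases hjJ : j ∈ constCoord A B q
        · refine ⟨Sum.inr ⟨j, hjJ⟩, ?_⟩
          rintro (k | k) hk
          · exact congrFun (gate_eq x y hx hy j hjJ hj') k
          · exact hj' k fun h => hk (congrArg Sum.inr (Subtype.ext h))
        · have hx' := gate_mem_inter hAB ga gb hx
          have hy' := gate_mem_inter hAB ga gb hy
          obtain ⟨i, -, hi⟩ := (ga.adj_iff hx'.1 hy'.1).1 (gate_adj x y hx hy j hjJ hj hj')
          rw [ga.comp, ga.comp] at hi
          refine ⟨Sum.inl i, ?_⟩
          rintro (k | k) hk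
          · exact hi k fun h => hk (h ▸ rfl)
          · exact hj' k fun h => hjJ (h ▸ k.2)
    obtain ⟨k, hk⟩ := this
    refine (Set.encard_le_encard (t := {k}) ?_).trans (Set.encard_singleton _).le
    intro i hi
    by_contra hc
    exact hi (hk i hc)
  · intro x y hxy
    -- The intermediate target `t` is `y` itself or the gate of `x` in `B`.
    have stepA : ∀ t ∈ A, x ∈ A → t ≠ x → (∀ i, p x i ≠ p t i → p t i = p y i) →
        ∃ z i, G.Adj x z ∧ amalgamCoord A B p q x i ≠ amalgamCoord A B p q y i ∧
          amalgamCoord A B p q z i = amalgamCoord A B p q y i ∧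
          ∀ j, j ≠ i → amalgamCoord A B p q z j = amalgamCoord A B p q x j := by
      intro t ht hx htx hi
      obtain ⟨z, hz, i, h1, h2, h3, h4⟩ := ga.exists_step hx ht htx.symm
      refine ⟨z, Sum.inl i, h1, fun h => h2 (h.trans (hi i h2).symm), h3.trans (hi i h2), ?_⟩
      rintro (k | k) hk
      · exact h4 k fun h => hk (h ▸ rfl)
      · exact coord_const ga gb hAB hz hx k.2
    have hBA : (B ∩ A).Nonempty := Set.inter_comm A B ▸ hAB
    by_cases hx : x ∈ A
    · by_cases hy : y ∈ A
      · exact stepA y hy hx hxy.symm fun _ _ => rfl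
      have hyB := (hmem y).resolve_left hy
      by_cases hxB : x ∈ B
      · exact stepB hxy hxB hyB
      · have h1 := gate_mem_inter hBA gb ga hx
        refine stepA (g' x) h1.2 hx (fun h => hxB (h ▸ h1.1)) fun i hi => ?_
        have h2 := gate_mem_inter hAB ga gb hyB
        have h3 := (ga.mem_interval hx h2.1 h1.2).1 (gb.gate x _ h2.2) i
        rw [ga.comp] at h3
        exact bool_eq_of_ne_of_ne hi.symm fun h => hi (h3 h.symm).symm
    · have hxB := (hmem x).resolve_left hx
      by_cases hy : y ∈ B
      · exact stepB hxy hxB hy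
      have hyA := (hmem y).resolve_right hy
      have h1 := gate_mem_inter hAB ga gb hxB
      obtain ⟨z, hz, j, h2, h3, h4, h5⟩ := gb.exists_step hxB h1.2 fun h => hx (h ▸ h1.1)
      have hjJ : j ∈ constCoord A B q := by
        by_contra hjJ
        exact h3 (gate_coord ga gb hAB hxB hjJ).symm
      have hyj : q (g x) j = q y j := by
        rw [← gb.comp y]
        have := gate_mem_inter hBA gb ga hyA
        exact hjJ _ h1 _ ⟨this.2, this.1⟩
      refine ⟨z, Sum.inr ⟨j, hjJ⟩, h2, fun h => h3 (h.trans hyj.symm), h4.trans hyj, ?_⟩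
      rintro (k | k) hk
      · exact congrFun (gate_eq z x hz hxB j hjJ h5) k
      · exact h5 k fun h => hk (congrArg Sum.inr (Subtype.ext h))

omit gb hAB in
theorem gate_interval (he : IsEmb G (amalgamCoord A B p q)) {x y z : V}
    (h : z ∈ interval G x y) : g z ∈ interval G (g x) (g y) := by
  rw [ga.mem_interval (ga.mem x) (ga.mem y) (ga.mem z), ga.comp, ga.comp, ga.comp]
  exact fun i => he.mem_interval.1 h (Sum.inl i)

/-- The Peano axiom for the gates in `A` gives `z'`, which serves if `v` or `w` is in `A`. If
neither is, the axiom in `B` gives `z`. When `u` is outside `B`, coordinates `p` constant on `A ∩ B`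
do not distinguish `z` from `z'`, the other coordinates `p` are visible from `B`, and the additional
coordinates of `B` agree at `u` and `y`. -/
theorem peano_of_mem (he : IsEmb G (amalgamCoord A B p q)) (he' : IsEmb G (amalgamCoord B A q p))
    (hP : PeanoAxiom (G.induce A)) (hP' : PeanoAxiom (G.induce B))
    (hmem : ∀ x, x ∈ A ∨ x ∈ B) {u v w x y : V} (hx : x ∈ interval G u w)
    (hy : y ∈ interval G v x) (hyA : y ∈ A) : ∃ z ∈ interval G v w, y ∈ interval G u z := by
  have hBA : (B ∩ A).Nonempty := Set.inter_comm A B ▸ hAB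
  have hx' := gate_interval ga he hx
  have hy' := gate_interval ga he hy
  rw [ga.fix hyA] at hy'
  obtain ⟨⟨z', hzA⟩, hz', hyz'⟩ := hP ⟨g u, ga.mem u⟩ ⟨g v, ga.mem v⟩ ⟨g w, ga.mem w⟩
    ⟨g x, ga.mem x⟩ ⟨y, hyA⟩ ((ga.mem_interval_induce _ _ _).2 hx')
    ((ga.mem_interval_induce _ _ _).2 hy')
  rw [ga.mem_interval_induce] at hz' hyz'
  have hyu : y ∈ interval G u z' :=
    he.symm_mem (he.interval_trans (he.symm_mem (ga.gate u z' hzA)) (he.symm_mem hyz'))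
  by_cases hvA : v ∈ A
  · rw [ga.fix hvA] at hz'
    exact ⟨z', he.interval_trans (he.symm_mem (ga.gate w v hvA)) hz', hyu⟩
  by_cases hwA : w ∈ A
  · rw [ga.fix hwA] at hz'
    exact ⟨z', he.symm_mem (he.interval_trans (he.symm_mem (ga.gate v w hwA)) (he.symm_mem hz')),
      hyu⟩
  have hv := (hmem v).resolve_left hvA
  have hw := (hmem w).resolve_left hwA
  have hx'' := gate_interval gb he' hx
  have hy'' := gate_interval gb he' hy
  obtain ⟨⟨z, hzB⟩, hz, hyz⟩ := hP' ⟨g' u, gb.mem u⟩ ⟨g' v, gb.mem v⟩ ⟨g' w, gb.mem w⟩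
    ⟨g' x, gb.mem x⟩ ⟨g' y, gb.mem y⟩ ((gb.mem_interval_induce _ _ _).2 hx'')
    ((gb.mem_interval_induce _ _ _).2 hy'')
  rw [gb.mem_interval_induce] at hz hyz
  rw [gb.fix hv, gb.fix hw] at hz
  refine ⟨z, hz, ?_⟩
  by_cases huB : u ∈ B
  · have hyB : y ∈ B := gb.conv v hv x (gb.conv u huB w hw hx) hy
    rwa [gb.fix huB, gb.fix hyB] at hyz
  have huA := (hmem u).resolve_right huB
  rw [he.mem_interval]
  rintro (i | j) h
  · by_cases hi : i ∈ constCoord B A p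
    · refine he.mem_interval.1 hyu (Sum.inl i) (h.trans ?_)
      change p z i = p z' i
      have h1 := gate_mem_inter hAB ga gb hzB
      have h2 := (ga.conv.inter gb.conv) _ (gate_mem_inter hAB ga gb hv) _
        (gate_mem_inter hAB ga gb hw) hz'
      rw [← ga.comp z]
      exact hi _ ⟨h1.2, h1.1⟩ _ ⟨h2.2, h2.1⟩
    · have h1 := gate_coord gb ga hBA huA hi
      have h2 := gate_coord gb ga hBA hyA hi
      have h3 := gate_interval ga he hyz
      rw [ga.mem_interval (ga.mem _) (ga.mem _) (ga.mem _), ga.comp, ga.comp, ga.comp] at h3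
      have h4 := h3 i
      rw [h1, h2] at h4
      exact h4 h
  · exact coord_const ga gb hAB hyA huA j.2

end Amalgam

theorem exists_gate {V W : Type u} {κ : Type v} {G : SimpleGraph V} {H : SimpleGraph W} {A : Set V}
    (hG : G.Connected) (hA : IsGated G A) {φ : W → κ → Bool} (he : IsEmb H φ) (e : H ≃g G.induce A) :
    ∃ g p, Gate (κ := κ) G A g p := by
  choose g hg h using hA
  have hfix : ∀ x ∈ A, g x = x := by
    intro x hx
    have := (mem_interval_iff_dist hG).1 (h x x hx)
    simp only [dist_self] at this
    exact ((hG.dist_eq_zero_iff).1 (by omega)).symm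
  refine ⟨g, fun x => φ (e.symm ⟨g x, hg x⟩), hG, isConvex_of_isGated hG fun x => ⟨g x, hg x, h x⟩,
    hg, h, ?_, fun x => ?_⟩
  · have := he.iso e
    convert this using 3 with a
    exact congrArg _ (Subtype.ext (hfix a a.2))
  · exact congrArg (fun t => φ (e.symm t)) (Subtype.ext (hfix _ (hg x)))

theorem connected_of_union {V : Type u} {G : SimpleGraph V} {A B : Set V}
    (hA : (G.induce A).Connected) (hB : (G.induce B).Connected) (hAB : (A ∩ B).Nonempty)
    (hU : A ∪ B = Set.univ) : G.Connected := by
  obtain ⟨o, hoA, hoB⟩ := hAB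
  have key : ∀ x, G.Reachable o x := fun x => by
    have : x ∈ A ∪ B := hU ▸ trivial
    rcases this with hx | hx
    · exact (hA.preconnected ⟨o, hoA⟩ ⟨x, hx⟩).map (Embedding.induce A).toHom
    · exact (hB.preconnected ⟨o, hoB⟩ ⟨x, hx⟩).map (Embedding.induce B).toHom
  exact { preconnected := fun x y => (key x).symm.trans (key y), nonempty := ⟨o⟩ }

theorem isPeanoPartialCube_amalgam : ClosedUnderGatedAmalgams.{u} IsPeanoPartialCube := by
  rintro V₀ V₁ V G₀ G₁ G h₀ h₁ ⟨A, B, hA, hB, hAB, hU, hE, ⟨e₀⟩, ⟨e₁⟩⟩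
  rw [isPeanoPartialCube_iff] at *
  obtain ⟨κ, p₀, he₀, hP₀⟩ := h₀
  obtain ⟨κ', q₀, he₁, hP₁⟩ := h₁
  have hG : G.Connected := connected_of_union (e₀.connected_iff.1 he₀.conn)
    (e₁.connected_iff.1 he₁.conn) hAB hU
  obtain ⟨g, p, ga⟩ := exists_gate hG hA he₀ e₀
  obtain ⟨g', q, gb⟩ := exists_gate hG hB he₁ e₁
  have hBA : (B ∩ A).Nonempty := Set.inter_comm A B ▸ hAB
  have he := isEmb_amalgam ga gb hAB hU hE
  have he' := isEmb_amalgam gb ga hBA (Set.union_comm A B ▸ hU) fun x y h => (hE x y h).symm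
  have hPA := peanoAxiom_iso e₀ hP₀
  have hPB := peanoAxiom_iso e₁ hP₁
  have hmem : ∀ x, x ∈ A ∨ x ∈ B := fun x => by
    have : x ∈ A ∪ B := hU ▸ trivial
    exact this
  refine ⟨_, _, he, fun u v w x y hx hy => ?_⟩
  rcases hmem y with hyA | hyB
  · exact peano_of_mem ga gb hAB he he' hPA hPB hmem hx hy hyA
  · exact peano_of_mem gb ga hBA he' he hPB hPA (fun x => (hmem x).symm) hx hy hyB

/-! ### Coordinate sets relative to a base vertex, boundaries and rings -/

section Relative
variable {V : Type u} {ι : Type v} {G : SimpleGraph V} {φ : V → ι → Bool}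

theorem eq_iff_mem_sep (y a b : V) (i : ι) : φ a i = φ b i ↔ (i ∈ sep φ y a ↔ i ∈ sep φ y b) := by
  simp only [Set.mem_ofPred_eq]
  cases φ a i <;> cases φ b i <;> cases φ y i <;> simp

theorem notMem_sep_self (y : V) (i : ι) : i ∉ sep φ y y := by simp

/-- The vertices of `K` on the side of `y` with respect to the coordinate `h` that have a neighbour
in `K` on the other side. -/
def bdry (φ : V → ι → Bool) (K : Set V) (h : ι) (y : V) : Set V :=
  {r | r ∈ K ∧ h ∉ sep φ y r ∧ ∃ s ∈ K, h ∈ sep φ y s ∧ ∀ j, j ≠ h → (j ∈ sep φ y s ↔ j ∈ sep φ y r)}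

/-- Two vertices of the boundary in opposite directions from `y`, such that every vertex of the
boundary lies behind one of them. -/
structure Ring (φ : V → ι → Bool) (K : Set V) (h : ι) (y : V) (Δ₁ Δ₂ : Set ι) : Prop where
  ne₁ : Δ₁.Nonempty
  ne₂ : Δ₂.Nonempty
  disj : ∀ i ∈ Δ₁, i ∉ Δ₂
  mem₁ : ∃ r ∈ bdry φ K h y, sep φ y r = Δ₁
  mem₂ : ∃ r ∈ bdry φ K h y, sep φ y r = Δ₂
  cover : ∀ r ∈ bdry φ K h y, Δ₁ ⊆ sep φ y r ∨ Δ₂ ⊆ sep φ y r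

theorem Ring.symm {K : Set V} {h : ι} {y : V} {Δ₁ Δ₂ : Set ι} (hR : Ring φ K h y Δ₁ Δ₂) :
    Ring φ K h y Δ₂ Δ₁ :=
  ⟨hR.ne₂, hR.ne₁, fun i h2 h1 => hR.disj i h1 h2, hR.mem₂, hR.mem₁, fun r hr => (hR.cover r hr).symm⟩

namespace IsEmb
variable (he : IsEmb G φ)
include he

theorem mem_interval_sep (y : V) {a b z : V} : z ∈ interval G a b ↔ ∀ i,
    (i ∈ sep φ y a → i ∈ sep φ y b → i ∈ sep φ y z) ∧
    (i ∈ sep φ y z → i ∈ sep φ y a ∨ i ∈ sep φ y b) := by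
  rw [he.mem_interval]
  refine forall_congr' fun i => ?_
  rw [eq_iff_mem_sep y a b, eq_iff_mem_sep y z a]
  tauto

theorem mem_hull_sep (y : V) {A : Set V} (hne : A.Nonempty) {z : V} : z ∈ hull G A ↔ ∀ i,
    ((∀ a ∈ A, i ∈ sep φ y a) → i ∈ sep φ y z) ∧ ((∀ a ∈ A, i ∉ sep φ y a) → i ∉ sep φ y z) := by
  rw [he.mem_hull hne]
  refine forall_congr' fun i => ?_
  simp only [Set.mem_ofPred_eq, not_not]
  constructor
  · intro h
    refine ⟨fun hA => ?_, fun hA => (h (φ y i) fun a ha => (hA a ha).symm).symm⟩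
    have := h (!φ y i) fun a ha => by
      have := hA a ha
      revert this; cases φ a i <;> cases φ y i <;> simp
    rw [this]; simp
  · rintro ⟨h1, h2⟩ b hb
    by_cases hby : φ y i = b
    · rw [← hby]; exact (h2 fun a ha => by rw [hb a ha, hby]).symm
    · exact bool_eq_of_ne_of_ne (h1 fun a ha => by rw [hb a ha]; exact hby).symm (Ne.symm hby)

omit he in
theorem bdry_congr {K : Set V} {h : ι} {y y' : V} (hyy : h ∉ sep φ y y') :
    bdry φ K h y = bdry φ K h y' := by
  ext r
  simp only [bdry, Set.mem_ofPred_eq, not_not] at *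
  rw [hyy]
  refine and_congr_right fun _ => and_congr_right fun _ => exists_congr fun s =>
    and_congr_right fun _ => and_congr_right fun _ => forall_congr' fun j => imp_congr_right fun _ => ?_
  cases φ y j <;> cases φ y' j <;> cases φ s j <;> cases φ r j <;> simp

theorem exists_flip_sep (y : V) {a b : V} {n : ι} (ha : n ∉ sep φ y a) (hb : n ∈ sep φ y b) :
    ∃ s t, s ∈ interval G a b ∧ t ∈ interval G a b ∧ n ∉ sep φ y s ∧ n ∈ sep φ y t ∧
      ∀ j, j ≠ n → (j ∈ sep φ y t ↔ j ∈ sep φ y s) := by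
  obtain ⟨s, t, h1, h2, h3, h4, h5⟩ := he.exists_mem_flip (x := a) (y := b) (i := n)
    (fun h => by have := (eq_iff_mem_sep y a b n).1 h; tauto)
  refine ⟨s, t, h1, h2, ?_, ?_, fun j hj => ((eq_iff_mem_sep y s t j).1 (h5 j hj)).symm⟩
  · rwa [(eq_iff_mem_sep y s a n).1 h3]
  · have := mt (eq_iff_mem_sep y t a n).2 h4
    tauto

theorem exists_bdry_below {K : Set V} (hK : IsConvex G K) {h : ι} {y : V} (hy : y ∈ K) {c : V}
    (hc : c ∈ K) (hch : h ∈ sep φ y c) : ∃ r ∈ bdry φ K h y, sep φ y r ⊆ sep φ y c := by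
  obtain ⟨s, t, h1, h2, h3, h4, h5⟩ := he.exists_flip_sep y (notMem_sep_self y h) hch
  refine ⟨s, ⟨hK y hy c hc h1, h3, t, hK y hy c hc h2, h4, h5⟩, fun i hi => ?_⟩
  exact (((he.mem_interval_sep y).1 h1 i).2 hi).resolve_left (notMem_sep_self y i)

theorem mem_of_interval_sep (y : V) {a z : V} (hz : z ∈ interval G y a) : sep φ y z ⊆ sep φ y a :=
  fun i hi => (((he.mem_interval_sep y).1 hz i).2 hi).resolve_left (notMem_sep_self y i)

variable (hP : PeanoAxiom G)
include hP

/-- Disjoint coordinate sets mean that `y` is between `p` and `r`. Apart from `h`, a halfspace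
containing the far side of `K` contains the boundary, hence `y`. So join-hull puts `y` between `p`
and a far vertex `c`, and a boundary vertex between `y` and `c` will do. -/
theorem exists_bdry_through {K : Set V} (hK : IsConvex G K) {h : ι} {y : V} (hyK : y ∈ K)
    (hy : y ∈ hull G (bdry φ K h y)) {p : V} (hp : h ∉ sep φ y p) :
    ∃ r ∈ bdry φ K h y, ∀ i ∈ sep φ y p, i ∉ sep φ y r := by
  have hne : (bdry φ K h y).Nonempty := by
    by_contra hc
    rw [Set.not_nonempty_iff_eq_empty] at hc
    rw [hc] at hy
    exact hull_subset (C := ∅) (fun _ h => h.elim) subset_rfl hy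
  obtain ⟨r0, -, -, s0, hs0, hs0h, -⟩ := id hne
  have hCc : IsConvex G (K ∩ {c | h ∈ sep φ y c}) := by
    refine hK.inter fun a ha b hb c hc => ?_
    exact ((he.mem_interval_sep y).1 hc h).1 ha hb
  obtain ⟨c, ⟨hcK, hch⟩, hyc⟩ := he.joinHull hP hCc ⟨s0, hs0, hs0h⟩ (u := p) (y := y) (by
    rw [he.mem_hull_sep y ⟨p, Or.inr rfl⟩]
    intro i
    refine ⟨fun hi => ?_, fun _ => notMem_sep_self y i⟩
    by_cases hih : i = h
    · subst hih; exact absurd (hi p (Or.inr rfl)) hp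
    · refine ((he.mem_hull_sep y hne).1 hy i).1 ?_
      rintro r ⟨hr, -, s, hs, hsh, hj⟩
      exact (hj i hih).1 (hi s (Or.inl ⟨hs, hsh⟩)))
  obtain ⟨r, hr, hrc⟩ := he.exists_bdry_below hK hyK hcK hch
  exact ⟨r, hr, fun i hip hir => notMem_sep_self y i
    (((he.mem_interval_sep y).1 hyc i).1 hip (hrc hir))⟩

end IsEmb

namespace Ring
variable {K : Set V} {h : ι} {y : V} {Δ₁ Δ₂ : Set ι} (hR : Ring φ K h y Δ₁ Δ₂)
  (he : IsEmb G φ) (hP : PeanoAxiom G) (hK : IsConvex G K) (hyK : y ∈ K)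
include hR

omit hyK in
theorem notMem₁ : h ∉ Δ₁ := by
  obtain ⟨r, hr, rfl⟩ := hR.mem₁; exact hr.2.1

omit hyK in
theorem notMem₂ : h ∉ Δ₂ := hR.symm.notMem₁

include he

theorem mem_hull : y ∈ hull G (bdry φ K h y) := by
  obtain ⟨r, hr, rfl⟩ := hR.mem₁
  obtain ⟨s, hs, rfl⟩ := hR.mem₂
  refine isConvex_hull _ r (subset_hull _ hr) s (subset_hull _ hs) ?_
  rw [he.mem_interval_sep y]
  intro i
  exact ⟨fun h1 h2 => absurd h2 (hR.disj i h1), fun h => absurd h (notMem_sep_self y i)⟩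

include hK hyK

theorem cross {c : V} (hc : c ∈ K) (hch : h ∈ sep φ y c) : Δ₁ ⊆ sep φ y c ∨ Δ₂ ⊆ sep φ y c := by
  obtain ⟨r, hr, hrc⟩ := he.exists_bdry_below hK hyK hc hch
  exact (hR.cover r hr).imp (fun h => h.trans hrc) (fun h => h.trans hrc)

/-- Walk between the far neighbours of the two ring vertices. Where the walk first loses `Δ₁` it
must have all of `Δ₂` by `cross`; the edge used flips a coordinate of `Δ₁`, so the vertex before it
has both sets. -/
theorem exists_opposite : ∃ z ∈ K, ∀ i, i ∈ sep φ y z ↔ i = h ∨ i ∈ Δ₁ ∨ i ∈ Δ₂ := by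
  have n1 := hR.notMem₁
  have n2 := hR.notMem₂
  obtain ⟨r₁, hr₁, e₁⟩ := hR.mem₁
  obtain ⟨r₂, hr₂, e₂⟩ := hR.mem₂
  obtain ⟨hrK₁, hrh₁, s₁, hs₁, hsh₁, hj₁⟩ := hr₁
  obtain ⟨hrK₂, hrh₂, s₂, hs₂, hsh₂, hj₂⟩ := hr₂
  rw [e₁] at hj₁
  rw [e₂] at hj₂
  obtain ⟨i₁, hi₁⟩ := hR.ne₁
  have hq : ¬ Δ₁ ⊆ sep φ y s₂ := by
    intro hc
    have h1 : i₁ ≠ h := by rintro rfl; exact n1 hi₁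
    exact hR.disj i₁ hi₁ ((hj₂ i₁ h1).1 (hc hi₁))
  have hp : Δ₁ ⊆ sep φ y s₁ := fun i hi => (hj₁ i (by rintro rfl; exact n1 hi)).2 hi
  obtain ⟨a, b, ha, hb, hadj, haQ, hbQ⟩ := he.exists_exit (Q := fun t => Δ₁ ⊆ sep φ y t) hp hq
  have haK := hK s₁ hs₁ s₂ hs₂ ha
  have hbK := hK s₁ hs₁ s₂ hs₂ hb
  rw [he.mem_interval_sep y] at ha hb
  have hb2 := (hR.cross he hK hyK hbK ((hb h).1 hsh₁ hsh₂)).resolve_left hbQ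
  obtain ⟨k, hk, hk'⟩ := he.adj_iff.1 hadj
  obtain ⟨k', hk1, hk2⟩ := Set.not_subset.1 hbQ
  have hkk : k' = k := by
    by_contra hc
    exact hk2 (((eq_iff_mem_sep y a b k').1 (hk' k' hc)).1 (haQ hk1))
  subst hkk
  refine ⟨a, haK, fun i => ⟨fun hi => ?_, ?_⟩⟩
  · by_cases hih : i = h
    · exact Or.inl hih
    · rcases (ha i).2 hi with h1 | h1
      · exact Or.inr (Or.inl ((hj₁ i hih).1 h1))
      · exact Or.inr (Or.inr ((hj₂ i hih).1 h1))
  · rintro (rfl | hi | hi)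
    · exact (ha _).1 hsh₁ hsh₂
    · exact haQ hi
    · by_cases hik : i = k'
      · subst hik; exact absurd hi (hR.disj i hk1)
      · exact ((eq_iff_mem_sep y a b i).1 (hk' i hik)).2 (hb2 hi)

include hP

/-- The base `y` is between `p` and a boundary vertex, which lies behind `Δ₁` or `Δ₂`. Here `p` is
any vertex of `G`, not only of `K`. -/
theorem sep_side {p : V} (hp : h ∉ sep φ y p) :
    (∀ i ∈ Δ₁, i ∉ sep φ y p) ∨ (∀ i ∈ Δ₂, i ∉ sep φ y p) := by
  obtain ⟨r, hr, hpr⟩ := he.exists_bdry_through hP hK hyK (hR.mem_hull he) hp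
  exact (hR.cover r hr).imp (fun h i hi hip => hpr i hip (h hi)) (fun h i hi hip => hpr i hip (h hi))

/-- The opposite vertex is between `p` and some `c` in the near-side interval of the two ring
vertices. Coordinates of `Δ₁` and `Δ₂` missing at `p` must then occur at `c`, which `sep_side`
forbids. -/
theorem other_side {p : V} (hp : h ∈ sep φ y p) : Δ₁ ⊆ sep φ y p ∨ Δ₂ ⊆ sep φ y p := by
  by_contra hc
  rw [not_or, Set.not_subset, Set.not_subset] at hc
  obtain ⟨⟨n₁, hn₁, hn₁'⟩, n₂, hn₂, hn₂'⟩ := hc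
  obtain ⟨r₁, hr₁, e₁⟩ := hR.mem₁
  obtain ⟨r₂, hr₂, e₂⟩ := hR.mem₂
  obtain ⟨z, hzK, hz⟩ := hR.exists_opposite he hK hyK
  have n1 := hR.notMem₁
  have n2 := hR.notMem₂
  obtain ⟨c, hc, hzc⟩ := he.joinHull hP (he.isConvex_interval r₁ r₂) ⟨r₁, he.left_mem _ _⟩ (u := p)
    (y := z) (by
      rw [he.mem_hull_sep y ⟨p, Or.inr rfl⟩]
      intro i
      constructor
      · intro hi
        have h1 := hi r₁ (Or.inl (he.left_mem _ _))
        rw [hz]; rw [e₁] at h1; exact Or.inr (Or.inl h1)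
      · intro hi hiz
        have h1 := hi r₁ (Or.inl (he.left_mem _ _))
        have h2 := hi r₂ (Or.inl (he.right_mem _ _))
        rw [e₁] at h1
        rw [e₂] at h2
        rw [hz] at hiz
        rcases hiz with rfl | hiz | hiz
        · exact hi p (Or.inr rfl) hp
        · exact h1 hiz
        · exact h2 hiz)
  rw [he.mem_interval_sep y, e₁, e₂] at hc
  rw [he.mem_interval_sep y] at hzc
  have c1 : n₁ ∈ sep φ y c := ((hzc n₁).2 ((hz _).2 (Or.inr (Or.inl hn₁)))).resolve_left hn₁'
  have c2 : n₂ ∈ sep φ y c := ((hzc n₂).2 ((hz _).2 (Or.inr (Or.inr hn₂)))).resolve_left hn₂'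
  have c3 : h ∉ sep φ y c := fun h3 => ((hc h).2 h3).elim n1 n2
  rcases hR.sep_side he hP hK hyK c3 with h4 | h4
  · exact h4 n₁ hn₁ c1
  · exact h4 n₂ hn₂ c2

theorem cover_univ {K' : Set V} {r : V} (hr : r ∈ bdry φ K' h y) :
    Δ₁ ⊆ sep φ y r ∨ Δ₂ ⊆ sep φ y r := by
  have n1 := hR.notMem₁
  have n2 := hR.notMem₂
  obtain ⟨-, -, s, -, hs, hj⟩ := hr
  refine (hR.other_side he hP hK hyK hs).imp (fun h1 i hi => ?_) fun h1 i hi => ?_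
  · exact (hj i (by rintro rfl; exact n1 hi)).1 (h1 hi)
  · exact (hj i (by rintro rfl; exact n2 hi)).1 (h1 hi)

/-- By `other_side` the covering condition holds throughout `G`; thus rings found inductively in
smaller convex sets persist. -/
theorem mono {K' : Set V} (hKK : K ⊆ K') : Ring φ K' h y Δ₁ Δ₂ := by
  have hsub : bdry φ K h y ⊆ bdry φ K' h y := fun r hr =>
    ⟨hKK hr.1, hr.2.1, hr.2.2.choose, hKK hr.2.2.choose_spec.1, hr.2.2.choose_spec.2⟩
  obtain ⟨r₁, hr₁, e₁⟩ := hR.mem₁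
  obtain ⟨r₂, hr₂, e₂⟩ := hR.mem₂
  exact ⟨hR.ne₁, hR.ne₂, hR.disj, ⟨r₁, hsub hr₁, e₁⟩, ⟨r₂, hsub hr₂, e₂⟩,
    fun r hr => hR.cover_univ he hP hK hyK hr⟩

end Ring
end Relative

/-! ### Existence of rings in Peano partial cubes -/

section RingExistence
variable {V : Type u} {ι : Type v} {G : SimpleGraph V} {φ : V → ι → Bool}

theorem mem_sep_step {y y₁ : V} {n : ι} (hn : n ∈ sep φ y y₁) (hj : ∀ j, j ≠ n → φ y₁ j = φ y j)
    (v : V) (i : ι) : i ∈ sep φ y₁ v ↔ (i = n ↔ i ∉ sep φ y v) := by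
  by_cases hi : i = n
  · subst hi
    simp only [Set.mem_ofPred_eq] at *
    revert hn
    cases φ y i <;> cases φ y₁ i <;> cases φ v i <;> simp
  · simp only [Set.mem_ofPred_eq, hj i hi, hi, false_iff, not_not]

namespace IsEmb
variable (he : IsEmb G φ)
include he

theorem exists_step_sep {y r : V} (h : y ≠ r) : ∃ y₁ n, y₁ ∈ interval G y r ∧ n ∈ sep φ y r ∧
    G.dist y r = G.dist y₁ r + 1 ∧ (∀ i, i ∈ sep φ y y₁ ↔ i = n) ∧
    ∀ v i, i ∈ sep φ y₁ v ↔ (i = n ↔ i ∉ sep φ y v) := by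
  obtain ⟨z, n, hadj, hz, h1, h2, h3⟩ := he.exists_step h
  have hn : n ∈ sep φ y z := by rw [Set.mem_ofPred_eq, h2]; exact h1
  refine ⟨z, n, hz, h1, ?_, fun i => ⟨fun hi => ?_, fun hi => hi ▸ hn⟩, mem_sep_step hn h3⟩
  · have h1 := (mem_interval_iff_dist he.conn).1 hz
    have h2 := dist_eq_one_iff_adj.2 hadj
    omega
  · by_contra hc; exact hi (h3 i hc).symm

theorem isConvex_notMem {K : Set V} (hK : IsConvex G K) (n : ι) (y : V) :
    IsConvex G (K ∩ {x | n ∉ sep φ y x}) := by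
  refine hK.inter fun a ha b hb c hc hcn => ?_
  exact (((he.mem_interval_sep y).1 hc n).2 hcn).elim ha hb

theorem exists_bdry_notMem {K : Set V} {h : ι} {y : V} (hy : y ∈ hull G (bdry φ K h y)) (n : ι) :
    ∃ r ∈ bdry φ K h y, n ∉ sep φ y r := by
  by_contra hc
  push Not at hc
  have hne : (bdry φ K h y).Nonempty := by
    by_contra hc
    rw [Set.not_nonempty_iff_eq_empty] at hc
    rw [hc] at hy
    exact hull_subset (C := ∅) (fun _ h => h.elim) subset_rfl hy
  exact notMem_sep_self y n (((he.mem_hull_sep y hne).1 hy n).1 hc)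

variable (hP : PeanoAxiom G)
include hP

theorem pair_props {K : Set V} (hK : IsConvex G K) {h : ι} {y : V} (hyK : y ∈ K)
    (hy : y ∈ hull G (bdry φ K h y)) {n m : ι}
    (hnm : ∀ r ∈ bdry φ K h y, n ∈ sep φ y r ∨ m ∈ sep φ y r) :
    (∀ p, h ∉ sep φ y p → n ∈ sep φ y p → m ∉ sep φ y p) ∧
    (∀ c ∈ K, h ∈ sep φ y c → n ∈ sep φ y c ∨ m ∈ sep φ y c) := by
  constructor
  · intro p hp hn hm
    obtain ⟨r, hr, hpr⟩ := he.exists_bdry_through hP hK hyK hy hp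
    exact (hnm r hr).elim (hpr n hn) (hpr m hm)
  · intro c hc hch
    obtain ⟨r, hr, hrc⟩ := he.exists_bdry_below hK hyK hc hch
    exact (hnm r hr).imp (fun h => hrc h) (fun h => hrc h)

/-- Outer induction on the size of `K`, inner induction on the distance from `y` to a boundary
vertex. Without a ring at `y`, every coordinate `n ≠ h` occurring in `K` has a partner `m` such that
each boundary vertex has `n` or `m`. The ring at the next vertex `y₁` then either transfers to `y`
or conflicts with these partners. -/
theorem exists_ring (K : Set V) (hfin : K.Finite) (hK : IsConvex G K) (h : ι) (y : V) (hyK : y ∈ K)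
    (hy : y ∈ hull G (bdry φ K h y)) (hyB : y ∉ bdry φ K h y) : ∃ Δ₁ Δ₂, Ring φ K h y Δ₁ Δ₂ := by
  induction hN : K.ncard using Nat.strong_induction_on generalizing K h y with
  | _ N IH => ?_
  subst hN
  have IH' : ∀ (n : ι) (y t : V), t ∈ K → n ∈ sep φ y t → ∀ (h : ι) (z : V),
      z ∈ K → n ∉ sep φ y z → z ∈ hull G (bdry φ (K ∩ {x | n ∉ sep φ y x}) h z) →
      z ∉ bdry φ (K ∩ {x | n ∉ sep φ y x}) h z →
      ∃ Δ₁ Δ₂, Ring φ (K ∩ {x | n ∉ sep φ y x}) h z Δ₁ Δ₂ := by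
    intro n y t ht hnt h z hz hnz h1 h2
    exact IH _ (Set.ncard_lt_ncard ⟨Set.inter_subset_left, fun hc => absurd hnt (hc ht).2⟩ hfin) _
      (hfin.subset Set.inter_subset_left) (he.isConvex_notMem hK n y) h z ⟨hz, hnz⟩ h1 h2 rfl
  -- The boundary vertices without `n` form the boundary of a smaller convex set. If `y` were in
  -- their hull, a ring there would be one in `K`; so a coordinate `m` separates `y` from them.
  have pairing : ∀ y ∈ K, y ∈ hull G (bdry φ K h y) → y ∉ bdry φ K h y →
      (¬ ∃ Δ₁ Δ₂, Ring φ K h y Δ₁ Δ₂) → ∀ n, n ≠ h → ∀ t ∈ K, n ∈ sep φ y t →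
      ∃ m, ∀ r ∈ bdry φ K h y, n ∈ sep φ y r ∨ m ∈ sep φ y r := by
    intro y hyK hy hyB hno n hnh t ht hnt
    have hsub : ∀ r, r ∈ bdry φ (K ∩ {x | n ∉ sep φ y x}) h y ↔
        r ∈ bdry φ K h y ∧ n ∉ sep φ y r := by
      intro r
      constructor
      · rintro ⟨⟨h1, h2⟩, h3, s, ⟨h4, -⟩, h5⟩
        exact ⟨⟨h1, h3, s, h4, h5⟩, h2⟩
      · rintro ⟨⟨h1, h3, s, h4, h5, h6⟩, h2⟩
        exact ⟨⟨h1, h2⟩, h3, s, ⟨h4, fun hc => h2 ((h6 n hnh).1 hc)⟩, h5, h6⟩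
    have hnot : y ∉ hull G (bdry φ (K ∩ {x | n ∉ sep φ y x}) h y) := by
      intro hc
      obtain ⟨Δ₁, Δ₂, hR⟩ := IH' n y t ht hnt h y hyK (notMem_sep_self y n) hc
        fun hb => hyB ((hsub y).1 hb).1
      exact hno ⟨Δ₁, Δ₂, hR.mono he hP (he.isConvex_notMem hK n y) ⟨hyK, notMem_sep_self y n⟩
        Set.inter_subset_left⟩
    obtain ⟨r0, hr0, hr0n⟩ := he.exists_bdry_notMem hy n
    rw [he.mem_hull_sep y ⟨r0, (hsub r0).2 ⟨hr0, hr0n⟩⟩] at hnot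
    push Not at hnot
    obtain ⟨m, hm⟩ := hnot
    have hm' : ∀ a ∈ bdry φ (K ∩ {x | n ∉ sep φ y x}) h y, m ∈ sep φ y a := by
      by_contra hc
      exact notMem_sep_self y m (hm fun h => absurd h hc).2
    refine ⟨m, fun r hr => ?_⟩
    by_cases hn : n ∈ sep φ y r
    · exact Or.inl hn
    · exact Or.inr (hm' r ((hsub r).2 ⟨hr, hn⟩))
  obtain ⟨r₁, hr₁, -⟩ := he.exists_bdry_notMem hy h
  induction hd : G.dist y r₁ generalizing y with
  | zero =>
    rw [he.conn.dist_eq_zero_iff] at hd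
    subst hd; exact absurd hr₁ hyB
  | succ d ih =>
  by_contra hno
  have pair := pairing y hyK hy hyB hno
  have hyr : y ≠ r₁ := by rintro rfl; exact hyB hr₁
  obtain ⟨y₁, n, hy₁, hn, hdist, hyy₁, hs₁⟩ := he.exists_step_sep hyr
  have hnh : n ≠ h := by rintro rfl; exact hr₁.2.1 hn
  have hy₁K : y₁ ∈ K := hK y hyK r₁ hr₁.1 hy₁
  have hB : bdry φ K h y = bdry φ K h y₁ := bdry_congr fun hc => hnh ((hyy₁ h).1 hc).symm
  have hn₁ : n ∈ sep φ y y₁ := (hyy₁ n).2 rfl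
  -- One step from the boundary, `{n}` forms a ring with any boundary vertex avoiding `n`: for each
  -- coordinate `i` of the latter the partner is `n`, since `y₁` differs from `y` in `n` only.
  by_cases hy₁B : y₁ ∈ bdry φ K h y
  · obtain ⟨r₂, hr₂, hnr₂⟩ := he.exists_bdry_notMem hy n
    refine hno ⟨{n}, sep φ y r₂, ⟨n, rfl⟩, ?_, ?_, ⟨y₁, hy₁B, ?_⟩, ⟨r₂, hr₂, rfl⟩, fun ρ hρ => ?_⟩
    · by_contra hc
      rw [Set.not_nonempty_iff_eq_empty] at hc
      have : y = r₂ := he.inj fun i => by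
        by_contra hi
        have : i ∈ sep φ y r₂ := hi
        rw [hc] at this; exact this
      subst this; exact hyB hr₂
    · rintro _ rfl; exact hnr₂
    · ext i; exact hyy₁ i
    · by_cases hnρ : n ∈ sep φ y ρ
      · left; rintro _ rfl; exact hnρ
      · right
        intro i hi
        obtain ⟨m, hm⟩ := pair i (by rintro rfl; exact hr₂.2.1 hi) r₂ hr₂.1 hi
        rcases hm y₁ hy₁B with h1 | h1
        · exact absurd ((hyy₁ i).1 h1 ▸ hi) hnr₂
        · rw [hyy₁] at h1; subst h1
          exact (hm ρ hρ).resolve_right hnρ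
  obtain ⟨Δ, η, hR⟩ := ih y₁ hy₁K (isConvex_hull _ y (hB ▸ hy) r₁ (subset_hull _ (hB ▸ hr₁)) hy₁)
    (hB ▸ hy₁B) (hB ▸ hr₁) (by omega)
  -- If `n` points along the ring at `y₁`, moving the base back to `y` shifts `n` from one direction
  -- to the other.
  have caseA : ∀ Δ η, Ring φ K h y₁ Δ η → n ∈ η → False := by
    intro Δ η hR hnη
    have hnΔ : n ∉ Δ := fun hc => hR.disj n hc hnη
    obtain ⟨s₁, hs₁B, e₁⟩ := hR.mem₁
    obtain ⟨s₂, hs₂B, e₂⟩ := hR.mem₂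
    rw [← hB] at hs₁B hs₂B
    refine hno ⟨insert n Δ, η \ {n}, ⟨n, Or.inl rfl⟩, ?_, ?_, ⟨s₁, hs₁B, ?_⟩, ⟨s₂, hs₂B, ?_⟩, ?_⟩
    · by_contra hc
      rw [Set.not_nonempty_iff_eq_empty] at hc
      have : y = s₂ := he.inj fun i => by
        by_contra hi
        have hi : i ∈ sep φ y s₂ := hi
        have h1 := hs₁ s₂ i
        rw [e₂] at h1
        have h2 : i ∉ η \ {n} := by rw [hc]; exact fun h => h
        simp only [Set.mem_sdiff, Set.mem_singleton_iff, not_and, not_not] at h2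
        by_cases hin : i = n
        · subst hin; exact (h1.1 hnη).1 rfl hi
        · exact hin (h2 (h1.2 ⟨fun h => absurd h hin, fun h => absurd hi h⟩))
      subst this; exact hyB hs₂B
    · rintro i (rfl | hi) ⟨h1, h2⟩
      · exact h2 rfl
      · exact hR.disj i hi h1
    · ext i
      have h1 := hs₁ s₁ i
      rw [e₁] at h1
      by_cases hin : i = n
      · subst hin; simp only [Set.mem_insert_iff, true_or, iff_true]
        clear * - h1 hnΔ; tauto
      · simp only [Set.mem_insert_iff]; clear * - h1 hin; tauto
    · ext i
      have h1 := hs₁ s₂ i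
      rw [e₂] at h1
      by_cases hin : i = n
      · subst hin; simp only [Set.mem_sdiff, Set.mem_singleton_iff, not_true_eq_false, and_false, iff_false]
        clear * - h1 hnη; tauto
      · simp only [Set.mem_sdiff, Set.mem_singleton_iff]; clear * - h1 hin; tauto
    · intro ρ hρ
      by_cases hnρ : n ∈ sep φ y ρ
      · rcases hR.cover ρ (hB ▸ hρ) with h1 | h1
        · left
          rintro i (rfl | hi)
          · exact hnρ
          · have := (hs₁ ρ i).1 (h1 hi)
            by_contra hc
            exact hnΔ (this.2 hc ▸ hi)
        · exact absurd hnρ (((hs₁ ρ n).1 (h1 hnη)).1 rfl)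
      · right
        have h1 : ¬ ∀ i ∈ η, i ∉ sep φ y₁ ρ := fun hc =>
          hc n hnη ((hs₁ ρ n).2 ⟨fun _ => hnρ, fun _ => rfl⟩)
        have h2 := (hR.sep_side he hP hK hy₁K (hB ▸ hρ : ρ ∈ bdry φ K h y₁).2.1).resolve_right h1
        obtain ⟨i₁, hi₁⟩ := hR.ne₁
        have h3 := (hR.cover ρ (hB ▸ hρ)).resolve_left fun hc => h2 i₁ hi₁ (hc hi₁)
        rintro i ⟨hi, hin⟩
        have := (hs₁ ρ i).1 (h3 hi)
        by_contra hc
        exact hin (this.2 hc)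
  have hnη : n ∉ η := fun hc => caseA Δ η hR hc
  have hnΔ : n ∉ Δ := fun hc => caseA η Δ hR.symm hc
  -- This gives a near-side edge across `n` behind `η`. If every boundary vertex behind `η` had `n`,
  -- then `n` and any `c ∈ Δ` would be partners, although `s₁` has both.
  have tail : ∀ Δ η, Ring φ K h y₁ Δ η → n ∉ Δ → n ∉ η →
      ∃ s ∈ K, ∃ t ∈ K, n ∉ sep φ y s ∧ n ∈ sep φ y t ∧ h ∉ sep φ y s ∧ η ⊆ sep φ y s ∧
        ∀ j, j ≠ n → (j ∈ sep φ y t ↔ j ∈ sep φ y s) := by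
    intro Δ η hR hnΔ hnη
    obtain ⟨s₁, hs₁B, e₁⟩ := hR.mem₁
    obtain ⟨s₂, hs₂B, e₂⟩ := hR.mem₂
    rw [← hB] at hs₁B hs₂B
    have : ∃ ρ ∈ bdry φ K h y, n ∉ sep φ y ρ ∧ η ⊆ sep φ y ρ := by
      by_contra hc
      push Not at hc
      obtain ⟨c, hcΔ⟩ := hR.ne₁
      have hcn : c ≠ n := by rintro rfl; exact hnΔ hcΔ
      have hnc : ∀ ρ ∈ bdry φ K h y, n ∈ sep φ y ρ ∨ c ∈ sep φ y ρ := by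
        intro ρ hρ
        by_cases hnρ : n ∈ sep φ y ρ
        · exact Or.inl hnρ
        right
        rcases hR.cover ρ (hB ▸ hρ) with h1 | h1
        · have := (hs₁ ρ c).1 (h1 hcΔ)
          clear * - this hcn; tauto
        · exfalso
          refine hc ρ hρ hnρ fun i hi => ?_
          have := (hs₁ ρ i).1 (h1 hi)
          by_contra hc'
          exact hnη (this.2 hc' ▸ hi)
      refine (he.pair_props hP hK hyK hy hnc).1 s₁ hs₁B.2.1 ?_ ?_
      · have := hs₁ s₁ n; rw [e₁] at this; clear * - this hnΔ; tauto
      · have := hs₁ s₁ c; rw [e₁] at this; clear * - this hcΔ hcn; tauto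
    obtain ⟨ρ, hρ, hnρ, hηρ⟩ := this
    have hs₂n : n ∈ sep φ y s₂ := by
      have := hs₁ s₂ n; rw [e₂] at this; clear * - this hnη; tauto
    have hs₂η : η ⊆ sep φ y s₂ := by
      intro i hi
      have := hs₁ s₂ i; rw [e₂] at this
      by_contra hc
      exact hnη ((this.1 hi).2 hc ▸ hi)
    obtain ⟨s, t, h1, h2, h3, h4, h5⟩ := he.exists_flip_sep y hnρ hs₂n
    have h1' := (he.mem_interval_sep y).1 h1
    exact ⟨s, hK _ hρ.1 _ hs₂B.1 h1, t, hK _ hρ.1 _ hs₂B.1 h2, h3, h4,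
      fun hc => ((h1' h).2 hc).elim hρ.2.1 hs₂B.2.1, fun i hi => (h1' i).1 (hηρ hi) (hs₂η hi), h5⟩
  obtain ⟨τ, hτK, t₁, ht₁K, hnτ, hnt₁, hhτ, hΔτ, ht₁⟩ := tail η Δ hR.symm hnη hnΔ
  obtain ⟨w, hwK, t₂, ht₂K, hnw, hnt₂, hhw, hηw, ht₂⟩ := tail Δ η hR hnΔ hnη
  obtain ⟨m, hm⟩ := pair n hnh y₁ hy₁K hn₁
  have hpm := he.pair_props hP hK hyK hy hm
  obtain ⟨r₀, hr₀, hnr₀⟩ := he.exists_bdry_notMem hy n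
  have hmr₀ := (hm r₀ hr₀).resolve_left hnr₀
  have hmn : m ≠ n := by rintro rfl; exact hnr₀ hmr₀
  have hmh : m ≠ h := by rintro rfl; exact hr₀.2.1 hmr₀
  obtain ⟨s₁, hs₁B, e₁⟩ := hR.mem₁
  obtain ⟨s₂, hs₂B, e₂⟩ := hR.mem₂
  rw [← hB] at hs₁B hs₂B
  have hΔ : ∀ i, i ∈ sep φ y s₁ ↔ i = n ∨ i ∈ Δ := by
    intro i
    have := hs₁ s₁ i
    rw [e₁] at this
    by_cases hin : i = n
    · subst hin; clear * - this hnΔ; tauto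
    · clear * - this hin; tauto
  have hη : ∀ i, i ∈ sep φ y s₂ ↔ i = n ∨ i ∈ η := by
    intro i
    have := hs₁ s₂ i
    rw [e₂] at this
    by_cases hin : i = n
    · subst hin; clear * - this hnη; tauto
    · clear * - this hin; tauto
  have hmΔ : m ∉ Δ := fun hc =>
    hpm.1 s₁ hs₁B.2.1 ((hΔ n).2 (Or.inl rfl)) ((hΔ m).2 (Or.inr hc))
  have hmη : m ∉ η := fun hc =>
    hpm.1 s₂ hs₂B.2.1 ((hη n).2 (Or.inl rfl)) ((hη m).2 (Or.inr hc))
  have hhΔ := hR.notMem₁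
  have hht₁ : h ∉ sep φ y t₁ := fun hc => hhτ ((ht₁ h hnh.symm).1 hc)
  have hht₂ : h ∉ sep φ y t₂ := fun hc => hhw ((ht₂ h hnh.symm).1 hc)
  -- If `y` has a neighbour `p` in a direction `s ∈ Δ`, then `p` is between `y₁` and some `c`
  -- between `z` and `w`. As `c` avoids `n` and `m`, it is on the near side of `h`, where having `s`
  -- and a coordinate of `η` contradicts `sep_side`.
  by_cases hE : ∃ s ∈ Δ, ∃ p ∈ K, ∀ i, i ∈ sep φ y p ↔ i = s
  · obtain ⟨s, hsΔ, p, hpK, hp⟩ := hE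
    have hsn : s ≠ n := by rintro rfl; exact hnΔ hsΔ
    obtain ⟨z, hzK, hz⟩ := hR.exists_opposite he hK hy₁K
    have hz' : ∀ i, i ≠ n → (i ∈ sep φ y z ↔ i = h ∨ i ∈ Δ ∨ i ∈ η) := by
      intro i hin
      have := hs₁ z i
      rw [hz] at this
      clear * - this hin; tauto
    obtain ⟨c, hc, hpc⟩ := he.joinHull hP (he.isConvex_interval z w) ⟨z, he.left_mem _ _⟩ (u := y₁)
      (y := p) (by
        rw [he.mem_hull_sep y ⟨y₁, Or.inr rfl⟩]
        intro i
        constructor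
        · intro hi
          have h1 := hi w (Or.inl (he.right_mem _ _))
          have h2 := (hyy₁ i).1 (hi y₁ (Or.inr rfl))
          exact absurd (h2 ▸ h1) hnw
        · intro hi hip
          rw [hp] at hip; subst hip
          exact hi z (Or.inl (he.left_mem _ _)) ((hz' i hsn).2 (Or.inr (Or.inl hsΔ))))
    have hcK : c ∈ K := hK z hzK w hwK hc
    rw [he.mem_interval_sep y] at hc hpc
    have hnc : n ∉ sep φ y c := fun h1 => hsn ((hp n).1 ((hpc n).1 hn₁ h1)).symm
    have hsc : s ∈ sep φ y c := by
      refine ((hpc s).2 ((hp s).2 rfl)).resolve_left fun h1 => hsn ((hyy₁ s).1 h1)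
    have hmc : m ∉ sep φ y c := by
      intro h1
      rcases (hc m).2 h1 with h2 | h2
      · rw [hz' m hmn] at h2
        rcases h2 with h2 | h2 | h2
        · exact hmh h2
        · exact hmΔ h2
        · exact hmη h2
      · exact hpm.1 t₂ hht₂ hnt₂ ((ht₂ m hmn).2 h2)
    by_cases hhc : h ∈ sep φ y c
    · exact (hpm.2 c hcK hhc).elim hnc hmc
    · have h1 : h ∉ sep φ y₁ c := fun h2 => hhc (by
        have := (hs₁ c h).1 h2
        by_contra h3
        exact hnh (this.2 h3).symm)
      rcases hR.sep_side he hP hK hy₁K h1 with h2 | h2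
      · exact h2 s hsΔ ((hs₁ c s).2 ⟨fun h => absurd h hsn, fun h => absurd hsc h⟩)
      · obtain ⟨j, hj⟩ := hR.ne₂
        have hjn : j ≠ n := by rintro rfl; exact hnη hj
        refine h2 j hj ((hs₁ c j).2 ⟨fun h => absurd h hjn, fun h => absurd ?_ h⟩)
        exact (hc j).1 ((hz' j hjn).2 (Or.inr (Or.inr hj))) (hηw hj)
  · push Not at hE
    have hmt₁ : m ∉ sep φ y t₁ := hpm.1 t₁ hht₁ hnt₁
    have hmτ : m ∉ sep φ y τ := fun hc => hmt₁ ((ht₁ m hmn).2 hc)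
    have hys₁ : y₁ ≠ s₁ := by
      rintro rfl; exact hy₁B hs₁B
    -- Now `n` takes the role of `h`, based at the next vertex `q` towards `s₁`. It is between the
    -- boundary vertices `y₁` and `t₁`, but not on the boundary: its neighbour across `n` would be a
    -- neighbour of `y` in direction `s`. Cutting with `m` makes the outer induction available.
    obtain ⟨q, s, hq, hs, -, hyq, hsq⟩ := he.exists_step_sep hys₁
    rw [e₁] at hs
    have hsn : s ≠ n := by rintro rfl; exact hnΔ hs
    have hqK : q ∈ K := hK _ hy₁K _ hs₁B.1 hq
    have hq' : ∀ v i, i ∈ sep φ q v ↔ ((i = s ∨ i = n) ↔ i ∉ sep φ y v) := by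
      intro v i
      rw [hsq, hs₁]
      by_cases hi : i = s
      · subst hi; simp [hsn]
      · by_cases hin : i = n <;> simp [hi, hin]
        subst hin; simp [hsn.symm]
    have hyq' : ∀ i, i ∈ sep φ y q ↔ i = s ∨ i = n := by
      intro i
      have := hq' q i
      have h2 := notMem_sep_self (φ := φ) q i
      clear * - this h2; tauto
    have hms : m ≠ s := by rintro rfl; exact hmΔ hs
    let K' := K ∩ {x | m ∉ sep φ y x}
    have hK' : IsConvex G K' := he.isConvex_notMem hK m y
    have hnq : ∀ v, n ∉ sep φ q v ↔ n ∈ sep φ y v := by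
      intro v; rw [hq']; simp
    have hqK' : q ∈ K' := ⟨hqK, by rw [Set.mem_ofPred_eq, hyq']; clear * - hmn hms; tauto⟩
    have hbd : ∀ v ∈ K', n ∈ sep φ y v → ∀ v' ∈ K', n ∉ sep φ y v' →
        (∀ j, j ≠ n → (j ∈ sep φ y v ↔ j ∈ sep φ y v')) → v ∈ bdry φ K' n q := by
      intro v hv hnv v' hv' hnv' hj
      refine ⟨hv, (hnq v).2 hnv, v', hv', ?_, fun j hjn => ?_⟩
      · by_contra hc; exact hnv' ((hnq v').1 hc)
      · rw [hq', hq', hj j hjn]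
    have hb₁ : y₁ ∈ bdry φ K' n q := by
      refine hbd y₁ ⟨hy₁K, fun hc => hmn ((hyy₁ m).1 hc)⟩ hn₁ y ⟨hyK, notMem_sep_self y m⟩
        (notMem_sep_self y n) fun j hj => ?_
      rw [hyy₁]; exact iff_of_false hj (notMem_sep_self y j)
    have hbt : t₁ ∈ bdry φ K' n q := hbd t₁ ⟨ht₁K, hmt₁⟩ hnt₁ τ ⟨hτK, hmτ⟩ hnτ ht₁
    have hqhull : q ∈ hull G (bdry φ K' n q) := by
      refine isConvex_hull _ y₁ (subset_hull _ hb₁) t₁ (subset_hull _ hbt) ?_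
      rw [he.mem_interval_sep y]
      intro i
      rw [hyq', hyy₁]
      refine ⟨fun h _ => Or.inr h, ?_⟩
      rintro (rfl | rfl)
      · exact Or.inr ((ht₁ i hsn).2 (hΔτ hs))
      · exact Or.inl rfl
    have hqnot : q ∉ bdry φ K' n q := by
      rintro ⟨-, -, p, hpK, hnp, hp⟩
      obtain ⟨i, hi⟩ := hE s hs p hpK.1
      have h1 : n ∉ sep φ y p := fun hc => (hnq p).2 hc hnp
      have h2 : ∀ j, j ≠ n → (j ∈ sep φ y p ↔ j = s) := by
        intro j hj
        have h3 := (hp j hj).not.trans (iff_true_intro (notMem_sep_self q j))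
        rw [hq'] at h3
        clear * - h3 hj; tauto
      by_cases hin : i = n
      · subst hin
        rcases hi with ⟨h3, -⟩ | ⟨-, h3⟩
        · exact h1 h3
        · exact hsn h3.symm
      · have := h2 i hin
        clear * - this hi; tauto
    obtain ⟨Γ₁, Γ₂, hR'⟩ := IH' m y r₀ hr₀.1 hmr₀ n q hqK hqK'.2 hqhull hqnot
    have hWLOG : ∃ Ξ, Ring φ K' n q {s} Ξ := by
      have hsy : sep φ q y₁ = {s} := by
        ext i
        rw [hq', hyy₁, Set.mem_singleton_iff]
        by_cases h1 : i = s
        · subst h1; simp [hsn]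
        · simp [h1]
      have hsub : ∀ Δ : Set ι, Δ.Nonempty → Δ ⊆ {s} → Δ = {s} := fun Δ h1 h2 =>
        (Set.Nonempty.subset_singleton_iff h1).1 h2
      rcases hR'.cover y₁ hb₁ with h1 | h1
      · rw [hsy] at h1
        exact ⟨Γ₂, hsub Γ₁ hR'.ne₁ h1 ▸ hR'⟩
      · rw [hsy] at h1
        exact ⟨Γ₁, hsub Γ₂ hR'.ne₂ h1 ▸ hR'.symm⟩
    obtain ⟨Ξ, hΞ⟩ := hWLOG
    have hΞτ : Ξ ⊆ sep φ y τ := by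
      have h1 := (hΞ.cover t₁ hbt).resolve_left fun hc => by
        have := hc rfl
        rw [hq', ht₁ s hsn] at this
        exact (this.1 (Or.inl rfl)) (hΔτ hs)
      intro i hi
      have h2 := h1 hi
      have his : i ≠ s := by rintro rfl; exact hΞ.disj i rfl hi
      have hin : i ≠ n := by rintro rfl; exact hΞ.notMem₂ hi
      rw [hq', ht₁ i hin] at h2
      by_contra hc
      exact (h2.2 hc).elim his hin
    obtain ⟨b₂, ⟨hb₂K, hnb₂, b₃, hb₃K, hnb₃, hb₃⟩, hb₂⟩ := hΞ.mem₂
    have hb₃' : ∀ i, i ∈ sep φ y b₃ ↔ i = s ∨ i ∈ Ξ := by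
      intro i
      by_cases hin : i = n
      · subst hin
        have h1 := hΞ.notMem₂
        have h2 := hq' b₃ i
        have h3 := hsn.symm
        clear * - h1 h2 h3 hnb₃; tauto
      · have h1 := hb₃ i hin
        rw [hb₂, hq'] at h1
        by_cases his : i = s
        · have := hΞ.disj i his
          clear * - h1 his this hin; tauto
        · clear * - h1 his hin; tauto
    -- Were `Ξ` contained in `Δ`, the first step from `y` to `b₃` would be in a direction of `Δ`,
    -- which is excluded in this case.
    have hbΔ : ∃ b ∈ Ξ, b ∉ Δ := by
      by_contra hc
      push Not at hc
      have hne : y ≠ b₃ := by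
        rintro rfl
        exact notMem_sep_self y s ((hb₃' s).2 (Or.inl rfl))
      obtain ⟨p, k, hp, hk, -, hyp, -⟩ := he.exists_step_sep hne
      have hkΔ : k ∈ Δ := by
        rcases (hb₃' k).1 hk with rfl | h1
        · exact hs
        · exact hc k h1
      obtain ⟨i, hi⟩ := hE k hkΔ p (hK _ hyK _ hb₃K.1 hp)
      have := hyp i
      clear * - this hi; tauto
    obtain ⟨b, hbΞ, hbΔ⟩ := hbΔ
    have hbn : b ≠ n := by rintro rfl; exact hΞ.notMem₂ hbΞ
    have hbh : b ≠ h := by rintro rfl; exact hhτ (hΞτ hbΞ)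
    have hbη : b ∉ η := by
      intro hbη
      have h1 : n ∉ sep φ q s₂ := (hnq s₂).2 ((hη n).2 (Or.inl rfl))
      rcases hΞ.sep_side he hP hK' hqK' h1 with h2 | h2
      · refine h2 s rfl ?_
        rw [hq', hη]
        have := hR.disj s hs
        clear * - this hsn; tauto
      · refine h2 b hbΞ ?_
        rw [hq', hη]
        have : b ≠ s := by rintro rfl; exact hbΔ hs
        clear * - this hbn hbη; tauto
    -- Neither `s₁` nor `s₂` has `b`, so the partner lies in both of their coordinate sets and is
    -- `n`. But `t₁` has both `b` and `n`.
    obtain ⟨b', hb'⟩ := pair b hbh τ hτK (hΞτ hbΞ)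
    have hb'n : b' = n := by
      have h1 := (hb' s₁ hs₁B).resolve_left (by rw [hΔ]; clear * - hbn hbΔ; tauto)
      have h2 := (hb' s₂ hs₂B).resolve_left (by rw [hη]; clear * - hbn hbη; tauto)
      rw [hΔ] at h1
      rw [hη] at h2
      have := hR.disj b'
      clear * - h1 h2 this; tauto
    subst hb'n
    exact (he.pair_props hP hK hyK hy hb').1 t₁ hht₁ ((ht₁ b hbn).2 (hΞτ hbΞ)) hnt₁
end IsEmb
end RingExistence

/-! ### Retracts of Peano partial cubes -/

section Retract
variable {V : Type u} {ι : Type v} {G : SimpleGraph V} {φ : V → ι → Bool}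

/-- A distance non-increasing retraction of a partial cube onto the subgraph induced by `S`. -/
structure Retraction (G : SimpleGraph V) (φ : V → ι → Bool) (S : Set V) (f : V → S) : Prop where
  emb : IsEmb G φ
  embS : IsEmb (G.induce S) fun s : S => φ s
  fix : ∀ s : S, f s = s
  dist_le : ∀ x y, G.dist (f x : V) (f y) ≤ G.dist x y

theorem IsEmb.eq_of_dist_le_one (he : IsEmb G φ) {a b : V} (h1 : G.dist a b ≤ 1) {h : ι}
    (hh : φ a h ≠ φ b h) (j : ι) (hj : j ≠ h) : φ a j = φ b j := by
  rw [← he.ncard_sep] at h1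
  by_contra hc
  exact hj ((Set.ncard_le_one (he.finite_sep a b)).1 h1 j hc h hh)

/-- The inclusion of `S` and the restriction of `f` are both non-expansive for extended distances,
so `S` induces a connected isometric subgraph. -/
theorem IsEmb.retraction (he : IsEmb G φ) {S : Set V} {f : V → S}
    (hc : IsContraction G (G.induce S) f) (hf : ∀ s : S, f s = s) : Retraction G φ S f := by
  have hle : ∀ x y : S, G.edist (x : V) y ≤ (G.induce S).edist x y := by
    intro x y
    by_cases hr : (G.induce S).Reachable x y
    · obtain ⟨p, hp⟩ := hr.exists_walk_length_eq_edist
      rw [← hp, ← Walk.length_map (Embedding.induce S).toHom]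
      exact edist_le _
    · rw [edist_eq_top_of_not_reachable hr]; exact le_top
  have hge : ∀ x y : S, (G.induce S).edist x y ≤ G.edist (x : V) y := by
    intro x y
    have := hc x y
    rwa [hf, hf] at this
  have hreach : ∀ x y : S, (G.induce S).Reachable x y := by
    intro x y
    rw [← edist_ne_top_iff_reachable]
    refine ne_top_of_le_ne_top ?_ (hge x y)
    rw [edist_ne_top_iff_reachable]; exact he.conn.preconnected _ _
  have hdist : ∀ x y : S, G.dist (x : V) y = (G.induce S).dist x y := by
    intro x y
    have h1 := (hle x y).antisymm (hge x y)
    rw [← (hreach x y).coe_dist_eq_edist, ← (he.conn.preconnected _ _).coe_dist_eq_edist] at h1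
    exact_mod_cast h1
  obtain ⟨x0⟩ := he.conn.nonempty
  have hconn : (G.induce S).Connected := { preconnected := hreach, nonempty := ⟨f x0⟩ }
  refine ⟨he, he.of_dist hconn Subtype.val hdist, hf, fun x y => ?_⟩
  have h1 := hc x y
  rw [hdist]
  rw [← (hreach _ _).coe_dist_eq_edist, ← (he.conn.preconnected _ _).coe_dist_eq_edist] at h1
  exact_mod_cast h1

namespace Retraction
variable {S : Set V} {f : V → S} (hR : Retraction G φ S f)
include hR

theorem mem_interval {x y z : S} :
    z ∈ interval (G.induce S) x y ↔ (z : V) ∈ interval G x y := by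
  rw [hR.embS.mem_interval, hR.emb.mem_interval]

theorem map_interval {x y : S} {z : V} (hz : z ∈ interval G x y) :
    f z ∈ interval (G.induce S) x y := by
  rw [hR.mem_interval, mem_interval_iff_dist hR.emb.conn]
  have h1 := (mem_interval_iff_dist hR.emb.conn).1 hz
  have h2 := hR.dist_le x z
  have h3 := hR.dist_le z y
  rw [hR.fix] at h2 h3
  have h4 := hR.emb.conn.dist_triangle (u := (x : V)) (v := (f z : V)) (w := (y : V))
  omega

theorem mem_bdry_of_flip {A : Set S} {h : ι} {y : S} {a b : V} (ha : f a ∈ A) (hb : f b ∈ A)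
    (hab : G.dist a b ≤ 1) (hah : h ∉ sep φ y (f a)) (hbh : h ∈ sep φ y (f b)) :
    f a ∈ bdry (fun s : S => φ s) A h y := by
  refine ⟨ha, hah, f b, hb, hbh, fun j hj => ?_⟩
  refine ((eq_iff_mem_sep (y : V) _ _ j).1 ?_)
  refine hR.emb.eq_of_dist_le_one ((hR.dist_le b a).trans (by rwa [dist_comm])) ?_ j hj
  rw [Ne, eq_iff_mem_sep (y : V)]
  tauto

omit hR in
theorem dist_le_one (he : IsEmb G φ) {a b : V} {h : ι} (hj : ∀ j, j ≠ h → φ a j = φ b j) :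
    G.dist a b ≤ 1 := by
  rw [← he.ncard_sep, Set.ncard_le_one (he.finite_sep a b)]
  intro i hi j hj'
  have h1 : i = h := by by_contra hc; exact hi (hj i hc)
  have h2 : j = h := by by_contra hc; exact hj' (hj j hc)
  rw [h1, h2]

/-- The vertices of a convex set between two boundary vertices are stable. -/
theorem stable_of_between (hP : PeanoAxiom G) {A : Set S} (hA : IsConvex (G.induce S) A) {h : ι}
    {y ρ₁ ρ₂ : S} (h₁ : ρ₁ ∈ bdry (fun s : S => φ s) A h y)
    (h₂ : ρ₂ ∈ bdry (fun s : S => φ s) A h y) (hy : y ∈ interval (G.induce S) ρ₁ ρ₂)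
    {p : S} (hp : h ∉ sep φ y p) :
    ∃ r ∈ bdry (fun s : S => φ s) A h y, y ∈ interval (G.induce S) p r := by
  obtain ⟨hA₁, hh₁, s₁, hs₁, hsh₁, hj₁⟩ := id h₁
  obtain ⟨hA₂, hh₂, s₂, hs₂, hsh₂, hj₂⟩ := id h₂
  have he := hR.emb
  -- A finite convex set of `G`, not of the retract, because the ring needs the Peano axiom.
  let K := hull G {(ρ₁ : V), (ρ₂ : V), (s₁ : V), (s₂ : V)}
  have hK : IsConvex G K := isConvex_hull _
  have hKfin : K.Finite := he.finite_hull (by simp)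
  have b₁ : (ρ₁ : V) ∈ bdry φ K h y := ⟨subset_hull _ (by simp), hh₁, s₁, subset_hull _ (by simp),
    hsh₁, hj₁⟩
  have b₂ : (ρ₂ : V) ∈ bdry φ K h y := ⟨subset_hull _ (by simp), hh₂, s₂, subset_hull _ (by simp),
    hsh₂, hj₂⟩
  have hyG : (y : V) ∈ interval G ρ₁ ρ₂ := hR.mem_interval.1 hy
  have hyK : (y : V) ∈ K := hK _ b₁.1 _ b₂.1 hyG
  have hdis : ∀ i, i ∈ sep φ y ρ₁ → i ∉ sep φ y ρ₂ := fun i i1 i2 =>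
    notMem_sep_self (y : V) i (((he.mem_interval_sep (y : V)).1 hyG i).1 i1 i2)
  -- a vertex of the opposite side is retracted into the opposite side
  have opp : ∀ z : V, h ∈ sep φ y z → (∀ i ∈ sep φ y z, i = h ∨ i ∈ sep φ y ρ₁ ∨ i ∈ sep φ y ρ₂) →
      f z ∈ A ∧ h ∈ sep φ y (f z) := by
    intro z hz hsub
    have : z ∈ interval G s₁ s₂ := by
      rw [he.mem_interval_sep (y : V)]
      intro i
      by_cases hi : i = h
      · subst hi; exact ⟨fun _ _ => hz, fun _ => Or.inl hsh₁⟩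
      · have e1 : i ∈ sep φ y s₁ ↔ i ∈ sep φ y ρ₁ := hj₁ i hi
        have e2 : i ∈ sep φ y s₂ ↔ i ∈ sep φ y ρ₂ := hj₂ i hi
        rw [e1, e2]
        exact ⟨fun i1 i2 => absurd i2 (hdis i i1), fun h => (hsub i h).resolve_left hi⟩
    have h3 := hR.map_interval this
    refine ⟨hA s₁ hs₁ s₂ hs₂ h3, ?_⟩
    exact ((he.mem_interval_sep (y : V)).1 (hR.mem_interval.1 h3) h).1 hsh₁ hsh₂
  by_cases hyb : (y : V) ∈ bdry φ K h y
  · obtain ⟨-, -, z, -, hz, hj⟩ := hyb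
    have hself : ∀ i ∈ sep φ (y : V) z, i = h := fun i hi => by
      by_contra hc
      exact notMem_sep_self (y : V) i ((hj i hc).1 hi)
    obtain ⟨hz1, hz2⟩ := opp z hz fun i hi => Or.inl (hself i hi)
    have hyA : y ∈ A := hA _ hA₁ _ hA₂ hy
    have := hR.mem_bdry_of_flip (A := A) (h := h) (y := y) (a := y) (b := z) (by rwa [hR.fix]) hz1
      (dist_le_one he (h := h) fun j hj => by
        by_contra hc
        exact hj (hself j hc)) (by rw [hR.fix]; exact notMem_sep_self _ _) hz2
    rw [hR.fix] at this
    exact ⟨y, this, hR.embS.right_mem _ _⟩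
  · have hyh : (y : V) ∈ hull G (bdry φ K h y) :=
      isConvex_hull _ _ (subset_hull _ b₁) _ (subset_hull _ b₂) hyG
    obtain ⟨Δ₁, Δ₂, hΔ⟩ := he.exists_ring hP K hKfin hK h y hyK hyh hyb
    -- The retraction takes a ring vertex `r` to a boundary vertex between `y` and `ρ₁`, which
    -- therefore lies behind `Δ₁` and not `Δ₂`. Being no farther from `y` than `r`, it has the
    -- coordinate set `Δ₁` exactly.
    have key : ∀ Δ₁ Δ₂ : Set ι, Ring φ K h y Δ₁ Δ₂ → ∀ ρ₁ ρ₂ : S,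
        ρ₁ ∈ A → Δ₁ ⊆ sep φ y ρ₁ → Δ₂ ⊆ sep φ y ρ₂ → h ∉ sep φ y ρ₁ →
        (∀ i, i ∈ sep φ y ρ₁ → i ∉ sep φ y ρ₂) →
        (∀ z : V, h ∈ sep φ y z → (∀ i ∈ sep φ y z, i = h ∨ i ∈ sep φ y ρ₁ ∨ i ∈ sep φ y ρ₂) →
          f z ∈ A ∧ h ∈ sep φ y (f z)) →
        ∃ r ∈ bdry (fun s : S => φ s) A h y, sep φ y r = Δ₁ := by
      intro Δ₁ Δ₂ hΔ ρ₁ ρ₂ hρA hs1 hs2 hhρ hdis opp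
      obtain ⟨r, ⟨hrK, hrh, s, hsK, hsh, hj⟩, hr⟩ := hΔ.mem₁
      have hrs : ∀ i ∈ sep φ (y : V) s, i = h ∨ i ∈ sep φ y ρ₁ ∨ i ∈ sep φ y ρ₂ := by
        intro i hi
        by_cases hih : i = h
        · exact Or.inl hih
        · have := (hj i hih).1 hi
          rw [hr] at this
          exact Or.inr (Or.inl (hs1 this))
      obtain ⟨hs3, hs4⟩ := opp s hsh hrs
      have hrI : r ∈ interval G y ρ₁ := by
        rw [he.mem_interval_sep (y : V)]
        intro i
        refine ⟨fun h => absurd h (notMem_sep_self (y : V) i), fun h => Or.inr (hs1 (hr ▸ h))⟩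
      have hfr := hR.map_interval hrI
      have hsubr := he.mem_of_interval_sep (y : V) (hR.mem_interval.1 hfr)
      have hyA : y ∈ A := hA _ hA₁ _ hA₂ hy
      have hfb := hR.mem_bdry_of_flip (A := A) (h := h) (y := y) (a := r) (b := s)
        (hA y hyA ρ₁ hρA hfr) hs3 (dist_le_one he (h := h) fun j hjh =>
          (eq_iff_mem_sep (y : V) _ _ j).2 (hj j hjh).symm) (fun hc => hhρ (hsubr hc)) hs4
      refine ⟨f r, hfb, ?_⟩
      have hcov := hΔ.cover_univ he hP hK hyK (K' := Set.univ) (r := f r) (by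
        obtain ⟨-, h1, t, -, h2⟩ := hfb
        exact ⟨trivial, h1, t, trivial, h2⟩)
      have h5 : Δ₁ ⊆ sep φ y (f r) := by
        refine hcov.resolve_right fun hc => ?_
        obtain ⟨i, hi⟩ := hΔ.ne₂
        exact hdis i (hsubr (hc hi)) (hs2 hi)
      have h6 := hR.dist_le y r
      rw [hR.fix, ← he.ncard_sep, ← he.ncard_sep, hr] at h6
      exact (Set.eq_of_subset_of_ncard_le h5 h6 (he.finite_sep _ _)).symm
    have both : ∃ r₁ ∈ bdry (fun s : S => φ s) A h y, ∃ r₂ ∈ bdry (fun s : S => φ s) A h y,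
        sep φ y r₁ = Δ₁ ∧ sep φ y r₂ = Δ₂ := by
      have opp' : ∀ z : V, h ∈ sep φ y z →
          (∀ i ∈ sep φ y z, i = h ∨ i ∈ sep φ y ρ₂ ∨ i ∈ sep φ y ρ₁) →
          f z ∈ A ∧ h ∈ sep φ y (f z) := fun z hz hs => opp z hz fun i hi => (hs i hi).imp_right Or.symm
      have hdis' : ∀ i, i ∈ sep φ y ρ₂ → i ∉ sep φ y ρ₁ := fun i i1 i2 => hdis i i2 i1
      obtain ⟨i₁, hi₁⟩ := hΔ.ne₁
      obtain ⟨i₂, hi₂⟩ := hΔ.ne₂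
      rcases hΔ.cover _ b₁ with c1 | c1
      · have c2 := (hΔ.cover _ b₂).resolve_left fun c2 => hdis _ (c1 hi₁) (c2 hi₁)
        obtain ⟨r₁, hr₁, e₁⟩ := key Δ₁ Δ₂ hΔ ρ₁ ρ₂ hA₁ c1 c2 hh₁ hdis opp
        obtain ⟨r₂, hr₂, e₂⟩ := key Δ₂ Δ₁ hΔ.symm ρ₂ ρ₁ hA₂ c2 c1 hh₂ hdis' opp'
        exact ⟨r₁, hr₁, r₂, hr₂, e₁, e₂⟩
      · have c2 := (hΔ.cover _ b₂).resolve_right fun c2 => hdis _ (c1 hi₂) (c2 hi₂)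
        obtain ⟨r₁, hr₁, e₁⟩ := key Δ₁ Δ₂ hΔ ρ₂ ρ₁ hA₂ c2 c1 hh₂ hdis' opp'
        obtain ⟨r₂, hr₂, e₂⟩ := key Δ₂ Δ₁ hΔ.symm ρ₁ ρ₂ hA₁ c1 c2 hh₁ hdis opp
        exact ⟨r₁, hr₁, r₂, hr₂, e₁, e₂⟩
    obtain ⟨r₁, hr₁, r₂, hr₂, e₁, e₂⟩ := both
    have fin : ∀ r : S, (∀ i ∈ sep φ y r, i ∉ sep φ y p) → y ∈ interval (G.induce S) p r := by
      intro r hr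
      rw [hR.mem_interval, he.mem_interval_sep (y : V)]
      exact fun i => ⟨fun h1 h2 => absurd h1 (hr i h2), fun h => absurd h (notMem_sep_self (y : V) i)⟩
    rcases hΔ.sep_side he hP hK hyK hp with h3 | h3
    · exact ⟨r₁, hr₁, fin r₁ (e₁ ▸ h3)⟩
    · exact ⟨r₂, hr₂, fin r₂ (e₂ ▸ h3)⟩

/-- A non-empty copoint `C` at `x` in `A` is the part of `A` beyond a coordinate `h` separating it
from `x`. Let `Y` be the near-side vertices that lie between any near-side vertex and some boundary
vertex. Then `C ∪ Y` is convex and contains `x`, and every vertex of `Y` is on a geodesic from `x`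
to `C`. -/
theorem phOne (hP : PeanoAxiom G) : PhOne (G.induce S) := by
  intro A hfin hA x hx C hC
  have he := hR.embS
  rcases C.eq_empty_or_nonempty with rfl | hne
  · rw [Set.empty_union]
    have : IsConvex (G.induce S) {x} := by
      rintro _ rfl _ rfl z hz; exact he.interval_self hz
    exact fun y hy => he.subset_preHull _ (hull_subset this subset_rfl hy)
  obtain ⟨hCc, hCA, hxC⟩ := hC.prop
  obtain ⟨h, hh⟩ := he.exists_separation hCc hne hxC
  have hCh : ∀ c ∈ A, h ∈ sep φ x c → c ∈ C := by
    have hconv : IsConvex (G.induce S) (A ∩ {c : S | h ∈ sep φ x c}) := by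
      refine hA.inter fun a ha b hb c hc => ?_
      exact ((he.mem_interval_sep x).1 hc h).1 ha hb
    have hmax := hC.le_of_ge (y := A ∩ {c : S | h ∈ sep φ x c})
      ⟨hconv, Set.inter_subset_left, fun hc => notMem_sep_self (x : V) h hc.2⟩
      fun c hc => ⟨hCA hc, (hh c hc).symm⟩
    exact fun c hcA hch => hmax ⟨hcA, hch⟩
  have hCh' : ∀ c ∈ C, h ∈ sep φ x c := fun c hc => (hh c hc).symm
  have bdx : ∀ y : S, h ∉ sep φ x y →
      bdry (fun s : S => φ s) A h y = bdry (fun s : S => φ s) A h x := fun y hy =>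
    (IsEmb.bdry_congr (φ := fun s : S => φ s) hy).symm
  let Y : Set S := {y | y ∈ A ∧ h ∉ sep φ x y ∧ ∀ p ∈ A, h ∉ sep φ x p →
    ∃ r ∈ bdry (fun s : S => φ s) A h x, y ∈ interval (G.induce S) p r}
  have hbY : ∀ r ∈ bdry (fun s : S => φ s) A h x, r ∈ Y := fun r hr =>
    ⟨hr.1, hr.2.1, fun p _ _ => ⟨r, hr, he.right_mem _ _⟩⟩
  have key : ∀ ρ₁ ∈ bdry (fun s : S => φ s) A h x, ∀ ρ₂ ∈ bdry (fun s : S => φ s) A h x,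
      ∀ y ∈ interval (G.induce S) ρ₁ ρ₂, y ∈ Y := by
    intro ρ₁ h₁ ρ₂ h₂ y hy
    have hyh : h ∉ sep φ x y := fun hc =>
      (((he.mem_interval_sep x).1 hy h).2 hc).elim h₁.2.1 h₂.2.1
    refine ⟨hA _ h₁.1 _ h₂.1 hy, hyh, fun p hp hph => ?_⟩
    rw [← bdx y hyh] at h₁ h₂ ⊢
    refine hR.stable_of_between hP hA h₁ h₂ hy fun hc => ?_
    have h3 : φ x h = φ y h := not_not.1 hyh
    have h4 : φ x h = φ p h := not_not.1 hph
    exact hc (h3.symm.trans h4)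
  have cross : ∀ t ∈ A, h ∉ sep φ x t → ∀ b ∈ C, ∃ r ∈ bdry (fun s : S => φ s) A h x,
      r ∈ interval (G.induce S) t b := by
    intro t ht hth b hb
    obtain ⟨s, s', h1, h2, h3, h4, h5⟩ := he.exists_flip_sep x (n := h) hth (hCh' b hb)
    exact ⟨s, ⟨hA _ ht _ (hCA hb) h1, h3, s', hA _ ht _ (hCA hb) h2, h4, h5⟩, h1⟩
  -- A near-side `t` is between two boundary vertices: `ρ₂`, where a geodesic from `t` to `b`
  -- crosses `h`, and `ρ₁`, which is opposite to `ρ₂` through `a`.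
  have mixed : ∀ a ∈ Y, ∀ b ∈ C, ∀ t ∈ interval (G.induce S) a b, t ∈ C ∪ Y := by
    intro a ha b hb t ht
    have htA : t ∈ A := hA a ha.1 b (hCA hb) ht
    by_cases hth : h ∈ sep φ x t
    · exact Or.inl (hCh t htA hth)
    · obtain ⟨ρ₂, hρ₂, hI⟩ := cross t htA hth b hb
      obtain ⟨ρ₁, hρ₁, ha1⟩ := ha.2.2 ρ₂ hρ₂.1 hρ₂.2.1
      right
      refine key ρ₂ hρ₂ ρ₁ hρ₁ t ?_
      refine he.interval_trans ha1 ?_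
      rw [he.mem_interval] at ht hI ⊢
      intro i hi
      have h1 := ht i
      have h2 := hI i
      revert hi h1 h2
      cases φ (ρ₂ : V) i <;> cases φ (a : V) i <;> cases φ (b : V) i <;> cases φ (t : V) i <;> simp
  have hconv : IsConvex (G.induce S) (C ∪ Y) := by
    rintro a (ha | ha) b (hb | hb) t ht
    · exact Or.inl (hCc a ha b hb ht)
    · exact mixed b hb a ha t (he.symm_mem ht)
    · exact mixed a ha b hb t ht
    · right
      obtain ⟨ρ₁, hρ₁, ha1⟩ := ha.2.2 b hb.1 hb.2.1
      obtain ⟨ρ₂, hρ₂, hb1⟩ := hb.2.2 ρ₁ hρ₁.1 hρ₁.2.1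
      exact key ρ₁ hρ₁ ρ₂ hρ₂ t (he.interval_trans hb1 (he.symm_mem (he.interval_trans ha1
        (he.symm_mem ht))))
  -- Otherwise `C ∪ Y` would avoid `x`, and be larger than `C` because it contains the boundary.
  have hxY : x ∈ Y := by
    by_contra hxY
    obtain ⟨c, hc⟩ := hne
    obtain ⟨r, hr, -⟩ := cross x hx (notMem_sep_self (x : V) h) c hc
    have := hC.le_of_ge (y := C ∪ Y) ⟨hconv, Set.union_subset hCA fun y hy => hy.1,
      fun h => h.elim hxC hxY⟩ Set.subset_union_left
    exact hr.2.1 (hCh' r (this (Or.inr (hbY r hr))))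
  intro y hy
  have hy' := hull_subset hconv (Set.union_subset Set.subset_union_left (by
    rintro _ rfl; exact Or.inr hxY)) hy
  rcases hy' with hyC | hyY
  · exact he.subset_preHull _ (Or.inl hyC)
  · obtain ⟨r, ⟨-, hrh, s, hs, hsh, hj⟩, hI⟩ := hyY.2.2 x hx (notMem_sep_self (x : V) h)
    refine Set.mem_biUnion (Or.inr rfl) (Set.mem_biUnion (Or.inl (hCh s hs hsh)) ?_)
    refine he.interval_trans ?_ hI
    rw [he.mem_interval_sep x]
    intro i
    refine ⟨fun h => absurd h (notMem_sep_self (x : V) i), fun hi => Or.inr ((hj i ?_).2 hi)⟩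
    rintro rfl; exact hrh hi

end Retraction

theorem isPeanoPartialCube_retract : ClosedUnderRetracts.{u} IsPeanoPartialCube := by
  rintro V G h S ⟨f, hc, hf⟩
  obtain ⟨ι, φ, he, hP⟩ := isPeanoPartialCube_iff.1 h
  have hR := he.retraction hc hf
  exact ⟨isPartialCube_iff.2 ⟨ι, _, hR.embS⟩, hR.embS.phOne_iff.2 (hR.phOne hP)⟩

end Retract

/-! ### Hyper-medians in isomorphic copies, convex subgraphs and gated amalgams -/

/-- The triple `(a, b, c)` has a median or a hyper-median. -/
def HasHyperMedian {V : Type u} (G : SimpleGraph V) (a b c : V) : Prop :=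
  (∃ m, IsMedian G a b c m) ∨ ∃ x y z, IsHyperMedian G a b c x y z

theorem HasHyperMedian.rotate {V : Type u} {G : SimpleGraph V} {a b c : V}
    (h : HasHyperMedian G a b c) : HasHyperMedian G b c a := by
  rcases h with ⟨m, h1, h2, h3⟩ | ⟨x, y, z, ⟨⟨⟨t1, t2, t3⟩, h1, h2, h3⟩, h4⟩⟩
  · exact Or.inl ⟨m, h2, h3, h1⟩
  · refine Or.inr ⟨y, z, x, ⟨⟨⟨t2, t3, t1⟩, h2, h3, h1⟩, ?_⟩⟩
    have : ({y, z, x} : Set V) = {x, y, z} := by ext; simp; tauto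
    rwa [this]

theorem IsHypertorus.iso {V : Type u} {W : Type v} {G : SimpleGraph V} {H : SimpleGraph W}
    (e : G ≃g H) (h : IsHypertorus G) : IsHypertorus H := by
  obtain ⟨n, k, h1, h2, ⟨e'⟩⟩ := h
  exact ⟨n, k, h1, h2, ⟨e.symm.trans e'⟩⟩

/-- An isomorphism restricts to induced subgraphs. -/
noncomputable def inducedIso {V : Type u} {W : Type v} {G : SimpleGraph V} {H : SimpleGraph W}
    (e : G ≃g H) (A : Set V) : G.induce A ≃g H.induce (e '' A) where
  toEquiv := e.toEquiv.image A
  map_rel_iff' := by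
    intro a b
    exact e.map_adj_iff

/-- An induced subgraph of an induced subgraph is an induced subgraph. -/
noncomputable def induceInduceIso {V : Type u} {G : SimpleGraph V} {S : Set V} (A : Set S) :
    (G.induce S).induce A ≃g G.induce (Subtype.val '' A) where
  toEquiv := Equiv.Set.image Subtype.val A Subtype.val_injective
  map_rel_iff' := Iff.rfl

section Iso
variable {V : Type u} {W : Type v} {G : SimpleGraph V} {H : SimpleGraph W}

theorem isMetricTriangle_iso (e : G ≃g H) {x y z : V} (h : IsMetricTriangle G x y z) :
    IsMetricTriangle H (e x) (e y) (e z) := by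
  obtain ⟨h1, h2, h3⟩ := h
  refine ⟨?_, ?_, ?_⟩ <;>
    rw [image_interval_iso, image_interval_iso, ← Set.image_inter e.injective, ← Set.image_singleton]
  · rw [h1]
  · rw [h2]
  · rw [h3]

theorem hasHyperMedian_iso (e : G ≃g H) {a b c : V} (h : HasHyperMedian G a b c) :
    HasHyperMedian H (e a) (e b) (e c) := by
  rcases h with ⟨m, h1, h2, h3⟩ | ⟨x, y, z, ⟨⟨t, h1, h2, h3⟩, h4⟩⟩
  · exact Or.inl ⟨e m, (mem_interval_iso e).2 h1, (mem_interval_iso e).2 h2, (mem_interval_iso e).2 h3⟩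
  · refine Or.inr ⟨e x, e y, e z, ⟨⟨isMetricTriangle_iso e t, ?_, ?_, ?_⟩, ?_⟩⟩
    · simp only [dist_iso]; exact h1
    · simp only [dist_iso]; exact h2
    · simp only [dist_iso]; exact h3
    · have : ({e x, e y, e z} : Set W) = e '' {x, y, z} := by
        simp [Set.image_insert_eq]
      rw [this, hull_iso]
      exact h4.iso (inducedIso e _)

end Iso

section Transfer
variable {V : Type u} {G : SimpleGraph V} {S : Set V}

theorem isQuasiMedian_induce (hint : ∀ x y z : S, z ∈ interval (G.induce S) x y ↔
    (z : V) ∈ interval G x y) (hdist : ∀ x y : S, (G.induce S).dist x y = G.dist (x : V) y)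
    {a b c x y z : S} (h : IsQuasiMedian G (a : V) b c x y z) :
    IsQuasiMedian (G.induce S) a b c x y z := by
  obtain ⟨⟨t1, t2, t3⟩, h1, h2, h3⟩ := h
  have key : ∀ p q r s t : S, interval G (p : V) q ∩ interval G (r : V) s = {(t : V)} →
      interval (G.induce S) p q ∩ interval (G.induce S) r s = {t} := by
    intro p q r s t h
    ext u
    rw [Set.mem_inter_iff, hint, hint, ← Set.mem_inter_iff, h]
    exact Subtype.val_inj
  exact ⟨⟨key _ _ _ _ _ t1, key _ _ _ _ _ t2, key _ _ _ _ _ t3⟩, by simp only [hdist]; exact h1,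
    by simp only [hdist]; exact h2, by simp only [hdist]; exact h3⟩

theorem isHyperMedian_induce (hint : ∀ x y z : S, z ∈ interval (G.induce S) x y ↔
    (z : V) ∈ interval G x y) (hdist : ∀ x y : S, (G.induce S).dist x y = G.dist (x : V) y)
    {a b c x y z : S} (h : IsHyperMedian G (a : V) b c x y z)
    (hh : Subtype.val '' hull (G.induce S) {x, y, z} = hull G {(x : V), (y : V), (z : V)}) :
    IsHyperMedian (G.induce S) a b c x y z := by
  refine ⟨isQuasiMedian_induce hint hdist h.1, ?_⟩
  have h2 := h.2
  rw [← hh] at h2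
  exact h2.iso (induceInduceIso _).symm

theorem isHyperMedian_of_induce (hS : IsConvex G S) (hint : ∀ x y z : S,
    z ∈ interval (G.induce S) x y ↔ (z : V) ∈ interval G x y)
    (hdist : ∀ x y : S, (G.induce S).dist x y = G.dist (x : V) y)
    {a b c x y z : S} (h : IsHyperMedian (G.induce S) a b c x y z)
    (hh : Subtype.val '' hull (G.induce S) {x, y, z} = hull G {(x : V), (y : V), (z : V)}) :
    IsHyperMedian G (a : V) b c x y z := by
  obtain ⟨⟨⟨t1, t2, t3⟩, h1, h2, h3⟩, h4⟩ := h
  simp only [hdist] at h1 h2 h3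
  have key : ∀ p q r s t : S, interval (G.induce S) p q ∩ interval (G.induce S) r s = {t} →
      interval G (p : V) q ∩ interval G (r : V) s = {(t : V)} := by
    intro p q r s t h
    ext u
    constructor
    · rintro ⟨hu1, hu2⟩
      have hu : u ∈ S := hS p p.2 q q.2 hu1
      have : (⟨u, hu⟩ : S) ∈ interval (G.induce S) p q ∩ interval (G.induce S) r s :=
        ⟨(hint _ _ _).2 hu1, (hint _ _ _).2 hu2⟩
      rw [h] at this
      exact congrArg Subtype.val this
    · rintro rfl
      have : t ∈ interval (G.induce S) p q ∩ interval (G.induce S) r s := by rw [h]; rfl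
      exact ⟨(hint _ _ _).1 this.1, (hint _ _ _).1 this.2⟩
  refine ⟨⟨⟨key _ _ _ _ _ t1, key _ _ _ _ _ t2, key _ _ _ _ _ t3⟩, h1, h2, h3⟩, ?_⟩
  rw [← hh]
  exact h4.iso (induceInduceIso _)

theorem dist_induce_eq (hG : G.Connected) (hS : IsConvex G S) (x y : S) :
    (G.induce S).dist x y = G.dist (x : V) y := by
  obtain ⟨p, hp⟩ := dist_induce_of_isConvex hG hS x y
  refine le_antisymm (hp ▸ dist_le p) ?_
  obtain ⟨q, hq⟩ := p.reachable.exists_walk_length_eq_dist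
  rw [← hq, ← Walk.length_map (Embedding.induce S).toHom]
  exact dist_le _

end Transfer

section Closure

theorem IsQuasiMedian.mem_interval {V : Type u} {G : SimpleGraph V} (hG : G.Connected)
    {a b c x y z : V} (h : IsQuasiMedian G a b c x y z) :
    x ∈ interval G a b ∧ y ∈ interval G a b ∧ y ∈ interval G b c ∧ z ∈ interval G b c ∧
      z ∈ interval G c a ∧ x ∈ interval G c a := by
  obtain ⟨-, h1, h2, h3⟩ := h
  have t1 := hG.dist_triangle (u := a) (v := x) (w := b)
  have t2 := hG.dist_triangle (u := x) (v := y) (w := b)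
  have t3 := hG.dist_triangle (u := a) (v := y) (w := b)
  have t4 := hG.dist_triangle (u := a) (v := x) (w := y)
  have s1 := hG.dist_triangle (u := b) (v := y) (w := c)
  have s2 := hG.dist_triangle (u := y) (v := z) (w := c)
  have s3 := hG.dist_triangle (u := b) (v := z) (w := c)
  have s4 := hG.dist_triangle (u := b) (v := (y : V)) (w := (z : V))
  have r1 := hG.dist_triangle (u := c) (v := z) (w := a)
  have r2 := hG.dist_triangle (u := (z : V)) (v := (x : V)) (w := a)
  have r3 := hG.dist_triangle (u := c) (v := x) (w := a)
  have r4 := hG.dist_triangle (u := c) (v := z) (w := x)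
  simp only [mem_interval_iff_dist hG]
  omega

theorem isHyperMedianPartialCube_iso {V W : Type u} {G : SimpleGraph V} {H : SimpleGraph W}
    (e : G ≃g H) (h : IsHyperMedianPartialCube V G) : IsHyperMedianPartialCube W H := by
  refine ⟨isPeanoPartialCube_iso e h.1, fun a b c => ?_⟩
  obtain ⟨a, rfl⟩ := e.surjective a
  obtain ⟨b, rfl⟩ := e.surjective b
  obtain ⟨c, rfl⟩ := e.surjective c
  exact hasHyperMedian_iso e (h.2 a b c)

theorem isHyperMedianPartialCube_induce :
    ClosedUnderConvexSubgraphs.{u} IsHyperMedianPartialCube := by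
  intro V G h S hne hS
  refine ⟨isPeanoPartialCube_induce V G h.1 S hne hS, fun a b c => ?_⟩
  obtain ⟨ι, φ, he, -⟩ := isPeanoPartialCube_iff.1 h.1
  have hint : ∀ x y z : S, z ∈ interval (G.induce S) x y ↔ (z : V) ∈ interval G x y :=
    fun x y z => he.mem_interval_induce hS
  rcases h.2 a b c with ⟨m, h1, h2, h3⟩ | ⟨x, y, z, hm⟩
  · exact Or.inl ⟨⟨m, hS a a.2 b b.2 h1⟩, (hint _ _ _).2 h1, (hint _ _ _).2 h2, (hint _ _ _).2 h3⟩
  · obtain ⟨i1, i2, -, i3, -⟩ := hm.1.mem_interval he.conn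
    refine Or.inr ⟨⟨x, hS a a.2 b b.2 i1⟩, ⟨y, hS a a.2 b b.2 i2⟩, ⟨z, hS b b.2 c c.2 i3⟩,
      isHyperMedian_induce hint (dist_induce_eq he.conn hS) hm ?_⟩
    rw [he.image_hull hS]
    simp [Set.image_insert_eq]

/-- The gate of `c` lies on geodesics from `c` to `a` and to `b`, so a median or hyper-median of
`a`, `b` and the gate is one of `a`, `b`, `c`. -/
theorem hasHyperMedian_of_gate {V : Type u} {κ : Type v} {G : SimpleGraph V} {A : Set V} {g : V → V}
    {p : V → κ → Bool} {ι : Type w} {φ : V → ι → Bool} (he : IsEmb G φ) (ga : Gate G A g p)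
    (hA : ∀ a b c : A, HasHyperMedian (G.induce A) a b c) {a b c : V} (ha : a ∈ A) (hb : b ∈ A) :
    HasHyperMedian G a b c := by
  have hint : ∀ x y z : A, z ∈ interval (G.induce A) x y ↔ (z : V) ∈ interval G x y :=
    fun x y z => ga.mem_interval_induce x.2 y.2 z.2
  have g1 := ga.gate c a ha
  have g2 := ga.gate c b hb
  rcases hA ⟨a, ha⟩ ⟨b, hb⟩ ⟨g c, ga.mem c⟩ with ⟨m, h1, h2, h3⟩ | ⟨x, y, z, hm⟩
  · rw [hint] at h1 h2 h3
    exact Or.inl ⟨m, h1, he.interval_trans (he.symm_mem g2) h2, he.symm_mem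
      (he.interval_trans (he.symm_mem g1) (he.symm_mem h3))⟩
  · have hm' := isHyperMedian_of_induce ga.conv hint (dist_induce_eq he.conn ga.conv) hm (by
      rw [he.image_hull ga.conv]
      simp [Set.image_insert_eq])
    refine Or.inr ⟨x, y, z, ⟨⟨hm'.1.1, hm'.1.2.1, ?_, ?_⟩, hm'.2⟩⟩
    · obtain ⟨i1, i2, i3, i4, i5, i6⟩ := hm'.1.mem_interval he.conn
      have h4 := hm'.1.2.2.1
      have h5 := he.interval_trans (he.symm_mem g2) i4
      simp only [mem_interval_iff_dist he.conn] at *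
      have s4 := he.conn.dist_triangle (u := b) (v := (y : V)) (w := (z : V))
      omega
    · obtain ⟨i1, i2, i3, i4, i5, i6⟩ := hm'.1.mem_interval he.conn
      have h4 := hm'.1.2.2.2
      have h5 := he.symm_mem (he.interval_trans (he.symm_mem g1) (he.symm_mem i5))
      simp only [mem_interval_iff_dist he.conn] at *
      have s4 := he.conn.dist_triangle (u := (z : V)) (v := (x : V)) (w := a)
      omega

theorem isHyperMedianPartialCube_amalgam :
    ClosedUnderGatedAmalgams.{u} IsHyperMedianPartialCube := by
  intro V₀ V₁ V G₀ G₁ G h₀ h₁ hA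
  have hP := isPeanoPartialCube_amalgam V₀ V₁ V G₀ G₁ G h₀.1 h₁.1 hA
  refine ⟨hP, fun a b c => ?_⟩
  obtain ⟨A, B, hA, hB, -, hU, -, ⟨e₀⟩, ⟨e₁⟩⟩ := hA
  obtain ⟨ι, φ, he, -⟩ := isPeanoPartialCube_iff.1 hP
  obtain ⟨κ, p₀, he₀, -⟩ := isPeanoPartialCube_iff.1 h₀.1
  obtain ⟨κ', q₀, he₁, -⟩ := isPeanoPartialCube_iff.1 h₁.1
  obtain ⟨g, p, ga⟩ := exists_gate he.conn hA he₀ e₀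
  obtain ⟨g', q, gb⟩ := exists_gate he.conn hB he₁ e₁
  have hmA := (isHyperMedianPartialCube_iso e₀ h₀).2
  have hmB := (isHyperMedianPartialCube_iso e₁ h₁).2
  have keyA : ∀ {a b c}, a ∈ A → b ∈ A → HasHyperMedian G a b c := fun ha hb =>
    hasHyperMedian_of_gate he ga hmA ha hb
  have keyB : ∀ {a b c}, a ∈ B → b ∈ B → HasHyperMedian G a b c := fun ha hb =>
    hasHyperMedian_of_gate he gb hmB ha hb
  have hmem : ∀ x, x ∈ A ∨ x ∈ B := fun x => by
    have : x ∈ A ∪ B := hU ▸ trivial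
    exact this
  change HasHyperMedian G a b c
  -- Two of the three vertices share a gated side; they are rotated to the front.
  rcases hmem a with ha | ha <;> rcases hmem b with hb | hb <;> rcases hmem c with hc | hc
  · exact keyA ha hb
  · exact keyA ha hb
  · exact (keyA hc ha).rotate
  · exact (keyB hb hc).rotate.rotate
  · exact (keyA hb hc).rotate.rotate
  · exact (keyB hc ha).rotate
  · exact keyB ha hb
  · exact keyB ha hb
end Closure

/-! ### Hyper-medians in products -/

theorem isHypertorus_of_finite {V : Type u} {G : SimpleGraph V} {J : Type v} [Finite J] {k : J → ℕ}
    (h4 : ∀ j, 4 ≤ 2 * k j) (h5 : ∃ j, 4 < 2 * k j)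
    (e : G ≃g cartProd fun j => cycleGraph (2 * k j)) : IsHypertorus G := by
  obtain ⟨N, ⟨s⟩⟩ := Finite.exists_equiv_fin J
  obtain ⟨j, hj⟩ := h5
  refine ⟨N, fun t => k (s.symm t), fun t => h4 _, ⟨s j, by simpa using hj⟩, ⟨e.trans
    { toEquiv := Equiv.piCongrLeft' (fun j => Fin (2 * k j)) s
      map_rel_iff' := ?_ }⟩⟩
  intro a b
  constructor
  · rintro ⟨t, h1, h2⟩
    refine ⟨s.symm t, h1, fun i hi => ?_⟩
    have := h2 (s i) fun h => hi (by rw [← h, s.symm_apply_apply])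
    simp only [Equiv.piCongrLeft'_apply] at this
    rwa [s.symm_apply_apply] at this
  · rintro ⟨t, h1, h2⟩
    refine ⟨s t, ?_, fun i hi => h2 _ fun h => hi (by rw [← h, s.apply_symm_apply])⟩
    simp only [Equiv.piCongrLeft'_apply]
    rwa [s.symm_apply_apply]

/-- The convex hull of `{x, y, z}` is a product of even cycles, trivially if `x = y = z`. -/
theorem exists_quasiMedian_data {V : Type u} {ι : Type v} {G : SimpleGraph V} {φ : V → ι → Bool}
    (he : IsEmb G φ) {a b c : V} (h : HasHyperMedian G a b c) : ∃ x y z : V,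
      IsQuasiMedian G a b c x y z ∧ ∃ (n : ℕ) (k : Fin n → ℕ), (∀ j, 4 ≤ 2 * k j) ∧
        Nonempty (G.induce (hull G {x, y, z}) ≃g cartProd fun j => cycleGraph (2 * k j)) ∧
        ((n = 0 ∧ x = y ∧ y = z) ∨ ∃ j, 4 < 2 * k j) ∧ (a = b → b = c → n = 0) := by
  have med : ∀ m, IsMedian G a b c m → ∃ x y z : V,
      IsQuasiMedian G a b c x y z ∧ ∃ (n : ℕ) (k : Fin n → ℕ), (∀ j, 4 ≤ 2 * k j) ∧
        Nonempty (G.induce (hull G {x, y, z}) ≃g cartProd fun j => cycleGraph (2 * k j)) ∧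
        ((n = 0 ∧ x = y ∧ y = z) ∨ ∃ j, 4 < 2 * k j) ∧ (a = b → b = c → n = 0) := by
    rintro m ⟨h1, h2, h3⟩
    have hs : interval G m m = {m} := by
      ext u
      exact ⟨fun h => he.interval_self h, by rintro rfl; exact he.left_mem _ _⟩
    have hh : hull G {m, m, m} = {m} := by
      refine Set.Subset.antisymm (hull_subset ?_ (by simp)) ((by simp : ({m} : Set V) ⊆ _).trans
        (subset_hull _))
      rintro _ rfl _ rfl u hu
      rwa [← hs]
    refine ⟨m, m, m, ⟨⟨?_, ?_, ?_⟩, ?_, ?_, ?_⟩, 0, Fin.elim0, fun j => j.elim0, ?_,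
      Or.inl ⟨rfl, rfl, rfl⟩, fun _ _ => rfl⟩
    · rw [hs, Set.inter_self]
    · rw [hs, Set.inter_self]
    · rw [hs, Set.inter_self]
    · rw [dist_self, add_zero, (mem_interval_iff_dist he.conn).1 h1]
    · rw [dist_self, add_zero, (mem_interval_iff_dist he.conn).1 h2]
    · rw [dist_self, add_zero, (mem_interval_iff_dist he.conn).1 h3]
    · rw [hh]
      refine ⟨⟨⟨fun _ j => j.elim0, fun _ => ⟨m, rfl⟩, fun x => ?_, fun x => ?_⟩, ?_⟩⟩
      · exact Subtype.ext x.2.symm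
      · funext j; exact j.elim0
      · rintro ⟨x, rfl⟩ ⟨y, rfl⟩
        constructor
        · rintro ⟨j, -⟩; exact j.elim0
        · intro h; exact absurd rfl (Adj.ne h)
  -- A constant triple must get the empty product of cycles: in a weak product almost all factors
  -- are of this kind, so only finitely many cycles occur.
  by_cases habc : a = b ∧ b = c
  · obtain ⟨rfl, rfl⟩ := habc
    exact med a ⟨he.left_mem _ _, he.left_mem _ _, he.left_mem _ _⟩
  rcases h with ⟨m, hm⟩ | ⟨x, y, z, hq, n, k, h4, h5, e⟩
  · exact med m hm
  · exact ⟨x, y, z, hq, n, k, h4, e, Or.inr h5, fun h1 h2 => absurd ⟨h1, h2⟩ habc⟩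

section Product
variable {ι : Type v} {V : ι → Type w} {G : ∀ i, SimpleGraph (V i)} {κ : ι → Type u}
  {φ : ∀ i, V i → κ i → Bool}

theorem mem_hull_weakCartProd (he : ∀ i, IsEmb (G i) (φ i)) (a : ∀ i, V i)
    {x y z u : {x : ∀ i, V i | (cartProd G).Reachable a x}} :
    u ∈ hull (weakCartProd G a) {x, y, z} ↔ ∀ i, u.1 i ∈ hull (G i) {x.1 i, y.1 i, z.1 i} := by
  rw [(isEmb_weakCartProd he a).mem_hull (by simp)]
  simp only [fun i => (he i).mem_hull (A := {x.1 i, y.1 i, z.1 i}) (by simp), Sigma.forall,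
    Set.mem_insert_iff, Set.mem_singleton_iff, forall_eq_or_imp, forall_eq]

/-- Quasi-medians and hulls of triples are formed coordinatewise. Factors with `n i = 0` contribute
a single vertex; if all do, the result is a median, otherwise the hull is the product of all the
cycles of the factors. -/
theorem hasHyperMedian_weakCartProd (he : ∀ i, IsEmb (G i) (φ i))
    (hm : ∀ i, ∀ a b c, HasHyperMedian (G i) a b c) (o : ∀ i, V i)
    (a b c : {x : ∀ i, V i | (cartProd G).Reachable o x}) :
    HasHyperMedian (weakCartProd G o) a b c := by
  choose x y z hq n k h4 e hn hn0 using fun i => exists_quasiMedian_data (he i) (hm i (a.1 i) (b.1 i) (c.1 i))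
  have E := fun i => (e i).some
  have hI := fun i => (hq i).mem_interval (he i).conn
  have hx : (cartProd G).Reachable o x := mem_weak_of_finite he a ((finite_ne o a b).subset
    fun i hi hab => hi ((he i).interval_self (by have := (hI i).1; rwa [← hab] at this)).symm)
  have hy : (cartProd G).Reachable o y := mem_weak_of_finite he a ((finite_ne o a b).subset
    fun i hi hab => hi ((he i).interval_self (by have := (hI i).2.1; rwa [← hab] at this)).symm)
  have hz : (cartProd G).Reachable o z := mem_weak_of_finite he b ((finite_ne o b c).subset
    fun i hi hab => hi ((he i).interval_self (by have := (hI i).2.2.2.1; rwa [← hab] at this)).symm)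
  have hconn := (isEmb_weakCartProd he o).conn
  have chain : ∀ (p q r s : {x : ∀ i, V i | (cartProd G).Reachable o x}),
      (∀ i, (G i).dist (p.1 i) (s.1 i) = (G i).dist (p.1 i) (q.1 i) + (G i).dist (q.1 i) (r.1 i) +
        (G i).dist (r.1 i) (s.1 i)) →
      (weakCartProd G o).dist p s = (weakCartProd G o).dist p q + (weakCartProd G o).dist q r +
        (weakCartProd G o).dist r s := by
    intro p q r s h
    have h1 : q ∈ interval (weakCartProd G o) p s := by
      rw [mem_interval_weakCartProd he]
      intro i
      rw [mem_interval_iff_dist (he i).conn]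
      have t1 := (he i).conn.dist_triangle (u := p.1 i) (v := q.1 i) (w := s.1 i)
      have t2 := (he i).conn.dist_triangle (u := q.1 i) (v := r.1 i) (w := s.1 i)
      have := h i
      omega
    have h2 : r ∈ interval (weakCartProd G o) q s := by
      rw [mem_interval_weakCartProd he]
      intro i
      rw [mem_interval_iff_dist (he i).conn]
      have t1 := (he i).conn.dist_triangle (u := p.1 i) (v := q.1 i) (w := s.1 i)
      have t2 := (he i).conn.dist_triangle (u := q.1 i) (v := r.1 i) (w := s.1 i)
      have := h i
      omega
    rw [mem_interval_iff_dist hconn] at h1 h2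
    omega
  have tri : ∀ (p q r s t : {x : ∀ i, V i | (cartProd G).Reachable o x}),
      (∀ i, interval (G i) (p.1 i) (q.1 i) ∩ interval (G i) (r.1 i) (s.1 i) = {t.1 i}) →
      interval (weakCartProd G o) p q ∩ interval (weakCartProd G o) r s = {t} := by
    intro p q r s t h
    ext u
    rw [Set.mem_inter_iff, mem_interval_weakCartProd he, mem_interval_weakCartProd he,
      ← forall_and, Set.mem_singleton_iff, Subtype.ext_iff, funext_iff]
    refine forall_congr' fun i => ?_
    rw [← Set.mem_inter_iff, h, Set.mem_singleton_iff]
  have hQ : IsQuasiMedian (weakCartProd G o) a b c ⟨x, hx⟩ ⟨y, hy⟩ ⟨z, hz⟩ :=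
    ⟨⟨tri _ _ _ _ _ fun i => (hq i).1.1, tri _ _ _ _ _ fun i => (hq i).1.2.1,
      tri _ _ _ _ _ fun i => (hq i).1.2.2⟩, chain _ _ _ _ fun i => (hq i).2.1,
      chain _ _ _ _ fun i => (hq i).2.2.1, chain _ _ _ _ fun i => (hq i).2.2.2⟩
  by_cases hall : ∀ i, n i = 0
  · left
    have hxyz : ∀ i, x i = y i ∧ y i = z i := fun i => by
      rcases hn i with h | ⟨j, -⟩
      · exact h.2
      · exact (Fin.cast (hall i) j).elim0
    refine ⟨⟨x, hx⟩, ?_, ?_, ?_⟩ <;> rw [mem_interval_weakCartProd he] <;> intro i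
    · exact (hI i).1
    · have := (hI i).2.2.1; rw [← (hxyz i).1] at this; exact this
    · exact (hI i).2.2.2.2.2
  push Not at hall
  obtain ⟨i₀, hi₀⟩ := hall
  obtain ⟨j₀, hj₀⟩ := (hn i₀).resolve_left fun h => hi₀ h.1
  refine Or.inr ⟨⟨x, hx⟩, ⟨y, hy⟩, ⟨z, hz⟩, hQ, ?_⟩
  have hfin : {i | n i ≠ 0}.Finite := by
    refine ((finite_ne o a b).union (finite_ne o b c)).subset fun i hi => ?_
    by_contra hc
    rw [Set.mem_union, not_or] at hc
    exact hi (hn0 i (not_not.1 hc.1) (not_not.1 hc.2))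
  have hJ : Finite (Σ i, Fin (n i)) := by
    have := hfin.to_subtype
    refine Finite.of_injective (β := Σ i : {i | n i ≠ 0}, Fin (n i))
      (fun p => ⟨⟨p.1, fun h => (Fin.cast h p.2).elim0⟩, p.2⟩) ?_
    rintro ⟨i, j⟩ ⟨i', j'⟩ h
    simp only [Sigma.mk.injEq, Subtype.mk.injEq] at h
    obtain ⟨rfl, h⟩ := h
    rw [eq_of_heq h]
  have hmem := fun u => mem_hull_weakCartProd he o (x := ⟨x, hx⟩) (y := ⟨y, hy⟩) (z := ⟨z, hz⟩) (u := u)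
  have hinv : ∀ w : ∀ p : Σ i, Fin (n i), Fin (2 * k p.1 p.2), (cartProd G).Reachable o
      fun i => ((E i).symm fun j => w ⟨i, j⟩).1 := by
    intro w
    refine mem_weak_of_finite he ⟨x, hx⟩ (hfin.subset fun i hi => ?_)
    intro hni
    apply hi
    have : (⟨x i, subset_hull _ (by simp)⟩ : hull (G i) {x i, y i, z i}) =
        (E i).symm fun j => w ⟨i, j⟩ := by
      apply (E i).injective
      funext j
      exact (Fin.cast hni j).elim0
    exact congrArg Subtype.val this
  refine isHypertorus_of_finite (J := Σ i, Fin (n i)) (k := fun p => k p.1 p.2) (fun p => h4 _ _)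
    ⟨⟨i₀, j₀⟩, hj₀⟩
    { toFun := fun v p => E p.1 ⟨v.1.1 p.1, (hmem _).1 v.2 p.1⟩ p.2
      invFun := fun w => ⟨⟨_, hinv w⟩, (hmem _).2 fun i => ((E i).symm fun j => w ⟨i, j⟩).2⟩
      left_inv := ?_
      right_inv := ?_
      map_rel_iff' := ?_ }
  · intro v
    refine Subtype.ext (Subtype.ext (funext fun i => ?_))
    exact congrArg Subtype.val ((E i).symm_apply_apply ⟨v.1.1 i, (hmem _).1 v.2 i⟩)
  · intro w
    funext ⟨i, j⟩
    exact congrFun ((E i).apply_symm_apply fun j => w ⟨i, j⟩) j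
  · intro v v'
    constructor
    · rintro ⟨⟨i, j⟩, h1, h2⟩
      refine ⟨i, ?_, fun i' hi' => ?_⟩
      · refine (E i).map_adj_iff.1 ⟨j, h1, fun j' hj' => h2 ⟨i, j'⟩ ?_⟩
        intro h; apply hj'; simpa using h
      · have : (⟨v.1.1 i', (hmem _).1 v.2 i'⟩ : hull (G i') {x i', y i', z i'}) =
            ⟨v'.1.1 i', (hmem _).1 v'.2 i'⟩ := by
          apply (E i').injective
          funext j'
          exact h2 ⟨i', j'⟩ fun h => hi' (congrArg Sigma.fst h)
        exact congrArg Subtype.val this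
    · rintro ⟨i, h1, h2⟩
      obtain ⟨j, h3, h4⟩ := (E i).map_adj_iff.2 (show ((G i).induce _).Adj
        ⟨v.1.1 i, (hmem _).1 v.2 i⟩ ⟨v'.1.1 i, (hmem _).1 v'.2 i⟩ from h1)
      refine ⟨⟨i, j⟩, h3, ?_⟩
      rintro ⟨i', j'⟩ hne
      by_cases hi : i' = i
      · subst hi
        exact h4 j' fun h => hne (by rw [h])
      · have : (⟨v.1.1 i', (hmem _).1 v.2 i'⟩ : hull (G i') {x i', y i', z i'}) =
            ⟨v'.1.1 i', (hmem _).1 v'.2 i'⟩ := Subtype.ext (h2 i' hi)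
        exact congrArg (fun t => E i' t j') this

end Product

theorem isHyperMedianPartialCube_product :
    ClosedUnderCartesianProducts.{u} IsHyperMedianPartialCube := by
  refine closedUnderCartesianProducts_of_weak (fun V G h => h.1.1.1)
    (fun V W G H e h => isHyperMedianPartialCube_iso e h) fun ι V G h a => ?_
  refine ⟨isPeanoPartialCube_product.2.2 ι V G (fun i => (h i).1) a, ?_⟩
  choose κ φ he hP using fun i => isPeanoPartialCube_iff.1 (h i).1
  exact hasHyperMedian_weakCartProd he (fun i => (h i).2) a

/-! ### Distances in cycles and tori, and integer charts -/

/-- The distance of `m` from `0` in the cycle of length `2 * k`. -/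
def cycDist (k : ℕ) (m : ℤ) : ℤ := min (m % (2 * k)) (2 * k - m % (2 * k))

section CycDist
variable {k : ℕ}

theorem cycDist_congr {m m' : ℤ} (h : m % (2 * k) = m' % (2 * k)) : cycDist k m = cycDist k m' := by
  rw [cycDist, h, cycDist]

theorem cycDist_add_mul (m q : ℤ) : cycDist k (m + 2 * k * q) = cycDist k m :=
  cycDist_congr (Int.add_mul_emod_self_left _ _ _)

theorem exists_rep (hk : 0 < k) (m : ℤ) : ∃ r q : ℤ, m = r + 2 * k * q ∧ -(k : ℤ) ≤ r ∧ r ≤ k := by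
  have h1 := Int.emod_add_mul_ediv m (2 * k)
  have h2 := Int.emod_nonneg m (b := 2 * k) (by omega)
  have h3 := Int.emod_lt_of_pos m (b := 2 * k) (by omega)
  by_cases h : m % (2 * k) ≤ k
  · exact ⟨m % (2 * k), m / (2 * k), by omega, by omega, h⟩
  · refine ⟨m % (2 * k) - 2 * k, m / (2 * k) + 1, ?_, by omega, by omega⟩
    rw [mul_add]; omega

/-- The range covers differences of representatives in `[-k, k]`; the piecewise linear form leaves
the later inequalities to `omega`. -/
theorem cycDist_eq (hk : 0 < k) {m : ℤ} (h1 : -(2 * k : ℤ) ≤ m) (h2 : m ≤ 2 * k) :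
    cycDist k m = min (max m (-m)) (2 * k - max m (-m)) := by
  have key : ∀ m : ℤ, 0 ≤ m → m < 2 * k → cycDist k m = min m (2 * k - m) := fun m h1 h2 => by
    rw [cycDist, Int.emod_eq_of_lt h1 h2]
  rcases lt_trichotomy m 0 with h | rfl | h
  · by_cases he : m = -(2 * k)
    · have := cycDist_add_mul (k := k) m 1
      rw [← this, key _ (by omega) (by omega)]; omega
    · have := cycDist_add_mul (k := k) m 1
      rw [← this, key _ (by omega) (by omega)]; omega
  · rw [key _ le_rfl (by omega)]; omega
  · by_cases he : m = 2 * k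
    · have := cycDist_add_mul (k := k) m (-1)
      rw [← this, key _ (by omega) (by omega)]; omega
    · rw [key _ (by omega) (by omega)]; omega

theorem cycDist_nonneg (hk : 0 < k) (m : ℤ) : 0 ≤ cycDist k m := by
  obtain ⟨r, q, rfl, h1, h2⟩ := exists_rep hk m
  rw [cycDist_add_mul, cycDist_eq hk (by omega) (by omega)]; omega

theorem cycDist_neg (hk : 0 < k) (m : ℤ) : cycDist k (-m) = cycDist k m := by
  obtain ⟨r, q, rfl, h1, h2⟩ := exists_rep hk m
  have : -(r + 2 * k * q) = -r + 2 * k * (-q) := by ring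
  rw [this, cycDist_add_mul, cycDist_add_mul, cycDist_eq hk (by omega) (by omega),
    cycDist_eq hk (by omega) (by omega)]; omega

theorem cycDist_zero (hk : 0 < k) : cycDist k 0 = 0 := by
  rw [cycDist_eq hk (by omega) (by omega)]; omega

theorem cycDist_step_le (hk : 0 < k) (m : ℤ) :
    cycDist k (m + 1) ≤ cycDist k m + 1 ∧ cycDist k (m - 1) ≤ cycDist k m + 1 := by
  obtain ⟨r, q, rfl, h1, h2⟩ := exists_rep hk m
  have e1 : r + 2 * k * q + 1 = r + 1 + 2 * k * q := by ring
  have e2 : r + 2 * k * q - 1 = r - 1 + 2 * k * q := by ring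
  rw [e1, e2, cycDist_add_mul, cycDist_add_mul, cycDist_add_mul, cycDist_eq hk (by omega) (by omega),
    cycDist_eq hk (by omega) (by omega), cycDist_eq hk (by omega) (by omega)]; omega

theorem cycDist_step_eq (hk : 0 < k) {m : ℤ} (h0 : cycDist k m ≠ 0) :
    cycDist k (m + 1) + 1 = cycDist k m ∨ cycDist k (m - 1) + 1 = cycDist k m := by
  obtain ⟨r, q, rfl, h1, h2⟩ := exists_rep hk m
  have e1 : r + 2 * k * q + 1 = r + 1 + 2 * k * q := by ring
  have e2 : r + 2 * k * q - 1 = r - 1 + 2 * k * q := by ring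
  rw [cycDist_add_mul, cycDist_eq hk (by omega) (by omega)] at h0
  rw [e1, e2, cycDist_add_mul, cycDist_add_mul, cycDist_add_mul, cycDist_eq hk (by omega) (by omega),
    cycDist_eq hk (by omega) (by omega), cycDist_eq hk (by omega) (by omega)]; omega

end CycDist

/-- A function that satisfies the recursion of the distance is the distance. -/
theorem dist_eq_of_step {V : Type u} {G : SimpleGraph V} (D : V → V → ℕ)
    (h0 : ∀ x, D x x = 0) (h1 : ∀ x y z, G.Adj x z → D x y ≤ D z y + 1)
    (h2 : ∀ x y, x ≠ y → ∃ z, G.Adj x z ∧ D z y + 1 = D x y) (x y : V) : G.dist x y = D x y := by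
  have key : ∀ (n : ℕ) (x y : V), D x y = n → ∃ p : G.Walk x y, p.length ≤ n := by
    intro n
    induction n with
    | zero =>
      intro x y h
      by_cases hxy : x = y
      · subst hxy; exact ⟨Walk.nil, le_rfl⟩
      · obtain ⟨z, -, hz⟩ := h2 x y hxy
        omega
    | succ n ih =>
      intro x y h
      by_cases hxy : x = y
      · subst hxy; exact ⟨Walk.nil, Nat.zero_le _⟩
      · obtain ⟨z, hadj, hz⟩ := h2 x y hxy
        obtain ⟨p, hp⟩ := ih z y (by omega)
        exact ⟨Walk.cons hadj p, by simp; omega⟩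
  have low : ∀ (x y : V) (p : G.Walk x y), D x y ≤ p.length := by
    intro x y p
    induction p with
    | nil => simp [h0]
    | @cons a b c h p ih =>
      have := h1 a c b h
      rw [Walk.length_cons]; omega
  obtain ⟨p, hp⟩ := key _ x y rfl
  obtain ⟨q, hq⟩ := p.reachable.exists_walk_length_eq_dist
  have h3 := low x y q
  have h4 := dist_le p
  omega

section Torus

theorem cycleGraph_adj_iff_cycDist {k : ℕ} (hk : 2 ≤ k) {u v : Fin (2 * k)} :
    (cycleGraph (2 * k)).Adj u v ↔ cycDist k ((u : ℕ) - (v : ℕ) : ℤ) = 1 := by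
  have hu := u.2
  have hv := v.2
  rw [cycleGraph_adj', cycDist_eq (by omega) (by omega) (by omega)]
  have h : ∀ u v : Fin (2 * k), (u - v).val = 1 ↔ (u : ℕ) = v + 1 ∨ (u : ℕ) + 2 * k = v + 1 := by
    intro u v
    have hu := u.2
    have hv := v.2
    rw [Fin.val_sub]
    by_cases huv : (v : ℕ) ≤ u
    · rw [show 2 * k - (v : ℕ) + u = (u - v) + 2 * k by omega, Nat.add_mod_right,
        Nat.mod_eq_of_lt (by omega)]
      omega
    · rw [Nat.mod_eq_of_lt (by omega)]
      omega
  rw [h, h]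
  omega

/-- The residue of an integer as a vertex of the cycle of length `2 * k`. -/
def cycRes (k : ℕ) (hk : 2 ≤ k) (m : ℤ) : Fin (2 * k) :=
  ⟨(m % (2 * k)).toNat, by
    have h2 := Int.emod_nonneg m (b := 2 * k) (by omega)
    have h3 := Int.emod_lt_of_pos m (b := 2 * k) (by omega)
    omega⟩

theorem cycRes_val {k : ℕ} (hk : 2 ≤ k) (m : ℤ) : ((cycRes k hk m : ℕ) : ℤ) = m % (2 * k) :=
  Int.toNat_of_nonneg (Int.emod_nonneg m (by omega))

theorem cycDist_cycRes_sub {k : ℕ} (hk : 2 ≤ k) (m m' : ℤ) :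
    cycDist k ((cycRes k hk m : ℕ) - m') = cycDist k (m - m') := by
  apply cycDist_congr
  rw [cycRes_val, Int.emod_sub_emod]

theorem sum_eq_of_ne {J : Type v} [Fintype J] {g h : J → ℤ} (j : J)
    (hj : ∀ i, i ≠ j → g i = h i) : ∑ i, g i = ∑ i, h i - h j + g j := by
  classical
  rw [← Finset.add_sum_erase _ g (Finset.mem_univ j), ← Finset.add_sum_erase _ h (Finset.mem_univ j),
    Finset.sum_congr rfl fun i hi => hj i (Finset.ne_of_mem_erase hi)]
  ring

theorem dist_torus {J : Type v} [Fintype J] {k : J → ℕ} (hk : ∀ j, 2 ≤ k j)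
    (x y : ∀ j, Fin (2 * k j)) :
    ((cartProd fun j => cycleGraph (2 * k j)).dist x y : ℤ) =
      ∑ j, cycDist (k j) ((x j : ℕ) - (y j : ℕ)) := by
  classical
  have hk0 : ∀ j, 0 < k j := fun j => by have := hk j; omega
  have hnn : ∀ x y : ∀ j, Fin (2 * k j), 0 ≤ ∑ j, cycDist (k j) ((x j : ℕ) - (y j : ℕ) : ℤ) :=
    fun x y => Finset.sum_nonneg fun j _ => cycDist_nonneg (hk0 j) _
  rw [dist_eq_of_step (fun x y => (∑ j, cycDist (k j) ((x j : ℕ) - (y j : ℕ) : ℤ)).toNat),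
    Int.toNat_of_nonneg (hnn x y)]
  · intro x
    have : ∑ j, cycDist (k j) ((x j : ℕ) - (x j : ℕ) : ℤ) = 0 :=
      Finset.sum_eq_zero fun j _ => by rw [sub_self, cycDist_zero (hk0 j)]
    rw [this]; rfl
  · rintro x y z ⟨j, h1, h2⟩
    rw [cycleGraph_adj_iff_cycDist (hk j)] at h1
    have h3 := sum_eq_of_ne (g := fun j => cycDist (k j) ((x j : ℕ) - (y j : ℕ) : ℤ))
      (h := fun j => cycDist (k j) ((z j : ℕ) - (y j : ℕ) : ℤ)) j fun i hi => by rw [h2 i hi]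
    have h4 : cycDist (k j) ((x j : ℕ) - (y j : ℕ) : ℤ) ≤
        cycDist (k j) ((z j : ℕ) - (y j : ℕ) : ℤ) + 1 := by
      have hx := (x j).2
      have hz := (z j).2
      rw [cycDist_eq (hk0 j) (by omega) (by omega)] at h1
      have h5 := cycDist_step_le (hk0 j) ((z j : ℕ) - (y j : ℕ) : ℤ)
      have h6 : ∃ q : ℤ, (x j : ℤ) - y j = z j - y j + 1 + 2 * k j * q ∨
          (x j : ℤ) - y j = z j - y j - 1 + 2 * k j * q := by
        have : (x j : ℤ) - z j = 1 ∨ (x j : ℤ) - z j = -1 ∨ (x j : ℤ) - z j = 2 * k j - 1 ∨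
          (x j : ℤ) - z j = - (2 * k j) + 1 := by omega
        rcases this with h | h | h | h
        · exact ⟨0, Or.inl (by omega)⟩
        · exact ⟨0, Or.inr (by omega)⟩
        · exact ⟨1, Or.inr (by omega)⟩
        · exact ⟨-1, Or.inl (by omega)⟩
      obtain ⟨q, h | h⟩ := h6
      · rw [h, cycDist_add_mul]; exact h5.1
      · rw [h, cycDist_add_mul]; exact h5.2
    have h5 := hnn x y
    have h6 := hnn z y
    omega
  · intro x y hxy
    have : ∃ j, x j ≠ y j := by
      by_contra hc; push Not at hc; exact hxy (funext hc)
    obtain ⟨j, hj⟩ := this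
    have hj' : (x j : ℕ) ≠ y j := fun h => hj (Fin.ext h)
    have hx := (x j).2
    have hy := (y j).2
    have hk2 := hk j
    have h0 : cycDist (k j) ((x j : ℕ) - (y j : ℕ) : ℤ) ≠ 0 := by
      rw [cycDist_eq (hk0 j) (by omega) (by omega)]; omega
    have : ∃ ε : ℤ, (ε = 1 ∨ ε = -1) ∧ cycDist (k j) ((x j : ℕ) + ε - (y j : ℕ) : ℤ) + 1 =
        cycDist (k j) ((x j : ℕ) - (y j : ℕ) : ℤ) := by
      rcases cycDist_step_eq (hk0 j) h0 with h | h
      · refine ⟨1, Or.inl rfl, ?_⟩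
        rw [← h]; congr 2; ring
      · refine ⟨-1, Or.inr rfl, ?_⟩
        rw [← h]; congr 2; ring
    obtain ⟨ε, hε, h1⟩ := this
    refine ⟨Function.update x j (cycRes (k j) (hk j) (x j + ε)), ⟨j, ?_, fun i hi => by
      rw [Function.update_of_ne hi]⟩, ?_⟩
    · refine Adj.symm ?_
      rw [Function.update_self, cycleGraph_adj_iff_cycDist (hk j), cycDist_cycRes_sub,
        add_sub_cancel_left, cycDist_eq (hk0 j) (by omega) (by omega)]
      omega
    · have h3 := sum_eq_of_ne (g := fun i => cycDist (k i)
        ((Function.update x j (cycRes (k j) (hk j) (x j + ε)) i : ℕ) - (y i : ℕ) : ℤ))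
        (h := fun j => cycDist (k j) ((x j : ℕ) - (y j : ℕ) : ℤ)) j fun i hi => by
          rw [Function.update_of_ne hi]
      rw [Function.update_self, cycDist_cycRes_sub] at h3
      have h5 := hnn x y
      have h6 := hnn (Function.update x j (cycRes (k j) (hk j) (x j + ε))) y
      have h7 := cycDist_nonneg (hk0 j) ((x j : ℕ) + ε - (y j : ℕ) : ℤ)
      omega

/-- An unrolled parametrisation of the set `H` as a product of even cycles. -/
structure Chart {V : Type u} (G : SimpleGraph V) (H : Set V) {J : Type v} [Fintype J] (k : J → ℕ)
    (E : (J → ℤ) → V) : Prop where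
  two_le : ∀ j, 2 ≤ k j
  dist : ∀ s t, (G.dist (E s) (E t) : ℤ) = ∑ j, cycDist (k j) (s j - t j)
  mem : ∀ t, E t ∈ H
  surj : ∀ v ∈ H, ∃ t, E t = v

namespace Chart
variable {V : Type u} {G : SimpleGraph V} {H : Set V} {J : Type v} [Fintype J] {k : J → ℕ}
  {E : (J → ℤ) → V}

theorem exists_of_iso (hG : G.Connected) (hH : IsConvex G H) (hk : ∀ j, 2 ≤ k j)
    (e : G.induce H ≃g cartProd fun j => cycleGraph (2 * k j)) {x : V} (hx : x ∈ H) :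
    ∃ E, Chart G H k E ∧ E 0 = x := by
  let R : (J → ℤ) → ∀ j, Fin (2 * k j) := fun t j => cycRes (k j) (hk j) ((e ⟨x, hx⟩ j : ℕ) + t j)
  refine ⟨fun t => (e.symm (R t) : V), ⟨hk, fun s t => ?_, fun t => (e.symm (R t)).2, fun v hv => ?_⟩, ?_⟩
  · rw [← dist_induce_eq hG hH, dist_iso, dist_torus hk]
    refine Finset.sum_congr rfl fun j _ => ?_
    have hk0 : 0 < k j := by have := hk j; omega
    simp only [R]
    rw [cycDist_cycRes_sub, ← cycDist_neg hk0, neg_sub, cycDist_cycRes_sub, ← cycDist_neg hk0]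
    congr 1; ring
  · refine ⟨fun j => (e ⟨v, hv⟩ j : ℕ) - (e ⟨x, hx⟩ j : ℕ), ?_⟩
    have : R (fun j => (e ⟨v, hv⟩ j : ℕ) - (e ⟨x, hx⟩ j : ℕ)) = e ⟨v, hv⟩ := by
      funext j
      refine Fin.ext (Int.ofNat_inj.1 ((cycRes_val (hk j) _).trans ?_))
      rw [add_sub_cancel, Int.emod_eq_of_lt (by omega) (by have := (e ⟨v, hv⟩ j).2; omega)]
    change ((e.symm (R _)) : V) = v
    rw [this]
    exact congrArg Subtype.val (e.symm_apply_apply _)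
  · have : R 0 = e ⟨x, hx⟩ := by
      funext j
      refine Fin.ext (Int.ofNat_inj.1 ((cycRes_val (hk j) _).trans ?_))
      rw [Pi.zero_apply, add_zero,
        Int.emod_eq_of_lt (by omega) (by have := (e ⟨x, hx⟩ j).2; omega)]
    change ((e.symm (R 0)) : V) = x
    rw [this]
    exact congrArg Subtype.val (e.symm_apply_apply _)

variable (hE : Chart G H k E)
include hE

theorem pos (j : J) : 0 < k j := by have := hE.two_le j; omega

theorem eq_of_dist (hG : G.Connected) {s t : J → ℤ} (h : ∀ j, cycDist (k j) (s j - t j) = 0) :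
    E s = E t := by
  rw [← hG.dist_eq_zero_iff]
  have := hE.dist s t
  rw [Finset.sum_eq_zero fun j _ => h j] at this
  exact_mod_cast this

/-- Translations and reflections allow any vertex of a triangle to be the origin, with a free choice
of orientation of each cycle. -/
theorem affine (b σ : J → ℤ) (hσ : ∀ j, σ j = 1 ∨ σ j = -1) :
    Chart G H k fun t => E (fun j => b j + σ j * t j) := by
  refine ⟨hE.two_le, fun s t => ?_, fun t => hE.mem _, fun v hv => ?_⟩
  · rw [hE.dist]
    refine Finset.sum_congr rfl fun j _ => ?_
    rcases hσ j with h | h <;> rw [h]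
    · congr 1; ring
    · rw [← cycDist_neg (hE.pos j)]; congr 1; ring
  · obtain ⟨t, rfl⟩ := hE.surj v hv
    refine ⟨fun j => σ j * (t j - b j), ?_⟩
    congr 1
    funext j
    rcases hσ j with h | h <;> simp only [h] <;> ring

theorem exists_rep_mem (hG : G.Connected) {v : V} (hv : v ∈ H) :
    ∃ t, E t = v ∧ ∀ j, -(k j : ℤ) ≤ t j ∧ t j ≤ k j := by
  obtain ⟨t, rfl⟩ := hE.surj v hv
  choose r q h1 h2 h3 using fun j => exists_rep (hE.pos j) (t j)
  refine ⟨r, hE.eq_of_dist hG fun j => ?_, fun j => ⟨h2 j, h3 j⟩⟩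
  have : r j - t j = 0 + 2 * k j * (-q j) := by rw [h1 j]; ring
  rw [this, cycDist_add_mul, cycDist_zero (hE.pos j)]

end Chart
end Torus

/-! ### Images of box corners and of axes under non-expansive maps -/

section Corner

theorem cycDist_of_le {k : ℕ} (hk : 0 < k) {m : ℤ} (h0 : 0 ≤ m) (h1 : m ≤ k) : cycDist k m = m := by
  rw [cycDist_eq hk (by omega) (by omega)]; omega

theorem sum_sub_single {J : Type v} [Fintype J] [DecidableEq J] (k : J → ℕ) (s : J → ℤ) (j : J)
    (m : ℤ) : ∑ i, cycDist (k i) (s i - Pi.single (M := fun _ => ℤ) j m i) =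
      ∑ i, cycDist (k i) (s i) - cycDist (k j) (s j) + cycDist (k j) (s j - m) := by
  have := sum_eq_of_ne (g := fun i => cycDist (k i) (s i - Pi.single (M := fun _ => ℤ) j m i))
    (h := fun i => cycDist (k i) (s i)) j fun i hi => by rw [Pi.single_eq_of_ne hi, sub_zero]
  rw [Pi.single_eq_same] at this
  exact this

/-- A point of a cycle is determined by its distances to the ends of a short arc through it. -/
theorem cycDist_rigid {k : ℕ} (hk : 0 < k) {β γ r t ρ : ℤ} (hβ : -k ≤ β ∧ β ≤ k)
    (hγ : -k ≤ γ ∧ γ ≤ k) (hr : -k ≤ r ∧ r ≤ k) (ht : -k ≤ t ∧ t ≤ k) (hρ : 0 ≤ ρ)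
    (hlt : cycDist k (β - γ) < k)
    (hsum : cycDist k (β - r) + cycDist k (r - γ) = cycDist k (β - γ))
    (h1 : ρ + cycDist k (t - β) ≤ cycDist k (r - β))
    (h2 : ρ + cycDist k (t - γ) ≤ cycDist k (r - γ)) : ρ = 0 ∧ cycDist k (t - r) = 0 := by
  rw [← neg_sub r β, cycDist_neg hk] at hsum

  have e1 := cycDist_eq (m := r - γ) hk (by omega) (by omega)
  have e2 := cycDist_eq (m := r - β) hk (by omega) (by omega)
  have e3 := cycDist_eq (m := β - γ) hk (by omega) (by omega)
  have e4 := cycDist_eq (m := t - γ) hk (by omega) (by omega)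
  have e5 := cycDist_eq (m := t - β) hk (by omega) (by omega)
  have e6 := cycDist_eq (m := t - r) hk (by omega) (by omega)
  generalize cycDist k (r - γ) = a1 at *
  generalize cycDist k (r - β) = a2 at *
  generalize cycDist k (β - γ) = a3 at *
  generalize cycDist k (t - γ) = a4 at *
  generalize cycDist k (t - β) = a5 at *
  generalize cycDist k (t - r) = a6 at *
  clear hk
  -- The triangle inequality through `t`; it leaves no room for `ρ` and makes both distance bounds
  -- equalities.
  have g1 : a4 + a5 ≥ a3 := by clear e1 e2 e6; omega
  have g0 : ρ = 0 := by omega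
  refine ⟨g0, ?_⟩
  have g4 : a4 = a1 := by omega
  have g5 : a5 = a2 := by omega
  subst g4 g5
  rcases max_cases (β-γ) (-(β - γ)) with h | h <;> rw [h.1] at e3 <;>
  omega

namespace Chart
variable {V : Type u} {G : SimpleGraph V} {H : Set V} {J : Type v} [Fintype J] [DecidableEq J]
  {k : J → ℕ} {E : (J → ℤ) → V} {F : V → V}

theorem mem_of_between (hG : G.Connected) (hH : IsConvex G H)
    (hF : ∀ u v, G.dist (F u) (F v) ≤ G.dist u v) {p q u : V} (hp : F p ∈ H) (hq : F q ∈ H)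
    (hpq : G.dist (F p) (F q) = G.dist p q) (hu : G.dist p u + G.dist u q = G.dist p q) :
    F u ∈ H := by
  refine hH _ hp _ hq ((mem_interval_iff_dist hG).2 ?_)
  have h1 := hF p u
  have h2 := hF u q
  have h3 := hG.dist_triangle (u := F p) (v := F u) (w := F q)
  omega

variable (hE : Chart G H k E) (hG : G.Connected) (hH : IsConvex G H)
  (hF : ∀ u v, G.dist (F u) (F v) ≤ G.dist u v)
include hE

theorem dist_add_single (s b : J → ℤ) (j : J) (m : ℤ) :
    (G.dist (E s) (E (b + Pi.single j m)) : ℤ) = G.dist (E s) (E b) -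
      cycDist (k j) (s j - b j) + cycDist (k j) (s j - b j - m) := by
  rw [hE.dist, hE.dist, ← sum_sub_single k (fun i => s i - b i) j m]
  refine Finset.sum_congr rfl fun i _ => ?_
  rw [Pi.add_apply, sub_add_eq_sub_sub]

theorem dist_single (s : J → ℤ) (j : J) (m : ℤ) :
    (G.dist (E s) (E (Pi.single j m)) : ℤ) = ∑ i, cycDist (k i) (s i) -
      cycDist (k j) (s j) + cycDist (k j) (s j - m) := by
  rw [hE.dist, sum_sub_single]

include hG hH hF

/-- The corner lies between the fixed vertices `E 0` and `E B`, so its image is in the box they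
span, and the two distances determine the coordinate sum of the image. -/
theorem corner_box {B : J → ℤ} (hB : ∀ i, 0 < B i ∧ B i < k i) (h0 : F (E 0) = E 0)
    (hFB : F (E B) = E B) (j : J) : ∃ p : J → ℤ, (∀ i, 0 ≤ p i ∧ p i ≤ B i) ∧ ∑ i, p i = B j ∧
      F (E (Pi.single j (B j))) = E p ∧
      ∀ i, i ≠ j → (∀ m, F (E (B + Pi.single i m)) = E (B + Pi.single i m)) → p i = 0 := by
  have hBB : ∀ i, cycDist (k i) (B i) = B i := fun i =>
    cycDist_of_le (hE.pos i) (hB i).1.le (hB i).2.le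
  have d0B : (G.dist (E B) (E 0) : ℤ) = ∑ i, B i := by
    rw [hE.dist]
    exact Finset.sum_congr rfl fun i _ => by rw [Pi.zero_apply, sub_zero, hBB]
  have dBu : (G.dist (E B) (E (Pi.single j (B j))) : ℤ) = ∑ i, B i - B j := by
    rw [hE.dist_single, Finset.sum_congr rfl fun i _ => hBB i, hBB, sub_self,
      cycDist_zero (hE.pos j), add_zero]
  have d0u : (G.dist (E 0) (E (Pi.single j (B j))) : ℤ) = B j := by
    rw [hE.dist_single]
    simp only [Pi.zero_apply, zero_sub, cycDist_neg (hE.pos j), hBB, cycDist_zero (hE.pos _)]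
    simp
  have hu := mem_of_between (p := E 0) (q := E B) (u := E (Pi.single j (B j))) hG hH hF
    (by rw [h0]; exact hE.mem _) (by rw [hFB]; exact hE.mem _) (by rw [h0, hFB])
    (by rw [dist_comm (u := E 0) (v := E B), dist_comm (v := E B)]; omega)
  obtain ⟨p, hp, hpr⟩ := hE.exists_rep_mem hG hu
  have f0 := hF (E 0) (E (Pi.single j (B j)))
  have fB := hF (E B) (E (Pi.single j (B j)))
  rw [h0, ← hp, dist_comm (v := E p)] at f0
  rw [hFB, ← hp] at fB
  have e0 : (G.dist (E p) (E 0) : ℤ) = ∑ i, cycDist (k i) (p i) := by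
    rw [hE.dist]; exact Finset.sum_congr rfl fun i _ => by rw [Pi.zero_apply, sub_zero]
  have eB : (G.dist (E B) (E p) : ℤ) = ∑ i, cycDist (k i) (B i - p i) := hE.dist B p
  have hge : ∀ i ∈ Finset.univ, B i ≤ cycDist (k i) (p i) + cycDist (k i) (B i - p i) := by
    intro i _
    obtain ⟨h1, h2⟩ := hpr i
    obtain ⟨h3, h4⟩ := hB i
    rw [cycDist_eq (hE.pos i) (by omega) (by omega), cycDist_eq (hE.pos i) (by omega) (by omega)]
    omega
  have hsum := Finset.sum_le_sum hge
  rw [Finset.sum_add_distrib] at hsum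
  have heq : ∀ i, B i = cycDist (k i) (p i) + cycDist (k i) (B i - p i) := fun i =>
    (Finset.sum_eq_sum_iff_of_le hge).1 (by rw [Finset.sum_add_distrib]; omega) i (Finset.mem_univ i)
  have hbox : ∀ i, 0 ≤ p i ∧ p i ≤ B i := by
    intro i
    have h5 := heq i
    obtain ⟨h1, h2⟩ := hpr i
    obtain ⟨h3, h4⟩ := hB i
    rw [cycDist_eq (hE.pos i) (by omega) (by omega),
      cycDist_eq (hE.pos i) (by omega) (by omega)] at h5
    omega
  have hpp : ∀ i, cycDist (k i) (p i) = p i := fun i =>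
    cycDist_of_le (hE.pos i) (hbox i).1 ((hbox i).2.trans (hB i).2.le)
  have hBp : ∀ i, cycDist (k i) (B i - p i) = B i - p i := fun i => by have := heq i; rw [hpp] at this; omega
  have e0' : (G.dist (E p) (E 0) : ℤ) = ∑ i, p i :=
    e0.trans (Finset.sum_congr rfl fun i _ => hpp i)
  have eB' : (G.dist (E B) (E p) : ℤ) = ∑ i, B i - ∑ i, p i :=
    eB.trans ((Finset.sum_congr rfl fun i _ => hBp i).trans (Finset.sum_sub_distrib ..))
  refine ⟨p, hbox, by omega, hp.symm, fun i hij hfix => ?_⟩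
  -- This vertex of the fixed line has `i`-th coordinate `-1`, just outside the box; a positive `p
  -- i` would increase the distance to it by `2 * p i`.
  have h1 := hF (E (Pi.single j (B j))) (E (B + Pi.single i (-(B i + 1))))
  have h2 := hE.dist_add_single p B i (-(B i + 1))
  have h3 := hE.dist_add_single (Pi.single j (B j)) B i (-(B i + 1))
  rw [hfix, ← hp] at h1
  rw [Pi.single_eq_of_ne hij] at h3
  rw [dist_comm (v := E B)] at h2 h3
  have hk := hE.two_le i
  obtain ⟨b1, b2⟩ := hB i
  obtain ⟨p1, p2⟩ := hbox i
  rw [cycDist_eq (hE.pos i) (by omega) (by omega),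
    cycDist_eq (hE.pos i) (by omega) (by omega)] at h2 h3
  omega

/-- The points `B j` and `-C j` of the `j`-axis go to `p` and `-q` with coordinate sums `B j` and `C
j`. Their distance does not grow, which says that the numbers `min (p i + q i) (k i)` sum to at most
`k j`. As `B j + C j > k j`, some `p i + q i` exceeds `k i`; minimality of `k j` leaves nothing for
other coordinates. So the `j`-axis goes to the `i`-axis. `P` collects directions whose lines are
already fixed. -/
theorem corner {B C : J → ℤ} (hB : ∀ i, 0 < B i ∧ B i < k i) (hC : ∀ i, 0 < C i ∧ C i < k i)
    (hBC : ∀ i, k i < B i + C i) (h0 : F (E 0) = E 0) (hFB : F (E B) = E B)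
    (hFC : F (E (-C)) = E (-C)) {P : J → Prop}
    (hPB : ∀ i, P i → ∀ m, F (E (B + Pi.single i m)) = E (B + Pi.single i m))
    (hPC : ∀ i, P i → ∀ m, F (E (-C + Pi.single i m)) = E (-C + Pi.single i m))
    {j : J} (hj : ¬ P j) (hmin : ∀ i, P i ∨ k j ≤ k i) :
    ∃ i, ¬ P i ∧ k i = k j ∧ B j ≤ B i ∧ C j ≤ C i ∧
      ∀ m, F (E (Pi.single j m)) = E (Pi.single i m) := by
  obtain ⟨p, hp, hps, hpF, hp0⟩ := hE.corner_box hG hH hF hB h0 hFB j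
  have hE' := hE.affine 0 (fun _ => -1) fun _ => Or.inr rfl
  have conv : ∀ t : J → ℤ, (fun j => (0 : J → ℤ) j + -1 * t j) = -t := fun t => by
    funext i; simp
  simp only [conv] at hE'
  obtain ⟨q, hq, hqs, hqF, hq0⟩ := hE'.corner_box hG hH hF hC (by simpa using h0) hFC j
  have hnj : ∀ i, P i → i ≠ j := fun i hi hij => hj (hij ▸ hi)
  have hp0 : ∀ i, P i → p i = 0 := fun i hi => hp0 i (hnj i hi) (hPB i hi)
  have hq0 : ∀ i, P i → q i = 0 := fun i hi => hq0 i (hnj i hi) fun m => by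
    have := hPC i hi (-m)
    rwa [neg_add, ← Pi.single_neg]
  have hd := hF (E (Pi.single j (B j))) (E (-Pi.single j (C j)))
  rw [hpF, hqF] at hd
  have d1 : (G.dist (E (Pi.single j (B j))) (E (-Pi.single j (C j))) : ℤ) =
      2 * k j - B j - C j := by
    rw [← Pi.single_neg, hE.dist_single, sub_eq_add_neg (∑ i, _)]
    have h1 := sum_eq_of_ne (g := fun i => cycDist (k i) ((Pi.single j (B j) : J → ℤ) i))
      (h := fun _ => (0 : ℤ)) j fun i hi => by
        simp only [Pi.single_eq_of_ne hi, cycDist_zero (hE.pos i)]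
    rw [Finset.sum_const_zero] at h1
    rw [h1, Pi.single_eq_same]
    obtain ⟨b1, b2⟩ := hB j
    obtain ⟨c1, c2⟩ := hC j
    have := hBC j
    rw [cycDist_eq (m := B j - -C j) (hE.pos j) (by omega) (by omega)]
    omega
  have d2 : (G.dist (E p) (E (-q)) : ℤ) = ∑ i, cycDist (k i) (p i + q i) := by
    rw [hE.dist]; exact Finset.sum_congr rfl fun i _ => by rw [Pi.neg_apply, sub_neg_eq_add]
  have hpq : ∀ i, (0 ≤ p i ∧ p i ≤ B i) ∧ (0 ≤ q i ∧ q i ≤ C i) := fun i => ⟨hp i, hq i⟩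
  have hr : ∀ i, p i + q i + cycDist (k i) (p i + q i) = 2 * min (p i + q i) (k i) := by
    intro i
    obtain ⟨⟨h1, h2⟩, h3, h4⟩ := hpq i
    have h5 := hB i
    have h6 := hC i
    rw [cycDist_eq (hE.pos i) (by omega) (by omega)]
    omega
  have hS : ∑ i, min (p i + q i) (k i : ℤ) ≤ k j := by
    have h1 := Finset.sum_congr (s₁ := Finset.univ) rfl fun i _ => hr i
    rw [Finset.sum_add_distrib, Finset.sum_add_distrib, ← Finset.mul_sum] at h1
    omega
  have : ∃ i, (k i : ℤ) < p i + q i := by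
    by_contra hc
    push Not at hc
    rw [Finset.sum_congr rfl fun i _ => min_eq_left (hc i), Finset.sum_add_distrib] at hS
    have := hBC j
    omega
  obtain ⟨i, hi⟩ := this
  have hPi : ¬ P i := fun hc => by
    rw [hp0 i hc, hq0 i hc] at hi; omega
  have hki := (hmin i).resolve_left hPi
  have hnn : ∀ l, 0 ≤ min (p l + q l) (k l : ℤ) := fun l => by
    obtain ⟨⟨h1, h2⟩, h3, h4⟩ := hpq l
    omega
  have hS' := Finset.add_sum_erase Finset.univ (fun i => min (p i + q i) (k i : ℤ)) (Finset.mem_univ i)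
  have hS'' : 0 ≤ ∑ l ∈ Finset.univ.erase i, min (p l + q l) (k l : ℤ) :=
    Finset.sum_nonneg fun l _ => hnn l
  rw [min_eq_right hi.le] at hS'
  have hkij : k i = k j := by omega
  have hzero : ∀ l, l ≠ i → p l = 0 ∧ q l = 0 := by
    intro l hl
    have h1 := (Finset.sum_eq_zero_iff_of_nonneg fun l _ => hnn l).1
      (show ∑ l ∈ Finset.univ.erase i, min (p l + q l) (k l : ℤ) = 0 by omega) l
      (Finset.mem_erase.2 ⟨hl, Finset.mem_univ l⟩)
    obtain ⟨⟨h2, h3⟩, h4, h5⟩ := hpq l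
    have := hE.pos l
    omega
  have hpi : p i = B j := by
    rw [← hps]; exact (Finset.sum_eq_single i (fun l _ hl => (hzero l hl).1) (by simp)).symm
  have hqi : q i = C j := by
    rw [← hqs]; exact (Finset.sum_eq_single i (fun l _ hl => (hzero l hl).2) (by simp)).symm
  have hpe : p = Pi.single i (B j) := by
    funext l
    by_cases hl : l = i
    · subst hl; rw [Pi.single_eq_same, hpi]
    · rw [Pi.single_eq_of_ne hl, (hzero l hl).1]
  have hqe : -q = Pi.single i (-C j) := by
    funext l
    by_cases hl : l = i
    · subst hl; rw [Pi.single_eq_same, Pi.neg_apply, hqi]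
    · rw [Pi.single_eq_of_ne hl, Pi.neg_apply, (hzero l hl).2, neg_zero]
  rw [hpe] at hpF
  rw [hqe, ← Pi.single_neg] at hqF
  refine ⟨i, hPi, hkij, hpi ▸ (hp i).2, hqi ▸ (hq i).2, fun m => ?_⟩
  -- distances along a coordinate line
  have dl : ∀ (i : J) (m m' : ℤ), (G.dist (E (Pi.single i m)) (E (Pi.single i m')) : ℤ) =
      cycDist (k i) (m - m') := by
    intro i m m'
    rw [hE.dist_single, Pi.single_eq_same]
    have h1 := sum_eq_of_ne (g := fun l => cycDist (k l) ((Pi.single i m : J → ℤ) l))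
      (h := fun _ => (0 : ℤ)) i fun l hl => by
        simp only [Pi.single_eq_of_ne hl, cycDist_zero (hE.pos l)]
    rw [Finset.sum_const_zero, Pi.single_eq_same] at h1
    rw [h1]; ring
  obtain ⟨r, s, hm, hr1, hr2⟩ := exists_rep (hE.pos j) m
  have red : ∀ l, k l = k j → E (Pi.single l m) = E (Pi.single l r) := by
    intro l hl
    rw [← hG.dist_eq_zero_iff]
    have := dl l m r
    rw [hm, add_sub_cancel_left, hl] at this
    have h2 := cycDist_add_mul (k := k j) 0 s
    rw [zero_add, cycDist_zero (hE.pos j)] at h2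
    rw [hm]
    omega
  rw [red j rfl, red i hkij]
  clear hm red
  have h0' : F (E (Pi.single j 0)) = E (Pi.single i 0) := by simpa using h0
  -- The points `0`, `B j` and `-C j` cut the axis into three arcs, each shorter than half the
  -- cycle; on such an arc `cycDist_rigid` determines the image.
  have seg : ∀ β γ : ℤ, (-(k j : ℤ) ≤ β ∧ β ≤ k j) → (-(k j : ℤ) ≤ γ ∧ γ ≤ k j) →
      cycDist (k j) (β - γ) < k j → F (E (Pi.single j β)) = E (Pi.single i β) →
      F (E (Pi.single j γ)) = E (Pi.single i γ) →
      cycDist (k j) (β - r) + cycDist (k j) (r - γ) = cycDist (k j) (β - γ) →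
      F (E (Pi.single j r)) = E (Pi.single i r) := by
    intro β γ rβ rγ hlt hβ hγ hsum
    have e1 := dl j β r
    have e2 := dl j r γ
    have e3 := dl j β γ
    have e4 := dl i β γ
    rw [hkij] at e4
    have hmem := mem_of_between (p := E (Pi.single j β)) (q := E (Pi.single j γ))
      (u := E (Pi.single j r)) hG hH hF (hβ ▸ hE.mem _) (hγ ▸ hE.mem _) (by rw [hβ, hγ]; omega)
      (by omega)
    obtain ⟨t, ht', htr⟩ := hE.exists_rep_mem hG hmem
    have f1 := hF (E (Pi.single j r)) (E (Pi.single j β))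
    have f2 := hF (E (Pi.single j r)) (E (Pi.single j γ))
    rw [hβ, ← ht'] at f1
    rw [hγ, ← ht'] at f2
    have g1 := hE.dist_single t i β
    have g2 := hE.dist_single t i γ
    have g3 := hE.dist_single t i r
    have e5 := dl j r β
    rw [hkij] at g1 g2 g3
    have hρ : cycDist (k j) (t i) ≤ ∑ l, cycDist (k l) (t l) := by
      have := Finset.single_le_sum (f := fun l => cycDist (k l) (t l)) (s := Finset.univ)
        (fun l _ => cycDist_nonneg (hE.pos l) _) (Finset.mem_univ i)
      rwa [hkij] at this
    have ht := htr i
    rw [hkij] at ht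
    obtain ⟨hz, hz'⟩ := cycDist_rigid (hE.pos j) rβ rγ ⟨hr1, hr2⟩ ht (sub_nonneg.2 hρ) hlt hsum
      (by omega) (by omega)
    rw [← ht', ← hG.dist_eq_zero_iff]
    omega
  have hkj := hE.pos j
  obtain ⟨b1, b2⟩ := hB j
  obtain ⟨c1, c2⟩ := hC j
  have bc := hBC j
  have hex : ∀ m : ℤ, -(2 * (k j : ℤ)) ≤ m → m ≤ 2 * k j →
      cycDist (k j) m = min (max m (-m)) (2 * k j - max m (-m)) := fun m => cycDist_eq hkj
  by_cases hr0 : 0 ≤ r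
  · by_cases hrB : r ≤ B j
    · exact seg (0) (B j) (by omega) (by omega) (by rw [hex _ (by omega) (by omega)]; omega)
        h0' hpF (by
          rw [hex _ (by omega) (by omega), hex _ (by omega) (by omega), hex _ (by omega) (by omega)]
          clear * - hr1 hr2 b1 b2 c1 c2 bc hr0 hrB hkj
          omega)
    · exact seg (B j) (-C j) (by omega) (by omega) (by rw [hex _ (by omega) (by omega)]; omega)
        hpF hqF (by
          rw [hex _ (by omega) (by omega), hex _ (by omega) (by omega), hex _ (by omega) (by omega)]
          clear * - hr1 hr2 b1 b2 c1 c2 bc hr0 hrB hkj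
          omega)
  · by_cases hrB : -C j ≤ r
    · exact seg (0) (-C j) (by omega) (by omega) (by rw [hex _ (by omega) (by omega)]; omega)
        h0' hqF (by
          rw [hex _ (by omega) (by omega), hex _ (by omega) (by omega), hex _ (by omega) (by omega)]
          clear * - hr1 hr2 b1 b2 c1 c2 bc hr0 hrB hkj
          omega)
    · exact seg (B j) (-C j) (by omega) (by omega) (by rw [hex _ (by omega) (by omega)]; omega)
        hpF hqF (by
          rw [hex _ (by omega) (by omega), hex _ (by omega) (by omega), hex _ (by omega) (by omega)]
          clear * - hr1 hr2 b1 b2 c1 c2 bc hr0 hrB hkj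
          omega)

end Chart
end Corner

/-! ### Coordinates of a metric triangle spanning a torus -/

section Coordinates

/-- The coordinate of a metric triangle that spans a torus. -/
theorem arc_of_rigid {k : ℕ} (hk : 2 ≤ k) {β γ : ℤ} (hβ : -k ≤ β ∧ β ≤ k) (hγ : -k ≤ γ ∧ γ ≤ k)
    (hne : β ≠ 0 ∨ γ ≠ 0)
    (hx : ∀ u, cycDist k u + cycDist k (β - u) = cycDist k β →
      cycDist k u + cycDist k (γ - u) = cycDist k γ → cycDist k u = 0)
    (hy : ∀ u, cycDist k u + cycDist k (-β - u) = cycDist k (-β) →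
      cycDist k u + cycDist k (γ - β - u) = cycDist k (γ - β) → cycDist k u = 0)
    (hz : ∀ u, cycDist k u + cycDist k (-γ - u) = cycDist k (-γ) →
      cycDist k u + cycDist k (β - γ - u) = cycDist k (β - γ) → cycDist k u = 0) :
    ∃ σ : ℤ, (σ = 1 ∨ σ = -1) ∧ (0 < σ * β ∧ σ * β < k) ∧ (0 < -(σ * γ) ∧ -(σ * γ) < k) ∧
      k < σ * β - σ * γ := by
  have hk0 : 0 < k := by omega
  have ex : ∀ m : ℤ, -(2 * (k : ℤ)) ≤ m → m ≤ 2 * k →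
      cycDist k m = min (max m (-m)) (2 * k - max m (-m)) := fun m => cycDist_eq hk0
  have z0 := cycDist_zero hk0
  have hβ0 : β ≠ 0 := by
    rintro rfl
    have h := hz (-γ) (by simp [z0]) (by simp [z0])
    rw [ex _ (by omega) (by omega)] at h
    omega
  have hγ0 : γ ≠ 0 := by
    rintro rfl
    have h := hy (-β) (by simp [z0]) (by simp [z0])
    rw [ex _ (by omega) (by omega)] at h
    omega
  -- It suffices to test the neighbours `1` and `-1` of `0`, and the point `0` as seen from `β` and
  -- from `γ`.
  have x1 := hx 1
  have x2 := hx (-1)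
  have y1 := hy (-β)
  have z1 := hz (-γ)
  rw [ex β (by omega) (by omega), ex γ (by omega) (by omega), ex (β - _) (by omega) (by omega),
    ex (γ - _) (by omega) (by omega), ex _ (by omega) (by omega)] at x1 x2
  rw [sub_self, z0, cycDist_neg hk0, ex β (by omega) (by omega), sub_neg_eq_add,
    sub_add_cancel, ex γ (by omega) (by omega), ex _ (by omega) (by omega)] at y1
  rw [sub_self, z0, cycDist_neg hk0, ex γ (by omega) (by omega), sub_neg_eq_add,
    sub_add_cancel, ex β (by omega) (by omega), ex _ (by omega) (by omega)] at z1
  rcases lt_or_gt_of_ne hβ0 with h | h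
  · have hγ' : 0 < γ := by by_contra hc; omega
    have g1 : -β < k := by by_contra hc; omega
    have g2 : γ < k := by by_contra hc; omega
    refine ⟨-1, Or.inr rfl, by omega, by omega, ?_⟩
    by_contra hc; omega
  · have hγ' : γ < 0 := by by_contra hc; omega
    have g1 : β < k := by by_contra hc; omega
    have g2 : -γ < k := by by_contra hc; omega
    refine ⟨1, Or.inl rfl, by omega, by omega, ?_⟩
    by_contra hc; omega

namespace Chart
variable {V : Type u} {G : SimpleGraph V} {H : Set V} {J : Type v} [Fintype J] [DecidableEq J]
  {k : J → ℕ} {E : (J → ℤ) → V}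
variable (hE : Chart G H k E) (hG : G.Connected)
include hE

theorem cycDist_eq_zero_of_inter {s t : J → ℤ}
    (h : ∀ v, G.dist (E 0) v + G.dist v (E s) = G.dist (E 0) (E s) →
      G.dist (E 0) v + G.dist v (E t) = G.dist (E 0) (E t) → v = E 0) (i : J) (u : ℤ)
    (hs : cycDist (k i) u + cycDist (k i) (s i - u) = cycDist (k i) (s i))
    (ht : cycDist (k i) u + cycDist (k i) (t i - u) = cycDist (k i) (t i)) :
    cycDist (k i) u = 0 := by
  have d0 : ∀ r, (G.dist (E 0) (E r) : ℤ) = ∑ l, cycDist (k l) (r l) := by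
    intro r
    rw [dist_comm, hE.dist]
    exact Finset.sum_congr rfl fun l _ => by rw [Pi.zero_apply, sub_zero]
  have dr := fun r => hE.dist_single r i u
  have d00 : (G.dist (E 0) (E (Pi.single i u)) : ℤ) = cycDist (k i) u := by
    rw [hE.dist_single]
    simp [cycDist_zero (hE.pos _), cycDist_neg (hE.pos i)]
  have key := h (E (Pi.single i u))
    (by have := dr s; have := d0 s; rw [dist_comm (v := E s)]; omega)
    (by have := dr t; have := d0 t; rw [dist_comm (v := E t)]; omega)
  rw [← d00, key, dist_self]; rfl

include hG

/-- Resetting the `i`-th coordinate to `0` shortens the distances to both ends, so on a geodesic it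
is `0` already. -/
theorem isConvex_slice (hH : IsConvex G H) (i : J) : IsConvex G {v | ∃ t, E t = v ∧ t i = 0} := by
  rintro _ ⟨s, rfl, hs⟩ _ ⟨t, rfl, ht⟩ v hv
  obtain ⟨r, rfl, hr⟩ := hE.exists_rep_mem hG (hH _ (hE.mem s) _ (hE.mem t) hv)
  refine ⟨r, rfl, ?_⟩
  rw [mem_interval_iff_dist hG] at hv
  have h1 := hE.dist_add_single s r i (-r i)
  have h2 := hE.dist_add_single t r i (-r i)
  have h3 := hG.dist_triangle (u := E s) (v := E (r + Pi.single i (-r i))) (w := E t)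
  rw [dist_comm (u := E (r + _)) (v := E t)] at h3
  rw [dist_comm (u := E r) (v := E t)] at hv
  obtain ⟨r1, r2⟩ := hr i
  have hp := hE.pos i
  simp only [hs, ht, zero_sub, sub_neg_eq_add, neg_add_cancel, cycDist_zero hp, cycDist_neg hp] at h1 h2
  rw [cycDist_eq hp (by omega) (by omega)] at h1 h2
  omega

/-- A metric triangle that spans a torus consists, in each coordinate, of three points of a cycle
that do not lie on a half-cycle. -/
theorem exists_triangle (hH : IsConvex G H) {x y z : V} (h0 : E 0 = x) (hy : y ∈ H) (hz : z ∈ H)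
    (hull_eq : H ⊆ hull G {x, y, z}) (hT : IsMetricTriangle G x y z) :
    ∃ (E' : (J → ℤ) → V) (b c : J → ℤ), Chart G H k E' ∧ E' 0 = x ∧ E' b = y ∧ E' (-c) = z ∧
      (∀ i, 0 < b i ∧ b i < k i) ∧ (∀ i, 0 < c i ∧ c i < k i) ∧ ∀ i, k i < b i + c i := by
  obtain ⟨β, rfl, hβ⟩ := hE.exists_rep_mem hG hy
  obtain ⟨γ, rfl, hγ⟩ := hE.exists_rep_mem hG hz
  subst h0
  obtain ⟨t1, t2, t3⟩ := hT
  -- If `y` and `z` agreed with `x` in coordinate `i`, a slice would contain the hull of the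
  -- triangle and thus all of `H`.
  have hne : ∀ i, β i ≠ 0 ∨ γ i ≠ 0 := by
    intro i
    by_contra! hc
    have := hull_eq.trans (hull_subset (hE.isConvex_slice hG hH i) (by
      rintro _ (rfl | rfl | rfl)
      · exact ⟨0, rfl, rfl⟩
      · exact ⟨β, rfl, hc.1⟩
      · exact ⟨γ, rfl, hc.2⟩)) (hE.mem (Pi.single i 1))
    obtain ⟨t, ht, hti⟩ := this
    have h1 := hE.dist t (Pi.single i 1)
    rw [ht, dist_self] at h1
    have h2 := Finset.single_le_sum (f := fun l => cycDist (k l) (t l - (Pi.single i 1 : J → ℤ) l))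
      (s := Finset.univ) (fun l _ => cycDist_nonneg (hE.pos l) _) (Finset.mem_univ i)
    have hk := hE.two_le i
    simp only [hti, Pi.single_eq_same, zero_sub, cycDist_neg (hE.pos i)] at h2
    rw [cycDist_of_le (hE.pos i) (by omega) (by omega)] at h2
    push_cast at h1
    omega
  have inter : ∀ {p q r v : V}, interval G p q ∩ interval G q r = {q} →
      G.dist q v + G.dist v p = G.dist q p → G.dist q v + G.dist v r = G.dist q r → v = q := by
    intro p q r v h h1 h2
    have : v ∈ interval G p q ∩ interval G q r := ⟨(mem_interval_iff_dist hG).2 (by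
      rw [dist_comm (u := p) (v := v), dist_comm (u := v) (v := q), dist_comm (u := p) (v := q)]
      omega),
      (mem_interval_iff_dist hG).2 h2⟩
    rw [h] at this
    exact this
  have aux : ∀ (b s : J → ℤ), (fun j => b j + 1 * s j) = b + s := fun b s => by
    funext j; simp
  have hβ' := hE.affine β (fun _ => 1) fun _ => Or.inl rfl
  have hγ' := hE.affine γ (fun _ => 1) fun _ => Or.inl rfl
  simp only [aux] at hβ' hγ'
  have rx := hE.cycDist_eq_zero_of_inter (s := γ) (t := β) (fun v => inter t3)
  have ry := hβ'.cycDist_eq_zero_of_inter (s := -β) (t := γ - β) (fun v => by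
    simpa using inter t1)
  have rz := hγ'.cycDist_eq_zero_of_inter (s := β - γ) (t := -γ) (fun v => by
    simpa using inter t2)
  choose σ hσ hb hc hbc using fun i => arc_of_rigid (hE.two_le i) (hβ i) (hγ i) (hne i)
    (fun u h1 h2 => rx i u h2 h1) (ry i) (fun u h1 h2 => rz i u h2 h1)
  have hσσ : ∀ i m, σ i * (σ i * m) = m := fun i m => by rcases hσ i with h | h <;> rw [h] <;> ring
  refine ⟨_, fun i => σ i * β i, fun i => -(σ i * γ i), hE.affine 0 σ hσ, ?_, ?_, ?_, hb, hc,
    fun i => by have := hbc i; dsimp only; omega⟩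
  · congr 1; funext j; simp
  · congr 1; funext j; simp [hσσ]
  · congr 1; funext j; simp [hσσ]

end Chart
end Coordinates

/-! ### Rigidity of hypertori spanned by fixed triangles -/

section FixTorus

namespace Chart
variable {V : Type u} {G : SimpleGraph V} {H : Set V} {J : Type v} [Fintype J]
  {k : J → ℕ} {E : (J → ℤ) → V} {F : V → V} (hE : Chart G H k E) (hG : G.Connected)
include hE

theorem eq_of_period (hG : G.Connected) {s t : J → ℤ} (q : ℤ) (h : ∀ j, s j = t j + 2 * k j * q) :
    E s = E t := by
  refine hE.eq_of_dist hG fun j => ?_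
  rw [h j, show t j + 2 * k j * q - t j = 0 + 2 * k j * q by ring, cycDist_add_mul,
    cycDist_zero (hE.pos j)]

theorem translate (b : J → ℤ) : Chart G H k fun t => E (b + t) := by
  have := hE.affine b (fun _ => 1) fun _ => Or.inl rfl
  have aux : ∀ s : J → ℤ, (fun j => b j + 1 * s j) = b + s := fun s => by funext j; simp
  simpa only [aux] using this

theorem reflect (b : J → ℤ) : Chart G H k fun t => E (b - t) := by
  have := hE.affine b (fun _ => -1) fun _ => Or.inr rfl
  have aux : ∀ s : J → ℤ, (fun j => b j + -1 * s j) = b - s := fun s => by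
    funext j; rw [Pi.sub_apply]; ring
  simpa only [aux] using this

variable [DecidableEq J]

theorem dist_single_add_single (b : J → ℤ) (i l : J) (m n : ℤ) :
    (G.dist (E (Pi.single i m)) (E (b + Pi.single l n)) : ℤ) = ∑ r, cycDist (k r) (b r) -
      cycDist (k i) (b i) + cycDist (k i) (b i - m) -
      cycDist (k l) ((Pi.single i m : J → ℤ) l - b l) +
      cycDist (k l) ((Pi.single i m : J → ℤ) l - b l - n) := by
  rw [hE.dist_add_single, dist_comm (v := E b), hE.dist_single]

/-- Two lines through opposite corners of a box that are images of one pair of parallel lines are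
parallel. -/
theorem eq_of_lines (hF : ∀ u v, G.dist (F u) (F v) ≤ G.dist u v) {b : J → ℤ}
    (hb : ∀ i, 0 < b i ∧ b i < k i) {j i l : J} (hk : k i = k l) (hij : b i = b j)
    (h0 : ∀ m, F (E (Pi.single j m)) = E (Pi.single i m))
    (h1 : ∀ m, F (E (b + Pi.single j m)) = E (b + Pi.single l m)) : i = l := by
  by_contra hil
  have hbb : ∀ r, cycDist (k r) (b r) = b r := fun r =>
    cycDist_of_le (hE.pos r) (hb r).1.le (hb r).2.le
  -- These vertices have the same `j`-th coordinate; for `i ≠ l` their images would be farther apart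
  -- by `2`.
  have hf := hF (E (Pi.single j (b j - (1 + b l)))) (E (b + Pi.single j (-(1 + b l))))
  rw [h0, h1] at hf
  have e1 := hE.dist_single_add_single b j j (b j - (1 + b l)) (-(1 + b l))
  have e2 := hE.dist_single_add_single b i l (b j - (1 + b l)) (-(1 + b l))
  have kl := hb l
  simp only [Pi.single_eq_same, Pi.single_eq_of_ne (Ne.symm hil), zero_sub, sub_sub_cancel,
    sub_sub_cancel_left, sub_neg_eq_add, hbb, cycDist_neg (hE.pos _), sub_self,
    cycDist_zero (hE.pos _), hij] at e1 e2
  have hbi := hbb i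
  rw [hij] at hbi
  rw [hbi, hk, cycDist_of_le (hE.pos l) (by omega) (by omega),
    cycDist_of_le (hE.pos l) (by omega) (by omega)] at e2
  omega

/-- Among the unfixed directions choose `j` with shortest cycle and then largest `b`. `corner`,
applied at each vertex of the triangle, sends the `j`-lines to lines in directions `i₁`, `i₂`, `i₃`
with arcs at least as long. The choice of `j` turns the arc inequalities into equalities, so
`eq_of_lines` identifies the three directions. By idempotence the image lines are fixed, although
`i₁` is an unfixed direction. -/
theorem fix_lines (hG : G.Connected) (hH : IsConvex G H)
    (hF : ∀ u v, G.dist (F u) (F v) ≤ G.dist u v) (hFF : ∀ v, F (F v) = F v)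
    {b c : J → ℤ} (hb : ∀ i, 0 < b i ∧ b i < k i) (hc : ∀ i, 0 < c i ∧ c i < k i)
    (hbc : ∀ i, k i < b i + c i) (h0 : F (E 0) = E 0) (h1 : F (E b) = E b)
    (h2 : F (E (-c)) = E (-c)) (i : J) :
    (∀ m, F (E (Pi.single i m)) = E (Pi.single i m)) ∧
    (∀ m, F (E (b + Pi.single i m)) = E (b + Pi.single i m)) ∧
    (∀ m, F (E (-c + Pi.single i m)) = E (-c + Pi.single i m)) := by
  set P : J → Prop := fun i => (∀ m, F (E (Pi.single i m)) = E (Pi.single i m)) ∧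
    (∀ m, F (E (b + Pi.single i m)) = E (b + Pi.single i m)) ∧
    (∀ m, F (E (-c + Pi.single i m)) = E (-c + Pi.single i m)) with hP
  change P i
  by_contra hi
  classical
  obtain ⟨j₀, hj₀, hmin⟩ := Finset.exists_min_image (Finset.univ.filter fun i => ¬ P i) k
    ⟨i, by simpa using hi⟩
  obtain ⟨j, hj, hmax⟩ := Finset.exists_max_image
    (Finset.univ.filter fun i => ¬ P i ∧ k i = k j₀) b ⟨j₀, by simpa using hj₀⟩
  simp only [Finset.mem_filter, Finset.mem_univ, true_and, and_imp] at hj₀ hmin hj hmax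
  obtain ⟨hj, hjk⟩ := hj
  have hmin' : ∀ i, P i ∨ k j ≤ k i := fun i => by
    by_cases h : P i
    · exact Or.inl h
    · exact Or.inr (hjk ▸ hmin i h)
  -- The third arc of each cycle: `b + a` and `-c` agree modulo the periods, which lets each vertex
  -- in turn be the origin.
  let a : J → ℤ := fun i => 2 * k i - b i - c i
  have ha : ∀ i, 0 < a i ∧ a i < k i := fun i => by
    have := hb i; have := hc i; have := hbc i; simp only [a]; omega
  have hba : ∀ i, k i < b i + a i := fun i => by have := hc i; simp only [a]; omega
  have hca : ∀ i, k i < c i + a i := fun i => by have := hb i; simp only [a]; omega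
  obtain ⟨i₁, hi₁, k₁, b₁, c₁, f₁⟩ := hE.corner hG hH hF hb hc hbc h0 h1 h2 (P := P)
    (fun i hi => hi.2.1) (fun i hi => hi.2.2) hj hmin'
  have pa : ∀ t : J → ℤ, E (b - (-a + t)) = E (-c - t) := fun t =>
    hE.eq_of_period hG 1 fun j => by
      simp only [a, Pi.sub_apply, Pi.add_apply, Pi.neg_apply]; ring
  have pa' : ∀ t : J → ℤ, E (-c + (-a + t)) = E (b + t) := fun t =>
    hE.eq_of_period hG (-1) fun j => by
      simp only [a, Pi.add_apply, Pi.neg_apply]; ring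
  obtain ⟨i₂, hi₂, k₂, b₂, a₂, f₂⟩ := (hE.reflect b).corner (F := F) hG hH hF hb ha hba
    (by simpa using h1) (by simpa using h0) (by
      have := pa 0
      rw [add_zero, sub_zero] at this
      rw [this, h2]) (P := P)
    (fun i hi m => by
      rw [← sub_sub, sub_self, zero_sub, ← Pi.single_neg]; exact hi.1 _)
    (fun i hi m => by
      rw [pa, sub_eq_add_neg, ← Pi.single_neg]; exact hi.2.2 _) hj hmin'
  obtain ⟨i₃, hi₃, k₃, c₃, a₃, f₃⟩ := (hE.translate (-c)).corner (F := F) hG hH hF hc ha hca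
    (by simpa using h2) (by simpa using h0) (by
      have := pa' 0
      rw [add_zero, add_zero] at this
      rw [this, h1]) (P := P)
    (fun i hi m => by
      rw [neg_add_cancel_left]; exact hi.1 _)
    (fun i hi m => by
      rw [pa']; exact hi.2.1 _) hj hmin'
  have e₁ := hmax i₁ hi₁ (k₁.trans hjk)
  have f₂' : ∀ m, F (E (b + Pi.single j m)) = E (b + Pi.single i₂ m) := fun m => by
    have := f₂ (-m)
    rwa [Pi.single_neg, Pi.single_neg, sub_neg_eq_add, sub_neg_eq_add] at this
  have h12 : i₁ = i₂ := hE.eq_of_lines hF hb (k₁.trans k₂.symm) (by omega) f₁ f₂'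
  subst h12
  have hcc : c i₁ = c j := by
    simp only [a] at a₂; omega
  have h13 : i₁ = i₃ := by
    refine (hE.reflect 0).eq_of_lines hF hc (j := j) (k₁.trans k₃.symm) hcc (fun m => ?_) (fun m => ?_)
    · rw [zero_sub, zero_sub, ← Pi.single_neg, ← Pi.single_neg]; exact f₁ _
    · rw [zero_sub, zero_sub, neg_add, neg_add, ← Pi.single_neg, ← Pi.single_neg]; exact f₃ _
  subst h13
  exact hi₁ ⟨fun m => by rw [← f₁, hFF], fun m => by rw [← f₂', hFF], fun m => by rw [← f₃, hFF]⟩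

/-- Comparison with the points of the fixed axes shows that a displacement of `v` moves it away from
`E 0` by the same amount in each coordinate; yet the image is no farther from `E 0` than `v`. -/
theorem fix_of_fix_lines (hG : G.Connected) (hH : IsConvex G H)
    (hF : ∀ u v, G.dist (F u) (F v) ≤ G.dist u v)
    (hl : ∀ i m, F (E (Pi.single i m)) = E (Pi.single i m)) (h0 : F (E 0) = E 0) {s v : V}
    (hs : s ∈ H) (hFs : F s = s) (hv : v ∈ interval G (E 0) s) : F v = v := by
  have hvH : v ∈ H := hH _ (hE.mem 0) s hs hv
  rw [mem_interval_iff_dist hG] at hv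
  have hFv := mem_of_between (p := E 0) (q := s) hG hH hF (by rw [h0]; exact hE.mem 0)
    (by rwa [hFs]) (by rw [h0, hFs]) hv
  obtain ⟨t, rfl⟩ := hE.surj v hvH
  obtain ⟨r, hr⟩ := hE.surj _ hFv
  have d0 : ∀ r, (G.dist (E 0) (E r) : ℤ) = ∑ l, cycDist (k l) (r l) := by
    intro r
    rw [dist_comm, hE.dist]
    exact Finset.sum_congr rfl fun l _ => by rw [Pi.zero_apply, sub_zero]
  have hle : ∀ i ∈ Finset.univ, cycDist (k i) (t i) + cycDist (k i) (r i - t i) ≤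
      cycDist (k i) (r i) := by
    intro i _
    have h1 := hF (E t) (E (Pi.single i (t i)))
    rw [hl, ← hr] at h1
    have h2 := hF (E t) s
    rw [hFs, ← hr] at h2
    have h3 := hG.dist_triangle (u := E 0) (v := E r) (w := s)
    have h4 := hE.dist_single t i (t i)
    have h5 := hE.dist_single r i (t i)
    rw [sub_self, cycDist_zero (hE.pos i)] at h4
    have := d0 t
    have := d0 r
    omega
  have hsum := Finset.sum_le_sum hle
  rw [Finset.sum_add_distrib] at hsum
  have h1 := hF (E 0) (E t)
  rw [h0, ← hr] at h1
  have h2 := hE.dist r t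
  have := d0 t
  have := d0 r
  rw [← hr, ← hG.dist_eq_zero_iff]
  omega

end Chart

/-- An idempotent non-expansive map that fixes a metric triangle spanning a hypertorus fixes the
hypertorus. -/
theorem IsEmb.fix_hypertorus {V : Type u} {ι : Type w} {G : SimpleGraph V} {φ : V → ι → Bool}
    (he : IsEmb G φ) (hP : PeanoAxiom G) {F : V → V}
    (hF : ∀ u v, G.dist (F u) (F v) ≤ G.dist u v) (hFF : ∀ v, F (F v) = F v) {x y z : V}
    (hT : IsMetricTriangle G x y z) (hH : IsHypertorus (G.induce (hull G {x, y, z})))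
    (hx : F x = x) (hy : F y = y) (hz : F z = z) {v : V} (hv : v ∈ hull G {x, y, z}) : F v = v := by
  obtain ⟨n, k, hk, -, ⟨e⟩⟩ := hH
  have hG := he.conn
  have hconv := isConvex_hull (G := G) {x, y, z}
  have mx : x ∈ hull G {x, y, z} := subset_hull _ (by simp)
  have my : y ∈ hull G {x, y, z} := subset_hull _ (by simp)
  have mz : z ∈ hull G {x, y, z} := subset_hull _ (by simp)
  obtain ⟨E₀, hE₀, h0⟩ := Chart.exists_of_iso hG hconv (fun i => by have := hk i; omega) e mx
  obtain ⟨E, b, c, hE, h0, rfl, rfl, hb, hc, hbc⟩ :=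
    hE₀.exists_triangle hG hconv h0 my mz subset_rfl hT
  subst h0
  have hl := hE.fix_lines hG hconv hF hFF hb hc hbc hx hy hz
  -- The lines through `E b` fix the side opposite `E 0`. By join-hull every vertex of the torus is
  -- between `E 0` and this side, and the lines through `E 0` finish.
  have hyz : ∀ s ∈ interval G (E b) (E (-c)), F s = s := fun s hs => by
    refine (hE.translate b).fix_of_fix_lines hG hconv hF (fun i m => (hl i).2.1 m)
      (by simpa using hy) mz hz (by simpa using hs)
  obtain ⟨s, hs, hvs⟩ := he.joinHull hP (he.isConvex_interval (E b) (E (-c))) ⟨_, he.left_mem _ _⟩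
    (u := E 0) (y := v) (hull_mono (by
      rintro _ (rfl | rfl | rfl)
      · exact Or.inr rfl
      · exact Or.inl (he.left_mem _ _)
      · exact Or.inl (he.right_mem _ _)) hv)
  exact hE.fix_of_fix_lines hG hconv hF (fun i m => (hl i).1 m) hx (hconv _ my _ mz hs) (hyz s hs) hvs

end FixTorus

/-! ### Retracts of hyper-median partial cubes -/

section HyperMedianRetract

theorem exists_isHyperMedian_minimal {V : Type u} {G : SimpleGraph V} {a b c : V}
    (h : ∃ x y z, IsHyperMedian G a b c x y z) :
    ∃ x y z, IsHyperMedian G a b c x y z ∧ ∀ x' y' z', IsHyperMedian G a b c x' y' z' →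
      G.dist x y + G.dist y z + G.dist z x ≤ G.dist x' y' + G.dist y' z' + G.dist z' x' := by
  classical
  have hex : ∃ n x y z, IsHyperMedian G a b c x y z ∧ G.dist x y + G.dist y z + G.dist z x = n := by
    obtain ⟨x, y, z, h⟩ := h
    exact ⟨_, x, y, z, h, rfl⟩
  obtain ⟨x, y, z, h, hn⟩ := Nat.find_spec hex
  exact ⟨x, y, z, h, fun x' y' z' h' => hn ▸ Nat.find_min' hex ⟨x', y', z', h', rfl⟩⟩

/-- A non-expansive map that fixes a triple without median maps a hyper-median of least perimeter
to a hyper-median. -/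
theorem exists_isHyperMedian_map {V : Type u} {G : SimpleGraph V} (hG : G.Connected)
    (hm : ∀ a b c, HasHyperMedian G a b c) {F : V → V}
    (hF : ∀ u v, G.dist (F u) (F v) ≤ G.dist u v) {a b c : V} (ha : F a = a) (hb : F b = b)
    (hc : F c = c) (hno : ¬ ∃ m, IsMedian G a b c m) :
    ∃ x y z, IsHyperMedian G a b c (F x) (F y) (F z) := by
  obtain ⟨x, y, z, h, hmin⟩ := exists_isHyperMedian_minimal ((hm a b c).resolve_left hno)
  refine ⟨x, y, z, ?_⟩
  have key : ∀ {a b x y : V}, F a = a → F b = b →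
      G.dist a b = G.dist a x + G.dist x y + G.dist y b →
      G.dist a b = G.dist a (F x) + G.dist (F x) (F y) + G.dist (F y) b ∧
        G.dist (F x) (F y) = G.dist x y := by
    intro a b x y ha hb h
    have h1 := hF a x
    have h2 := hF x y
    have h3 := hF y b
    rw [ha] at h1
    rw [hb] at h3
    have t1 := hG.dist_triangle (u := a) (v := F x) (w := b)
    have t2 := hG.dist_triangle (u := F x) (v := F y) (w := b)
    omega
  obtain ⟨-, q1, q2, q3⟩ := h.1
  obtain ⟨e1, p1⟩ := key ha hb q1
  obtain ⟨e2, p2⟩ := key hb hc q2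
  obtain ⟨e3, p3⟩ := key hc ha q3
  -- A median of the image triple would be one of `a, b, c`. A hyper-median of it is one of `a, b,
  -- c` too, and least perimeter forces it to be the image triple.
  rcases hm (F x) (F y) (F z) with ⟨m, m1, m2, m3⟩ | ⟨x', y', z', hq, ht⟩
  · refine absurd ⟨m, ?_, ?_, ?_⟩ hno
    all_goals rw [mem_interval_iff_dist hG] at m1 m2 m3 ⊢
    · have t1 := hG.dist_triangle (u := a) (v := F x) (w := m)
      have t2 := hG.dist_triangle (u := m) (v := F y) (w := b)
      have t3 := hG.dist_triangle (u := a) (v := m) (w := b)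
      omega
    · have t1 := hG.dist_triangle (u := b) (v := F y) (w := m)
      have t2 := hG.dist_triangle (u := m) (v := F z) (w := c)
      have t3 := hG.dist_triangle (u := b) (v := m) (w := c)
      omega
    · have t1 := hG.dist_triangle (u := c) (v := F z) (w := m)
      have t2 := hG.dist_triangle (u := m) (v := F x) (w := a)
      have t3 := hG.dist_triangle (u := c) (v := m) (w := a)
      omega
  · obtain ⟨hmt, r1, r2, r3⟩ := hq
    have split : ∀ {a b p q x' y' : V}, G.dist a b = G.dist a p + G.dist p q + G.dist q b →
        G.dist p q = G.dist p x' + G.dist x' y' + G.dist y' q →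
        G.dist a b = G.dist a x' + G.dist x' y' + G.dist y' b := by
      intro a b p q x' y' h h'
      have t1 := hG.dist_triangle (u := a) (v := p) (w := x')
      have t2 := hG.dist_triangle (u := y') (v := q) (w := b)
      have t3 := hG.dist_triangle (u := a) (v := x') (w := b)
      have t4 := hG.dist_triangle (u := x') (v := y') (w := b)
      omega
    have hh : IsHyperMedian G a b c x' y' z' :=
      ⟨⟨hmt, split e1 r1, split e2 r2, split e3 r3⟩, ht⟩
    have := hmin _ _ _ hh
    have ex : F x = x' := hG.dist_eq_zero_iff.1 (by omega)
    have ey : F y = y' := hG.dist_eq_zero_iff.1 (by omega)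
    have ez : F z = z' := hG.dist_eq_zero_iff.1 (by omega)
    rwa [ex, ey, ez]

theorem isHyperMedianPartialCube_retract : ClosedUnderRetracts.{u} IsHyperMedianPartialCube := by
  rintro V G ⟨hPe, hm⟩ S hr
  refine ⟨isPeanoPartialCube_retract V G hPe S hr, fun a b c => ?_⟩
  obtain ⟨f, hc, hf⟩ := hr
  obtain ⟨ι, φ, he, hP⟩ := isPeanoPartialCube_iff.1 hPe
  have hR := he.retraction hc hf
  by_cases hmed : ∃ m, IsMedian G (a : V) b c m
  · obtain ⟨m, h1, h2, h3⟩ := hmed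
    exact Or.inl ⟨f m, hR.map_interval h1, hR.map_interval h2, hR.map_interval h3⟩
  obtain ⟨x, y, z, hh⟩ := exists_isHyperMedian_map he.conn hm (F := fun v => (f v : V)) hR.dist_le
    (congrArg _ (hf a)) (congrArg _ (hf b)) (congrArg _ (hf c)) hmed
  refine Or.inr ⟨f x, f y, f z, isHyperMedian_induce (fun _ _ _ => hR.mem_interval)
    (fun p q => by rw [← hR.embS.ncard_sep, ← he.ncard_sep]) hh ?_⟩
  have hne : ({f x, f y, f z} : Set S).Nonempty := ⟨f x, by simp⟩
  have hne' : ({(f x : V), (f y : V), (f z : V)} : Set V).Nonempty := ⟨f x, by simp⟩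
  -- Rigidity puts the whole hypertorus inside `S`, so the hull taken in the retract is the same
  -- one.
  have hsub : ∀ v ∈ hull G {(f x : V), (f y : V), (f z : V)}, (f v : V) = v := fun v hv =>
    he.fix_hypertorus hP (F := fun v => (f v : V)) hR.dist_le (fun v => congrArg _ (hf (f v)))
      hh.1.1 hh.2 (congrArg _ (hf _)) (congrArg _ (hf _)) (congrArg _ (hf _)) hv
  have hiff : ∀ v : S, v ∈ hull (G.induce S) {f x, f y, f z} ↔
      (v : V) ∈ hull G {(f x : V), (f y : V), (f z : V)} := fun v => by
    rw [hR.embS.mem_hull hne, he.mem_hull hne']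
    simp
  ext v
  constructor
  · rintro ⟨w, hw, rfl⟩
    exact (hiff w).1 hw
  · intro hv
    have h := hsub v hv
    exact ⟨f v, (hiff _).2 (by rwa [h]), h⟩

end HyperMedianRetract

end PeanoCubes

theorem theoremT :
    (PeanoCubes.IsVariety.{u} PeanoCubes.IsPeanoPartialCube ∧
      PeanoCubes.ClosedUnderConvexSubgraphs.{u} PeanoCubes.IsPeanoPartialCube ∧
      PeanoCubes.ClosedUnderGatedAmalgams.{u} PeanoCubes.IsPeanoPartialCube) ∧
    (PeanoCubes.IsVariety.{u} PeanoCubes.IsHyperMedianPartialCube ∧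
      PeanoCubes.ClosedUnderConvexSubgraphs.{u} PeanoCubes.IsHyperMedianPartialCube ∧
      PeanoCubes.ClosedUnderGatedAmalgams.{u} PeanoCubes.IsHyperMedianPartialCube) := by
  exact ⟨⟨⟨PeanoCubes.isPeanoPartialCube_retract, PeanoCubes.isPeanoPartialCube_product⟩,
    PeanoCubes.isPeanoPartialCube_induce, PeanoCubes.isPeanoPartialCube_amalgam⟩,
    ⟨PeanoCubes.isHyperMedianPartialCube_retract, PeanoCubes.isHyperMedianPartialCube_product⟩,
    PeanoCubes.isHyperMedianPartialCube_induce, PeanoCubes.isHyperMedianPartialCube_amalgam⟩
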